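/- **Conventions.** $\mathbb N=\{1,2,\dots\}$, $\mathbb Z_+=\{0,1,2,\dots\}$; alphabets are finite. A subshift $X\subset\Sigma^{\mathbb Z}$ is a closed shift-invariant set, $\mathcal L(X)$ is its language of admissible words, and $\ell(a)$ is the length of a word $a$. The higher block system $X^{\langle[1,n]\rangle}$ is the image of $X$ under $x\mapsto (x_{[i+1,i+n]})_{i\in\mathbb Z}$. A topological conjugacy is a shift-commuting homeomorphism. A non-empty word $v\in\mathcal L(X)$ is *synchronizing* if $u,w,uv,vw\in\mathcal L(X)$ implies $uvw\in\mathcal L(X)$; $\Sigma_{synchro}(X)$ is the set of synchronizing symbols. $X$ is *strongly synchronizing* if it is topologically transitive (for non-empty relatively open $U,V\subset X$ some forward image of $U$ under the shift meets $V$), has a synchronizing word, and there is $Q\in\mathbb Z_+$ such that whenever $x\in X$ and $x_{[I_-,I_+]}$ is synchronizing, some $x_i$ with $I_--Q\le i\le I_++Q$ is a synchronizing symbol. **Markov codes.** A Markov code is a set $\mathcal C$ of words with maps $s,t:\mathcal C\to\Gamma$ into a finite set and a $0$-$1$ matrix $A$ on $\Gamma$. Its Markov coded system $scM(\mathcal C)$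 is the closure of the set of points $x$ for which there are integers $i_k<i_{k+1}$ $(k\in\mathbb Z)$ with $x_{[i_k,i_{k+1})}\in\mathcal C$ and $A(t(x_{[i_{k-1},i_k)}),s(x_{[i_k,i_{k+1})}))=1$. In all Markov codes below $\Gamma$ is the set of subsets of $\Sigma$, $s(c)$ is the singleton of the first symbol of $c$, and $A(S,T)=1$ iff $T=\{\sigma\}$ with $\sigma\in S$; such a code is given by its words and the sets $t(c)$. In the codes $\bigcup_\sigma \mathcal C(\sigma)$ below, $t(c)=\{\sigma\mid c\in\mathcal C(\sigma)\}$; unions of such codes, and their parts of prescribed word lengths, are formed with $\sigma$ fixed. **Characteristic pair.** A characteristic pair of $X$ is a pair of fixed points $((\alpha_-)_{i\in\mathbb Z},(\alpha_+)_{i\in\mathbb Z})$ of $X$ that is the only pair of fixed points satisfying: (a) the points of $X$ that are left asymptotic to $(\alpha_-)$, right asymptotic to $(\alpha_+)$ and contain no synchronizing word form exactly one orbit $O_X$; (b) some point of $X$ that is left asymptotic to $(\alpha_+)$ and right asymptotic to $(\alpha_-)$ contains a synchronizing word; $(c^-)$ there is $K$ such that, if $x\in X$ is right asymptotic to $(\alpha_-)$,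 $x_{[I_-,I_+]}$ is synchronizing and no $x_{(I_+,I_++k]}$, $k\in\mathbb N$, is synchronizing, then for some $i$ with $I_-<i\le I_++K$ one has $x_j=\alpha_-$ for all $j\ge i$; $(c^+)$ the time-symmetric condition for $\alpha_+$. The points of $O_X$ then have the form $\alpha_-^\infty c_X\alpha_+^\infty$ for a unique word $c_X$ that is empty, or does not begin with $\alpha_-$ and does not end with $\alpha_+$. **Notation.** For $\sigma\in\Sigma_{synchro}(X)$ and a symbol $a$, let $\mathcal D(\sigma,a)$ (resp. $\mathcal D(a,\sigma)$) be the set of (possibly empty) admissible words $d$ without synchronizing symbols that do not end (resp. begin) with $a$ and satisfy $\sigma d a^k\in\mathcal L(X)$ (resp. $a^kd\sigma\in\mathcal L(X)$) for all $k\in\mathbb N$. Let $E_-$ be the set of words $\sigma_-d^-$ with $d^-\in\mathcal D(\sigma_-,\alpha_-)$, let $\Sigma_-^+(X)=\{\sigma\mid\mathcal D(\sigma,\alpha_+)\neq\emptyset\}$, and let $\Omega^{\pm}(X)$ be the set of words $d\sigma$ with $d\in\mathcal D(\alpha_\pm,\sigma)$. Let $\Omega^+_{reset}(X)$ be the set of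 $w\in\Omega^+(X)$ for which there is $D\in\mathbb Z_+$ with $\alpha_-^{k_-}c_X\alpha_+^{k_++D}w\in\mathcal L(X)$ for all $k_-,k_+\in\mathbb N$, the smallest such $D$ being $D(w)$. Put $\Omega^+_{counter}(X)=\Omega^+(X)\setminus\Omega^+_{reset}(X)$ and $\Omega^-_{reset}(X)=\{c_X\alpha_+^{k_++D(w)}w\mid w\in\Omega^+_{reset}(X),k_+\in\mathbb N\}$. The *reset condition* says that $\Omega^-(X)\setminus\Omega^-_{reset}(X)$ is finite. Parameters are $M_\pm,J_\pm\in\mathbb Z_+$ and maps $D_-:E_-\to\mathbb Z_+$, $D_+:\Omega^+_{reset}(X)\to\mathbb Z_+$, and $\Delta_-$ on $E_-$, $\Delta_+$ on $\Omega^+_{counter}(X)$ whose values are non-empty finite subsets of $\mathbb Z_+$. For a synchronizing symbol $\sigma$, and with $e\in E_-$ and $k_-,k_+\in\mathbb N$, let - $\mathcal C_-(\sigma)=\{e\,\alpha_-^{k_-}d\mid d\sigma\in\Omega^-(X)\setminus\Omega^-_{reset}(X)\}$, - $\mathcal C_{reset}(\sigma)=\{e\,\alpha_-^{k_-}c_X\alpha_+^{k_++D(d\sigma)}d\mid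 d\sigma\in\Omega^+_{reset}(X),\ D_-(e)+k_-+M_-\ge M_++k_++D_+(d\sigma)\}$, - $\mathcal C_{counter}(\sigma)=\{e\,\alpha_-^{k_-}c_X\alpha_+^{k_+}d\mid d\sigma\in\Omega^+_{counter}(X),\ (\Delta_-(e)+k_-+J_-)\cap(J_++k_++\Delta_+(d\sigma))\ne\emptyset\}$. Let $\mathcal C_-,\mathcal C_{reset},\mathcal C_{counter}$ be the unions over $\sigma$. Let $\mathcal C(X)$ be the Markov code of the admissible words $c$ that begin with a synchronizing symbol, contain no other one, and can be followed by one, where $t(c)$ is the set of synchronizing symbols that can follow $c$. **Standard one-counter shifts.** $X$ is a *standard one-counter shift* if it is strongly synchronizing, has a characteristic pair of fixed points, $\Sigma_-^+(X)=\emptyset$, the reset condition holds, and there are $I\in\mathbb Z_+$ and parameters such that the words of length $>I$ in $\mathcal C(X)$ and in $\mathcal C_-\cup\mathcal C_{reset}\cup\mathcal C_{counter}$ form the same Markov code. Let $I_X$ be the smallest such $I$. A *canonical Markov code* $\mathcal C^{(X)}$ consists of the words of $\mathcal C(X)$ of length $\le I_X$ and of the words of length $>I_X$ of $\mathcal C_-\cup\mathcal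 C_{reset}\cup\mathcal C_{counter}$ for parameters that are possible with $I=I_X$ and normalized by $\min(M_-,M_+)=\min D_-=\min D_+=0$ if $\Omega^+_{reset}(X)\neq\emptyset$, and $\min(J_-,J_+)=\min\bigcup_e\Delta_-(e)=\min\bigcup_w\Delta_+(w)=0$ if $\Omega^+_{counter}(X)\ne\emptyset$. **Theorem.** Let $X\subset\Sigma^{\mathbb Z}$ be a subshift that is topologically conjugate to a standard one-counter shift. Then there is $n_0\in\mathbb N$ such that for all $n\ge n_0$ the higher block system $X^{\langle[1,n]\rangle}$ is a standard one-counter shift, it has a canonical Markov code, and $$X^{\langle[1,n]\rangle}=scM\big(\mathcal C^{(X^{\langle[1,n]\rangle})}\big)$$ for every canonical Markov code $\mathcal C^{(X^{\langle[1,n]\rangle})}$ of it. -/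

import Mathlib

open SymbolicDynamics.FullShift

namespace OneCounter

section Words

variable {A : Type*}

/-- The word of length `n` carried by `x` at the coordinates `i, i + 1, …, i + n - 1`. -/
def block (x : ℤ → A) (i : ℤ) (n : ℕ) : List A :=
  List.ofFn fun k : Fin n => x (i + (k : ℕ))

/-- `x` is left asymptotic to the fixed point all of whose coordinates are `a`. -/
def LeftAsymptotic (x : ℤ → A) (a : A) : Prop := ∃ N : ℤ, ∀ i ≤ N, x i = a

/-- `x` is right asymptotic to the fixed point all of whose coordinates are `a`. -/
def RightAsymptotic (x : ℤ → A) (a : A) : Prop := ∃ N : ℤ, ∀ i ≥ N, x i = a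

theorem block_shift (x : ℤ → A) (g i : ℤ) (n : ℕ) :
    block (shift g x) i n = block x (g + i) n := by
  simp [block, add_assoc]

end Words

section Conjugacy

variable {A B : Type*} [TopologicalSpace A] [TopologicalSpace B]

/-- Topological conjugacy of subshifts: a shift-commuting homeomorphism between them. -/
def TopologicallyConjugate (X : Subshift A ℤ) (Y : Subshift B ℤ) : Prop :=
  ∃ φ : X.carrier ≃ₜ Y.carrier, ∀ x : X.carrier,
    φ ⟨shift 1 x.1, X.mapsTo 1 x.2⟩ = ⟨shift 1 (φ x).1, Y.mapsTo 1 (φ x).2⟩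

end Conjugacy

section HigherBlock

variable {A : Type*}

/-- The map `x ↦ (x_{[i+1,i+n]})_{i ∈ ℤ}`. -/
def blockMap (n : ℕ) (x : ℤ → A) : ℤ → (Fin n → A) :=
  fun i k => x (i + 1 + (k : ℕ))

variable [TopologicalSpace A]

theorem continuous_blockMap (n : ℕ) : Continuous (blockMap (A := A) n) := by
  unfold blockMap
  fun_prop

/-- The higher block system `X^{⟨[1,n]⟩}`. -/
def higherBlock [Finite A] [DiscreteTopology A] (X : Subshift A ℤ) (n : ℕ) :
    Subshift (Fin n → A) ℤ where
  carrier := blockMap n '' X.carrier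
  isClosed := (X.isClosed.isCompact.image (continuous_blockMap n)).isClosed
  mapsTo := by
    rintro g _ ⟨x, hx, rfl⟩
    refine ⟨shift g x, X.mapsTo g hx, ?_⟩
    funext i k
    simp [blockMap, add_assoc]

end HigherBlock

section MarkovCodes

/-- A Markov code over the alphabet `A` with the finite index set `Γ`: a set of words,
with a source and a target map (only their values on the words of the code matter), and
a 0-1 transition matrix on `Γ`. -/
structure MarkovCode (A Γ : Type*) where
  words : Set (List A)
  s : List A → Γ
  t : List A → Γ
  trans : Γ → Γ → Prop
  finite_index : Finite Γ

variable {A Γ : Type*}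

/-- The points that carry a bi-infinite concatenation of words of the code
that is compatible with the transition matrix. -/
def MarkovCode.points (C : MarkovCode A Γ) : Set (ℤ → A) :=
  {x | ∃ i : ℤ → ℤ, StrictMono i ∧
    (∀ k : ℤ, block x (i k) (i (k + 1) - i k).toNat ∈ C.words) ∧
    ∀ k : ℤ, C.trans (C.t (block x (i (k - 1)) (i k - i (k - 1)).toNat))
      (C.s (block x (i k) (i (k + 1) - i k).toNat))}

theorem MarkovCode.shift_mem_points (C : MarkovCode A Γ) (g : ℤ) {x : ℤ → A}
    (hx : x ∈ C.points) : shift g x ∈ C.points := by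
  obtain ⟨i, hi, hw, ht⟩ := hx
  refine ⟨fun k => i k - g, fun a b h => sub_lt_sub_right (hi h) g, fun k => ?_, fun k => ?_⟩
  · simpa [block_shift] using hw k
  · simpa [block_shift] using ht k

/-- The Markov coded system `scM(C)`: the closure of the set of these points. -/
def MarkovCode.codedSystem [TopologicalSpace A] (C : MarkovCode A Γ) : Subshift A ℤ where
  carrier := closure C.points
  isClosed := isClosed_closure
  mapsTo := fun g => Set.MapsTo.closure (fun _ hx => C.shift_mem_points g hx)
    (continuous_shift g)

/-- The Markov code with the words `w` for which `(w, σ) ∈ R` for some symbol `σ`, where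
`t(w) = {σ | (w, σ) ∈ R}`, where `s(w)` is the singleton of the first symbol of `w`, and where
`S` can be followed by `T` if and only if `T = {σ}` for some `σ ∈ S`. The index set is the set of
subsets of the alphabet. Two such codes are equal if and only if the relations `R` are. -/
def followerCode [Finite A] (R : Set (List A × A)) : MarkovCode A (Set A) where
  words := {w | ∃ σ, (w, σ) ∈ R}
  s := fun w => {a | w.head? = some a}
  t := fun w => {σ | (w, σ) ∈ R}
  trans := fun S T => ∃ σ ∈ S, T = {σ}
  finite_index := inferInstance

end MarkovCodes

section Synchronization

variable {A : Type*} [TopologicalSpace A]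

/-- The language of admissible words of `X`. -/
def language (X : Subshift A ℤ) : Set (List A) :=
  {w | ∃ x ∈ X.carrier, ∃ i : ℤ, block x i w.length = w}

/-- Synchronizing (non-empty) words. -/
def IsSynchronizing (X : Subshift A ℤ) (v : List A) : Prop :=
  v ≠ [] ∧ v ∈ language X ∧ ∀ u ∈ language X, ∀ w ∈ language X,
    u ++ v ∈ language X → v ++ w ∈ language X → u ++ v ++ w ∈ language X

/-- The set of synchronizing symbols. -/
def synchro (X : Subshift A ℤ) : Set A := {σ | IsSynchronizing X [σ]}

def ContainsSynchronizingWord (X : Subshift A ℤ) (x : ℤ → A) : Prop :=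
  ∃ (i : ℤ) (n : ℕ), IsSynchronizing X (block x i n)

def IsTopologicallyTransitive (X : Subshift A ℤ) : Prop :=
  ∀ U V : Set (ℤ → A), IsOpen U → IsOpen V → (X.carrier ∩ U).Nonempty →
    (X.carrier ∩ V).Nonempty → ∃ n : ℕ, ∃ x ∈ X.carrier ∩ U, shift (n : ℤ) x ∈ V

/-- Strongly synchronizing subshifts: topologically transitive, with a synchronizing word, and
with synchronizing symbols uniformly close to all occurrences `x_{[i,i+n-1]}` of
synchronizing words. -/
def IsStronglySynchronizing (X : Subshift A ℤ) : Prop :=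
  IsTopologicallyTransitive X ∧ (∃ v, IsSynchronizing X v) ∧
    ∃ Q : ℕ, ∀ x ∈ X.carrier, ∀ (i : ℤ) (n : ℕ), IsSynchronizing X (block x i n) →
      ∃ j : ℤ, i - Q ≤ j ∧ j ≤ i + n - 1 + Q ∧ x j ∈ synchro X

end Synchronization

section CharacteristicPair

variable {A : Type*} [TopologicalSpace A]

/-- The points that are left asymptotic to `(α₋)`, right asymptotic to `(α₊)`, and that do not
contain a synchronizing word. -/
def connectingPoints (X : Subshift A ℤ) (am ap : A) : Set (ℤ → A) :=
  {x | x ∈ X.carrier ∧ LeftAsymptotic x am ∧ RightAsymptotic x ap ∧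
    ¬ ContainsSynchronizingWord X x}

/-- Condition (a): there is exactly one orbit of connecting points. -/
def ConditionA (X : Subshift A ℤ) (am ap : A) : Prop :=
  (connectingPoints X am ap).Nonempty ∧
    ∀ x ∈ connectingPoints X am ap, ∀ y ∈ connectingPoints X am ap, ∃ g : ℤ, y = shift g x

/-- Condition (b): a point from `(α₊)` to `(α₋)` contains a synchronizing word. -/
def ConditionB (X : Subshift A ℤ) (am ap : A) : Prop :=
  ∃ x ∈ X.carrier, LeftAsymptotic x ap ∧ RightAsymptotic x am ∧ ContainsSynchronizingWord X x

/-- Condition (c⁻), with `[I₋, I₊] = [i, i + n - 1]`. -/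
def ConditionCMinus (X : Subshift A ℤ) (am : A) : Prop :=
  ∃ K : ℕ, ∀ x ∈ X.carrier, RightAsymptotic x am → ∀ (i : ℤ) (n : ℕ),
    IsSynchronizing X (block x i n) →
    (∀ k : ℕ, 1 ≤ k → ¬ IsSynchronizing X (block x (i + n) k)) →
    ∃ j : ℤ, i < j ∧ j ≤ i + n - 1 + K ∧ ∀ l ≥ j, x l = am

/-- Condition (c⁺), the time-symmetric condition, with `[I₋, I₊] = [i, i + n - 1]`. -/
def ConditionCPlus (X : Subshift A ℤ) (ap : A) : Prop :=
  ∃ K : ℕ, ∀ x ∈ X.carrier, LeftAsymptotic x ap → ∀ (i : ℤ) (n : ℕ),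
    IsSynchronizing X (block x i n) →
    (∀ k : ℕ, 1 ≤ k → ¬ IsSynchronizing X (block x (i - k) k)) →
    ∃ j : ℤ, i - K ≤ j ∧ j < i + n - 1 ∧ ∀ l ≤ j, x l = ap

/-- A pair of fixed points that satisfies (a), (b), (c⁻) and (c⁺). -/
def SatisfiesABC (X : Subshift A ℤ) (am ap : A) : Prop :=
  (fun _ => am) ∈ X.carrier ∧ (fun _ => ap) ∈ X.carrier ∧
    ConditionA X am ap ∧ ConditionB X am ap ∧ ConditionCMinus X am ∧ ConditionCPlus X ap

/-- A characteristic pair of fixed points `((α₋), (α₊))`: the unique pair with these properties. -/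
def IsCharacteristicPair (X : Subshift A ℤ) (am ap : A) : Prop :=
  SatisfiesABC X am ap ∧ ∀ bm bp : A, SatisfiesABC X bm bp → bm = am ∧ bp = ap

/-- `c` is the word `c_X`: the points of the orbit `O_X` have the form `α₋^∞ c α₊^∞`, where `c` is
empty, or does not begin with `α₋` and does not end with `α₊`. -/
def IsConnectingWord (X : Subshift A ℤ) (am ap : A) (c : List A) : Prop :=
  c.head? ≠ some am ∧ c.getLast? ≠ some ap ∧
    ∃ x ∈ connectingPoints X am ap, ∃ i : ℤ, (∀ j < i, x j = am) ∧
      block x i c.length = c ∧ ∀ j ≥ i + c.length, x j = ap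

end CharacteristicPair

section Counter

variable {A : Type*} [TopologicalSpace A]

/-- `D(σ, a)`, for a synchronizing symbol `σ` on the left of a symbol `a`. -/
def stemsRight (X : Subshift A ℤ) (σ a : A) : Set (List A) :=
  {d | d ∈ language X ∧ (∀ τ ∈ d, τ ∉ synchro X) ∧ d.getLast? ≠ some a ∧
    ∀ k : ℕ, 1 ≤ k → σ :: d ++ List.replicate k a ∈ language X}

/-- `D(a, σ)`, for a synchronizing symbol `σ` on the right of a symbol `a`. -/
def stemsLeft (X : Subshift A ℤ) (a σ : A) : Set (List A) :=
  {d | d ∈ language X ∧ (∀ τ ∈ d, τ ∉ synchro X) ∧ d.head? ≠ some a ∧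
    ∀ k : ℕ, 1 ≤ k → List.replicate k a ++ d ++ [σ] ∈ language X}

/-- `Σ₋⁺(X)`, the set of synchronizing symbols `σ` with `D(σ, α₊) ≠ ∅`. -/
def sigmaMinusPlus (X : Subshift A ℤ) (ap : A) : Set A :=
  {σ | σ ∈ synchro X ∧ (stemsRight X σ ap).Nonempty}

/-- The set of the words `σ₋ d⁻`, where `σ₋ ∈ Σ₋(X)` and `d⁻ ∈ D(σ₋, α₋)`. -/
def entries (X : Subshift A ℤ) (am : A) : Set (List A) :=
  {w | ∃ σ d, σ ∈ synchro X ∧ d ∈ stemsRight X σ am ∧ w = σ :: d}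

/-- The set of the words `d σ` with a synchronizing symbol `σ` and `d ∈ D(a, σ)`. This is
`Ω⁺(X)` for `a = α₊`, and `Ω⁻(X)` for `a = α₋`. -/
def exits (X : Subshift A ℤ) (a : A) : Set (List A) :=
  {w | ∃ σ d, σ ∈ synchro X ∧ d ∈ stemsLeft X a σ ∧ w = d ++ [σ]}

/-- All words `α₋^{k₋} c α₊^{k₊ + D} w` with `k₋, k₊ ≥ 1` are admissible. -/
def ResetsFrom (X : Subshift A ℤ) (am ap : A) (c w : List A) (D : ℕ) : Prop :=
  ∀ km kp : ℕ, 1 ≤ km → 1 ≤ kp →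
    List.replicate km am ++ c ++ List.replicate (kp + D) ap ++ w ∈ language X

/-- `Ω⁺_reset(X)`. -/
def resetExits (X : Subshift A ℤ) (am ap : A) (c : List A) : Set (List A) :=
  {w | w ∈ exits X ap ∧ ∃ D, ResetsFrom X am ap c w D}

/-- `D(w)` for `w ∈ Ω⁺_reset(X)`: the smallest `D` in the definition of `Ω⁺_reset(X)`. -/
noncomputable def resetDelay (X : Subshift A ℤ) (am ap : A) (c w : List A) : ℕ :=
  sInf {D | ResetsFrom X am ap c w D}

/-- `Ω⁺_counter(X)`. -/
def counterExits (X : Subshift A ℤ) (am ap : A) (c : List A) : Set (List A) :=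
  exits X ap \ resetExits X am ap c

/-- `Ω⁻_reset(X)`. -/
def resetMinusExits (X : Subshift A ℤ) (am ap : A) (c : List A) : Set (List A) :=
  {v | ∃ w ∈ resetExits X am ap c, ∃ kp : ℕ, 1 ≤ kp ∧
    v = c ++ List.replicate (kp + resetDelay X am ap c w) ap ++ w}

/-- The reset condition. -/
def ResetCondition (X : Subshift A ℤ) (am ap : A) (c : List A) : Prop :=
  (exits X am \ resetMinusExits X am ap c).Finite

/-- The Markov code `C(X)`, as a relation: `(w, σ)` belongs to it if `w` begins with a
synchronizing symbol, contains no other one, and can be followed by the synchronizing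
symbol `σ`. -/
def synchroRel (X : Subshift A ℤ) : Set (List A × A) :=
  {p | (∃ σ d, p.1 = σ :: d ∧ σ ∈ synchro X ∧ ∀ τ ∈ d, τ ∉ synchro X) ∧
    p.2 ∈ synchro X ∧ p.1 ++ [p.2] ∈ language X}

/-- The words of `C₋^{(X)}(σ)`, paired with `σ`. -/
def minusRel (X : Subshift A ℤ) (am ap : A) (c : List A) : Set (List A × A) :=
  {p | ∃ e ∈ entries X am, ∃ d, d ++ [p.2] ∈ exits X am \ resetMinusExits X am ap c ∧
    ∃ km : ℕ, 1 ≤ km ∧ p.1 = e ++ List.replicate km am ++ d}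

/-- Parameters `D₋, M₋, M₊, D₊, Δ₋, J₋, J₊, Δ₊`. Only the values of `D₋, Δ₋` on the words `σ₋ d⁻`,
of `D₊` on `Ω⁺_reset(X)`, and of `Δ₊` on `Ω⁺_counter(X)` matter. -/
structure Parameters (A : Type*) where
  Dm : List A → ℕ
  Mm : ℕ
  Mp : ℕ
  Dp : List A → ℕ
  Δm : List A → Finset ℕ
  Jm : ℕ
  Jp : ℕ
  Δp : List A → Finset ℕ

/-- The values of `Δ₋` and `Δ₊` are non-empty finite sets of non-negative integers. -/
def Parameters.IsProper (P : Parameters A) (X : Subshift A ℤ) (am ap : A) (c : List A) : Prop :=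
  (∀ e ∈ entries X am, (P.Δm e).Nonempty) ∧ ∀ w ∈ counterExits X am ap c, (P.Δp w).Nonempty

/-- The words of `C_reset^{(X)}(D₋, M₋, M₊, D₊; σ)`, paired with `σ`. -/
def resetRel (X : Subshift A ℤ) (am ap : A) (c : List A) (P : Parameters A) :
    Set (List A × A) :=
  {p | ∃ e ∈ entries X am, ∃ d, d ++ [p.2] ∈ resetExits X am ap c ∧
    ∃ km kp : ℕ, 1 ≤ km ∧ 1 ≤ kp ∧
      P.Mp + kp + P.Dp (d ++ [p.2]) ≤ P.Dm e + km + P.Mm ∧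
      p.1 = e ++ List.replicate km am ++ c ++
        List.replicate (kp + resetDelay X am ap c (d ++ [p.2])) ap ++ d}

/-- The words of `C_counter^{(X)}(Δ₋, J₋, J₊, Δ₊; σ)`, paired with `σ`. -/
def counterRel (X : Subshift A ℤ) (am ap : A) (c : List A) (P : Parameters A) :
    Set (List A × A) :=
  {p | ∃ e ∈ entries X am, ∃ d, d ++ [p.2] ∈ counterExits X am ap c ∧
    ∃ km kp : ℕ, 1 ≤ km ∧ 1 ≤ kp ∧
      (∃ δ ∈ P.Δm e, ∃ δ' ∈ P.Δp (d ++ [p.2]), δ + km + P.Jm = P.Jp + kp + δ') ∧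
      p.1 = e ++ List.replicate km am ++ c ++ List.replicate kp ap ++ d}

/-- The Markov code `C₋ ∪ C_reset ∪ C_counter`, as a relation. -/
def parameterRel (X : Subshift A ℤ) (am ap : A) (c : List A) (P : Parameters A) :
    Set (List A × A) :=
  minusRel X am ap c ∪ resetRel X am ap c P ∪ counterRel X am ap c P

/-- `I` and `P` are parameters of `X`: the words of length larger than `I` form the same
Markov code in `C(X)` and in `C₋ ∪ C_reset ∪ C_counter`. -/
def AreParameters [Finite A] (X : Subshift A ℤ) (am ap : A) (c : List A) (I : ℕ)
    (P : Parameters A) : Prop :=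
  P.IsProper X am ap c ∧
    followerCode {p | p ∈ synchroRel X ∧ I < p.1.length} =
      followerCode {p | p ∈ parameterRel X am ap c P ∧ I < p.1.length}

/-- Standard one-counter shifts. -/
def IsStandardOneCounterShift [Finite A] (X : Subshift A ℤ) : Prop :=
  IsStronglySynchronizing X ∧ ∃ am ap : A, ∃ c : List A,
    IsCharacteristicPair X am ap ∧ IsConnectingWord X am ap c ∧
    sigmaMinusPlus X ap = ∅ ∧ ResetCondition X am ap c ∧
    ∃ (I : ℕ) (P : Parameters A), AreParameters X am ap c I P

/-- The normalization of the parameters; the parameters `D₋, M₋, M₊, D₊` are missing if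
`Ω⁺_reset(X)` is empty, and `Δ₋, J₋, J₊, Δ₊` are missing if `Ω⁺_counter(X)` is empty. -/
def Parameters.IsNormalized (P : Parameters A) (X : Subshift A ℤ) (am ap : A) (c : List A) :
    Prop :=
  ((resetExits X am ap c).Nonempty →
    min P.Mm P.Mp = 0 ∧ (∃ e ∈ entries X am, P.Dm e = 0) ∧
      ∃ w ∈ resetExits X am ap c, P.Dp w = 0) ∧
  ((counterExits X am ap c).Nonempty →
    min P.Jm P.Jp = 0 ∧ (∃ e ∈ entries X am, 0 ∈ P.Δm e) ∧
      ∃ w ∈ counterExits X am ap c, 0 ∈ P.Δp w)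

/-- `C` is the canonical Markov code `C^{(X)}` of the standard one-counter shift `X`. Its words of
length at most `I_X` are those of `C(X)`, the longer ones are given by normalized parameters
of `X`, where `I_X` is the smallest `I` that is possible in parameters of `X`. -/
def IsCanonicalMarkovCode [Finite A] (X : Subshift A ℤ) (C : MarkovCode A (Set A)) : Prop :=
  IsStandardOneCounterShift X ∧ ∃ (am ap : A) (c : List A) (I : ℕ) (P : Parameters A),
    IsCharacteristicPair X am ap ∧ IsConnectingWord X am ap c ∧
    IsLeast {J | ∃ P' : Parameters A, AreParameters X am ap c J P'} I ∧
    AreParameters X am ap c I P ∧ P.IsNormalized X am ap c ∧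
    C = followerCode ({p | p ∈ synchroRel X ∧ p.1.length ≤ I} ∪
      {p | p ∈ parameterRel X am ap c P ∧ I < p.1.length})

end Counter

end OneCounter

/-! A strongly synchronizing subshift `X` is the coded system of its own code `C(X)`. A point with
synchronizing symbols arbitrarily far to the left and to the right is a concatenation of words of
`C(X)`, and such points are dense because transitivity produces periodic ones (`eq_codedSystem`). A
canonical code has the short words of `C(X)` by definition and the long ones by the choice of the
parameters, so it equals `C(X)`. The final equation therefore needs strong synchronization only. A
canonical code exists because the least `I` can be taken and the parameters can be normalized by
moving minima from one to another (`exists_normalized`). The substance is that the higher block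
systems of high order are standard one-counter shifts.

Let the conjugacy of `X` with the standard shift `Y` have radius `r`. A synchronizing symbol of `Y`
makes a window of `4 * r + 1` coordinates synchronizing in `X`, and for `n ≥ 4 * r + 1` this window
fits into one symbol of the higher block system (`IsConj.synchro_blockMap`), which is therefore
strongly synchronizing. Between strongly synchronizing subshifts a conjugacy moves synchronizing
symbols by a bounded distance (`IsSyncConj`). The conditions on the characteristic pair and on
`Σ₋⁺`, once expressed by points and synchronizing symbols, carry over.

The counter is transported through `HasCounterStructure`: for large exponents, admissibility of `e
α₋^km c α₊^kp w` is an inequality or an equation between `km` and `kp`, with offsets that belong to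
`e` and to `w` separately. `IsBase.hasCounterStructure` and `IsBase.exists_areParameters` translate
between this and actual parameters. Since `e` begins and `w` ends with a synchronizing symbol, the
word is admissible exactly if a point glued from an entry point, the connecting point and an exit
point lies in the subshift. A conjugacy maps glued points to glued points; it changes `km` by a
constant depending on `e` alone and `kp` by one depending on `w` alone (`IsBaseConj.map_join_arc`),
and the offsets absorb both. It remains that long exit words at `α₋` are reset words
(`IsBaseConj.reset`) and that long words of `C(X)` have the required shape (`IsBaseConj.long`). -/

namespace OneCounter

/-! ### Words of a sequence on integer intervals. -/

section Segments

variable {A : Type*}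

@[simp] theorem length_block (x : ℤ → A) (i : ℤ) (n : ℕ) : (block x i n).length = n := by
  simp [block]

theorem block_eq_iff {x : ℤ → A} {i : ℤ} {n : ℕ} {w : List A} :
    block x i n = w ↔ w.length = n ∧ ∀ k (hk : k < w.length), x (i + k) = w[k] := by
  constructor
  · rintro rfl
    simp [block]
  · rintro ⟨rfl, h⟩
    apply List.ext_getElem (by simp)
    intro k h1 h2
    simp [block, h k h2]

theorem block_congr {x y : ℤ → A} {i j : ℤ} {n : ℕ} (h : ∀ k : ℕ, k < n → x (i + k) = y (j + k)) :
    block x i n = block y j n := by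
  rw [block_eq_iff]
  refine ⟨by simp, fun k hk => ?_⟩
  simp [block] at hk ⊢
  exact h k hk

theorem eq_of_block_eq {x y : ℤ → A} {i j : ℤ} {n : ℕ} (h : block x i n = block y j n)
    {k : ℕ} (hk : k < n) : x (i + k) = y (j + k) := by
  rw [block_eq_iff] at h
  have := h.2 k (by simpa using hk)
  simpa [block] using this

/-- The word of `x` on the interval `[i, j)`. -/
def seg (x : ℤ → A) (i j : ℤ) : List A := block x i (j - i).toNat

theorem length_seg (x : ℤ → A) {i j : ℤ} (h : i ≤ j) : ((seg x i j).length : ℤ) = j - i := by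
  simp [seg, h]

@[simp] theorem seg_self (x : ℤ → A) (i : ℤ) : seg x i i = [] := by
  simp [seg, block]

theorem block_eq_seg (x : ℤ → A) (i : ℤ) (n : ℕ) : block x i n = seg x i (i + n) := by
  simp [seg]

theorem seg_append (x : ℤ → A) {i j k : ℤ} (h : i ≤ j) (h' : j ≤ k) :
    seg x i j ++ seg x j k = seg x i k := by
  obtain ⟨m, rfl⟩ := Int.le.dest h
  obtain ⟨n, rfl⟩ := Int.le.dest h'
  symm
  simp only [seg]
  rw [block_eq_iff]
  refine ⟨by simp; omega, fun l hl => ?_⟩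
  rw [List.getElem_append]
  split_ifs with h1
  · simp [block]
  · simp [block] at h1 ⊢
    congr 1
    omega

theorem seg_congr {x y : ℤ → A} {i j d : ℤ} (h : ∀ l, i ≤ l → l < j → x l = y (l + d)) :
    seg x i j = seg y (i + d) (j + d) := by
  have e : j + d - (i + d) = j - i := by ring
  simp only [seg, e]
  refine block_congr fun k hk => ?_
  rw [h _ (by omega) (by omega)]
  congr 1; ring

theorem seg_congr' {x y : ℤ → A} {i j : ℤ} (h : ∀ l, i ≤ l → l < j → x l = y l) :
    seg x i j = seg y i j := by
  simpa using seg_congr (d := 0) (by simpa using h)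

theorem eq_of_seg_eq {x y : ℤ → A} {i j i' j' : ℤ} (h : seg x i j = seg y i' j')
    {l : ℤ} (h1 : i ≤ l) (h2 : l < j) : x l = y (l - i + i') := by
  have hl := congrArg List.length h
  simp only [seg, length_block] at hl
  rw [seg, seg, ← hl] at h
  have := eq_of_block_eq h (k := (l - i).toNat) (by omega)
  have e : ((l - i).toNat : ℤ) = l - i := by omega
  rw [e] at this
  rw [show l = i + (l - i) by ring, this]
  congr 1; ring

theorem eq_of_seg_eq' {x y : ℤ → A} {i j : ℤ} (h : seg x i j = seg y i j)
    {l : ℤ} (h1 : i ≤ l) (h2 : l < j) : x l = y l := by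
  simpa using eq_of_seg_eq h h1 h2

theorem seg_eq_replicate {x : ℤ → A} {i j : ℤ} {a : A} (h : ∀ l, i ≤ l → l < j → x l = a) :
    seg x i j = List.replicate (j - i).toNat a := by
  rw [seg, block_eq_iff]
  refine ⟨by simp, fun k hk => ?_⟩
  simp at hk
  simp [h (i + k) (by omega) (by omega)]

theorem eq_of_seg_eq_replicate {x : ℤ → A} {i j : ℤ} {n : ℕ} {a : A}
    (h : seg x i j = List.replicate n a) {l : ℤ} (h1 : i ≤ l) (h2 : l < j) : x l = a := by
  rw [seg, block_eq_iff] at h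
  have := h.2 (l - i).toNat (by simp at h ⊢; omega)
  simp at this
  rw [← this]; congr 1; omega

theorem seg_succ (x : ℤ → A) (i : ℤ) : seg x i (i + 1) = [x i] := by
  simp [seg, block]

theorem seg_cons (x : ℤ → A) {i j : ℤ} (h : i < j) : seg x i j = x i :: seg x (i + 1) j := by
  rw [← seg_append x (show i ≤ i + 1 by omega) (by omega), seg_succ]; rfl

theorem seg_concat (x : ℤ → A) {i j : ℤ} (h : i ≤ j) : seg x i (j + 1) = seg x i j ++ [x j] := by
  rw [← seg_append x h (by omega), seg_succ]

theorem seg_shift (x : ℤ → A) (g i j : ℤ) : seg (shift g x) i j = seg x (g + i) (g + j) := by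
  simp [seg, block_shift]

theorem mem_seg {x : ℤ → A} {i j : ℤ} {a : A} : a ∈ seg x i j ↔ ∃ l, i ≤ l ∧ l < j ∧ x l = a := by
  simp only [seg, block, List.mem_ofFn]
  constructor
  · rintro ⟨k, rfl⟩
    exact ⟨i + (k : ℕ), by omega, by omega, rfl⟩
  · rintro ⟨l, h1, h2, rfl⟩
    exact ⟨⟨(l - i).toNat, by omega⟩, by simp; congr 1; omega⟩

theorem head?_seg (x : ℤ → A) {i j : ℤ} (h : i < j) : (seg x i j).head? = some (x i) := by
  rw [seg_cons x h]; rfl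

theorem getLast?_seg (x : ℤ → A) {i j : ℤ} (h : i < j) :
    (seg x i j).getLast? = some (x (j - 1)) := by
  have := seg_concat x (show i ≤ j - 1 by omega)
  rw [show j - 1 + 1 = j by ring] at this
  simp [this]

/-- Splits an equation between a segment and a concatenation. -/
theorem seg_eq_append {x : ℤ → A} {i j : ℤ} {u v : List A} (hij : i ≤ j) (h : seg x i j = u ++ v) :
    seg x i (i + u.length) = u ∧ seg x (i + u.length) j = v ∧ i + u.length + v.length = j := by
  have hl := congrArg List.length h
  have := length_seg x hij
  rw [h] at this
  simp at this
  have h2 := seg_append x (show i ≤ i + u.length by omega) (show i + u.length ≤ j by omega)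
  rw [h] at h2
  have h3 := List.append_inj h2 (by
    have := length_seg x (show i ≤ i + u.length by omega)
    omega)
  exact ⟨h3.1, h3.2, by omega⟩

/-- A sequence with a prescribed word at a prescribed place, and prescribed outside of it. -/
theorem exists_seg_eq (x : ℤ → A) (i : ℤ) (w : List A) :
    ∃ y : ℤ → A, seg y i (i + w.length) = w ∧ (∀ l < i, y l = x l) ∧
      ∀ l ≥ i + w.length, y l = x l := by
  classical
  refine ⟨fun l => if h : i ≤ l ∧ l < i + w.length then w[(l - i).toNat]'(by omega) else x l,
    ?_, fun l hl => dif_neg (by omega), fun l hl => dif_neg (by omega)⟩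
  rw [seg, block_eq_iff]
  refine ⟨by simp, fun k hk => ?_⟩
  simp [hk]

/-- The sequence that agrees with `y` up to `b`, and with `z` from there on. -/
def splice (y z : ℤ → A) (b : ℤ) : ℤ → A := fun i => if i ≤ b then y i else z i

theorem splice_of_le (y z : ℤ → A) {b i : ℤ} (h : i ≤ b) : splice y z b i = y i := if_pos h

theorem splice_of_lt (y z : ℤ → A) {b i : ℤ} (h : b < i) : splice y z b i = z i :=
  if_neg (not_le.2 h)

theorem shift_apply' (g : ℤ) (x : ℤ → A) (i : ℤ) : shift g x i = x (g + i) := rfl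

end Segments

/-! ### Windows, closedness and compactness. -/

section Topology

variable {A : Type*} [TopologicalSpace A]

theorem exists_window_of_isOpen {U : Set (ℤ → A)} (hU : IsOpen U) {x : ℤ → A} (hx : x ∈ U) :
    ∃ m : ℕ, ∀ y : ℤ → A, (∀ i, -(m : ℤ) ≤ i → i ≤ m → y i = x i) → y ∈ U := by
  rw [isOpen_pi_iff] at hU
  obtain ⟨I, u, h1, h2⟩ := hU x hx
  refine ⟨I.sup Int.natAbs, fun y hy => h2 fun a ha => ?_⟩
  have : a.natAbs ≤ I.sup Int.natAbs := Finset.le_sup (f := Int.natAbs) ha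
  rw [hy a (by omega) (by omega)]
  exact (h1 a ha).2

theorem isOpen_window [DiscreteTopology A] (x : ℤ → A) (a b : ℤ) :
    IsOpen {y : ℤ → A | ∀ i, a ≤ i → i ≤ b → y i = x i} := by
  have : {y : ℤ → A | ∀ i, a ≤ i → i ≤ b → y i = x i} =
      ⋂ i ∈ Set.Icc a b, (fun y : ℤ → A => y i) ⁻¹' {x i} := by
    ext y; simp
  rw [this]
  exact (Set.finite_Icc a b).isOpen_biInter fun i _ =>
    (isOpen_discrete _).preimage (continuous_apply i)

theorem mem_of_forall_window (X : Subshift A ℤ) {x : ℤ → A}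
    (h : ∀ m : ℕ, ∃ y ∈ X.carrier, ∀ i, -(m : ℤ) ≤ i → i ≤ m → y i = x i) : x ∈ X.carrier := by
  rw [← X.isClosed.closure_eq, mem_closure_iff]
  intro U hU hx
  obtain ⟨m, hm⟩ := exists_window_of_isOpen hU hx
  obtain ⟨y, hy, h'⟩ := h m
  exact ⟨y, hm y h', hy⟩

theorem shift_mem (X : Subshift A ℤ) {x : ℤ → A} (hx : x ∈ X.carrier) (g : ℤ) :
    shift g x ∈ X.carrier := X.mapsTo g hx

/-- Compactness turns admissibility of `σ d a^k` for every `k` into one point with an infinite tail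
of `a`. -/
theorem exists_mem_of_monotone_windows [Finite A] [DiscreteTopology A] (X : Subshift A ℤ)
    (t : ℤ → A) (s : ℕ → Set ℤ) (hs : Monotone s)
    (h : ∀ k, ∃ x ∈ X.carrier, ∀ i ∈ s k, x i = t i) :
    ∃ x ∈ X.carrier, ∀ k, ∀ i ∈ s k, x i = t i := by
  have hc : ∀ k, IsClosed (X.carrier ∩ {x : ℤ → A | ∀ i ∈ s k, x i = t i}) := by
    intro k
    refine X.isClosed.inter ?_
    simp only [Set.ofPred_forall]
    exact isClosed_iInter fun i => isClosed_iInter fun _ =>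
      isClosed_eq (continuous_apply i) continuous_const
  have := IsCompact.nonempty_iInter_of_sequence_nonempty_isCompact_isClosed
    (fun k => X.carrier ∩ {x : ℤ → A | ∀ i ∈ s k, x i = t i})
    (fun k x hx => ⟨hx.1, fun i hi => hx.2 i (hs (Nat.le_succ k) hi)⟩)
    (fun k => by obtain ⟨x, h1, h2⟩ := h k; exact ⟨x, h1, h2⟩)
    (hc 0).isCompact hc
  obtain ⟨x, hx⟩ := this
  rw [Set.mem_iInter] at hx
  exact ⟨x, (hx 0).1, fun k => (hx k).2⟩

end Topology

/-! ### Admissible words as segments of points. -/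

section Language

variable {A : Type*} [TopologicalSpace A] {X : Subshift A ℤ}

theorem seg_mem_language {x : ℤ → A} (hx : x ∈ X.carrier) (i j : ℤ) : seg x i j ∈ language X :=
  ⟨x, hx, i, by simp [seg]⟩

theorem exists_seg_of_mem_language {w : List A} (h : w ∈ language X) (i : ℤ) :
    ∃ x ∈ X.carrier, seg x i (i + w.length) = w := by
  obtain ⟨x, hx, j, h⟩ := h
  refine ⟨shift (j - i) x, shift_mem X hx _, ?_⟩
  rw [seg_shift, show j - i + i = j by ring, show j - i + (i + w.length) = j + w.length by ring,
    ← block_eq_seg, h]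

theorem language_of_append_append {u v w : List A} (h : u ++ v ++ w ∈ language X) :
    v ∈ language X := by
  obtain ⟨x, hx, h⟩ := exists_seg_of_mem_language h 0
  have h1 := seg_eq_append (by positivity) h
  have h2 := seg_eq_append (by positivity) h1.1
  rw [← h2.2.1]
  exact seg_mem_language hx _ _

theorem seg_mem_language_iff {t : ℤ → A} {i j : ℤ} (hij : i ≤ j) :
    seg t i j ∈ language X ↔ ∃ x ∈ X.carrier, ∀ l, i ≤ l → l < j → x l = t l := by
  constructor
  · intro h
    obtain ⟨x, hx, h⟩ := exists_seg_of_mem_language h i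
    rw [length_seg t hij, show i + (j - i) = j by ring] at h
    exact ⟨x, hx, fun l h1 h2 => eq_of_seg_eq' h h1 h2⟩
  · rintro ⟨x, hx, h⟩
    rw [← seg_congr' h]
    exact seg_mem_language hx _ _

theorem mem_of_forall_seg {x : ℤ → A} (N : ℤ)
    (h : ∀ i j, i ≤ -N → N ≤ j → i ≤ j → seg x i j ∈ language X) : x ∈ X.carrier := by
  refine mem_of_forall_window X fun m => ?_
  have h1 := h (-(m + |N|)) (m + |N| + 1) (by have := le_abs_self N; omega)
    (by have := le_abs_self N; omega) (by have := abs_nonneg N; omega)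
  have := abs_nonneg N
  rw [seg_mem_language_iff (by omega)] at h1
  obtain ⟨y, hy, h⟩ := h1
  exact ⟨y, hy, fun i h1 h2 => h i (by omega) (by omega)⟩

end Language

/-! ### Synchronization as splicing of points. -/

section Synchronizing

variable {A : Type*} [TopologicalSpace A] {X : Subshift A ℤ}

/-- Any two points that agree with `x` on `[a, b]` can be spliced there. -/
def SyncOn (X : Subshift A ℤ) (x : ℤ → A) (a b : ℤ) : Prop :=
  ∀ y ∈ X.carrier, ∀ z ∈ X.carrier, (∀ i, a ≤ i → i ≤ b → y i = x i) →
    (∀ i, a ≤ i → i ≤ b → z i = x i) → splice y z b ∈ X.carrier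

/-- Two points that agree with `x` on the larger window have the same splice at `b` and at `b'`. -/
theorem SyncOn.mono {x : ℤ → A} {a b a' b' : ℤ} (h : SyncOn X x a b) (hab : a ≤ b) (ha : a' ≤ a)
    (hb : b ≤ b') : SyncOn X x a' b' := by
  intro y hy z hz h1 h2
  have := h y hy z hz (fun i h3 h4 => h1 i (by omega) (by omega))
    (fun i h3 h4 => h2 i (by omega) (by omega))
  convert this using 1
  funext i
  simp only [splice]
  split_ifs with h3 h4 h4
  · rfl
  · rw [h1 i (by omega) h3, h2 i (by omega) h3]
  · omega
  · rfl

/-- The words `uv` and `vw` extend to points that agree on the place of `v`, and `uvw` is a word of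
their splice. Splicing, unlike concatenation of words, is easily transported by a conjugacy. -/
theorem isSynchronizing_seg_iff {x : ℤ → A} (hx : x ∈ X.carrier) {i j : ℤ} (hij : i < j) :
    IsSynchronizing X (seg x i j) ↔ SyncOn X x i (j - 1) := by
  constructor
  · rintro ⟨-, -, h⟩ y hy z hz hy' hz'
    have ey : seg y i j = seg x i j := seg_congr' fun l h1 h2 => hy' l h1 (by omega)
    have ez : seg z i j = seg x i j := seg_congr' fun l h1 h2 => hz' l h1 (by omega)
    refine mem_of_forall_seg (max |i| |j|) fun p q hp hq _ => ?_
    have h1 : p ≤ i := by have := neg_abs_le i; have := le_max_left |i| |j|; omega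
    have h2 : j ≤ q := by have := le_abs_self j; have := le_max_right |i| |j|; omega
    have := h (seg y p i) (seg_mem_language hy _ _) (seg z j q) (seg_mem_language hz _ _)
      (by rw [← ey, seg_append _ h1 hij.le]; exact seg_mem_language hy _ _)
      (by rw [← ez, seg_append _ hij.le h2]; exact seg_mem_language hz _ _)
    rw [← ey, seg_append _ h1 hij.le] at this
    rw [← seg_append _ (h1.trans hij.le) h2]
    convert this using 2
    · exact seg_congr' fun l _ h4 => splice_of_le _ _ (by omega)
    · exact seg_congr' fun l h3 _ => splice_of_lt _ _ (by omega)
  · intro h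
    refine ⟨by rw [seg_cons x hij]; simp, seg_mem_language hx _ _, fun u _ w _ hu hw => ?_⟩
    obtain ⟨y, hy, ey⟩ := exists_seg_of_mem_language hu (i - u.length)
    obtain ⟨z, hz, ez⟩ := exists_seg_of_mem_language hw i
    have lx := length_seg x hij.le
    obtain ⟨y1, y2, -⟩ := seg_eq_append (by omega) ey
    obtain ⟨z1, z2, -⟩ := seg_eq_append (by omega) ez
    simp only [List.length_append, Nat.cast_add, lx] at y2 z1 z2
    have e1 : i - u.length + u.length = i := by ring
    have e2 : i - u.length + (u.length + (j - i)) = j := by ring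
    have e3 : i + (j - i) = j := by ring
    have e4 : i + (j - i + w.length) = j + w.length := by ring
    rw [e1, e2] at y2
    rw [e1] at y1
    rw [e3] at z1
    rw [e3, e4] at z2
    have := h y hy z hz (fun l h1 h2 => eq_of_seg_eq' y2 h1 (by omega))
      (fun l h1 h2 => eq_of_seg_eq' z1 h1 (by omega))
    have h3 := seg_mem_language this (i - u.length) (j + w.length)
    rw [← seg_append _ (show i - u.length ≤ j by omega) (by omega),
      ← seg_append _ (show i - u.length ≤ i by omega) hij.le] at h3
    convert h3 using 3
    · conv_lhs => rw [← y1]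
      exact seg_congr' fun l _ h4 => (splice_of_le _ _ (by omega)).symm
    · rw [← y2]; exact seg_congr' fun l _ h4 => (splice_of_le _ _ (by omega)).symm
    · conv_lhs => rw [← z2]
      exact seg_congr' fun l h4 _ => (splice_of_lt _ _ (by omega)).symm

theorem mem_synchro_iff {x : ℤ → A} (hx : x ∈ X.carrier) (p : ℤ) :
    x p ∈ synchro X ↔ SyncOn X x p p := by
  have := isSynchronizing_seg_iff hx (show p < p + 1 by omega)
  rw [seg_succ] at this
  simpa [synchro] using this

end Synchronizing

/-! ### Conjugacies as sliding block maps. -/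

section Conj

variable {A B C : Type*} [TopologicalSpace A] [TopologicalSpace B] [TopologicalSpace C]

/-- `f` and `g` restrict to mutually inverse sliding block maps of radius `r`. -/
structure IsConj (X : Subshift A ℤ) (Y : Subshift B ℤ) (f : (ℤ → A) → ℤ → B)
    (g : (ℤ → B) → ℤ → A) (r : ℕ) : Prop where
  map_mem : ∀ x ∈ X.carrier, f x ∈ Y.carrier
  inv_mem : ∀ y ∈ Y.carrier, g y ∈ X.carrier
  left_inv : ∀ x ∈ X.carrier, g (f x) = x
  right_inv : ∀ y ∈ Y.carrier, f (g y) = y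
  map_local : ∀ x ∈ X.carrier, ∀ y ∈ X.carrier, ∀ i j : ℤ,
    (∀ k, -(r : ℤ) ≤ k → k ≤ r → x (i + k) = y (j + k)) → f x i = f y j
  inv_local : ∀ x ∈ Y.carrier, ∀ y ∈ Y.carrier, ∀ i j : ℤ,
    (∀ k, -(r : ℤ) ≤ k → k ≤ r → x (i + k) = y (j + k)) → g x i = g y j

variable {X : Subshift A ℤ} {Y : Subshift B ℤ} {Z : Subshift C ℤ} {f : (ℤ → A) → ℤ → B}
  {g : (ℤ → B) → ℤ → A} {f' : (ℤ → B) → ℤ → C} {g' : (ℤ → C) → ℤ → B} {r r' : ℕ}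

theorem IsConj.symm (h : IsConj X Y f g r) : IsConj Y X g f r :=
  ⟨h.inv_mem, h.map_mem, h.right_inv, h.left_inv, h.inv_local, h.map_local⟩

theorem IsConj.trans (h : IsConj X Y f g r) (h' : IsConj Y Z f' g' r') :
    IsConj X Z (f' ∘ f) (g ∘ g') (r + r') where
  map_mem x hx := h'.map_mem _ (h.map_mem x hx)
  inv_mem x hx := h.inv_mem _ (h'.inv_mem x hx)
  left_inv x hx := by simp [h'.left_inv _ (h.map_mem x hx), h.left_inv x hx]
  right_inv x hx := by simp [h.right_inv _ (h'.inv_mem x hx), h'.right_inv x hx]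
  map_local x hx y hy i j hk := by
    refine h'.map_local _ (h.map_mem x hx) _ (h.map_mem y hy) _ _ fun k h1 h2 => ?_
    refine h.map_local _ hx _ hy _ _ fun l h3 h4 => ?_
    have := hk (k + l) (by push_cast; omega) (by push_cast; omega)
    rwa [← add_assoc, ← add_assoc] at this
  inv_local x hx y hy i j hk := by
    refine h.inv_local _ (h'.inv_mem x hx) _ (h'.inv_mem y hy) _ _ fun k h1 h2 => ?_
    refine h'.inv_local _ hx _ hy _ _ fun l h3 h4 => ?_
    have := hk (k + l) (by push_cast; omega) (by push_cast; omega)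
    rwa [← add_assoc, ← add_assoc] at this

/-- Local determination of the image, in terms of a translation by `d`. -/
theorem IsConj.map_eq (h : IsConj X Y f g r) {x y : ℤ → A} (hx : x ∈ X.carrier)
    (hy : y ∈ X.carrier) (d : ℤ) {i : ℤ} (hxy : ∀ l, i - r ≤ l → l ≤ i + r → x l = y (l + d)) :
    f x i = f y (i + d) := by
  refine h.map_local x hx y hy i (i + d) fun k h1 h2 => ?_
  rw [hxy _ (by omega) (by omega)]
  congr 1; ring

theorem IsConj.map_eq' (h : IsConj X Y f g r) {x y : ℤ → A} (hx : x ∈ X.carrier)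
    (hy : y ∈ X.carrier) {i : ℤ} (hxy : ∀ l, i - r ≤ l → l ≤ i + r → x l = y l) :
    f x i = f y i := by
  simpa using h.map_eq hx hy 0 (by simpa using hxy)

theorem IsConj.map_shift (h : IsConj X Y f g r) {x : ℤ → A} (hx : x ∈ X.carrier) (s : ℤ) :
    f (shift s x) = shift s (f x) := by
  funext i
  rw [shift_apply', add_comm s i]
  exact h.map_eq (shift_mem X hx s) hx s fun l _ _ => by rw [shift_apply', add_comm]

/-- Points that agree with `f x` on the larger window have preimages that agree with `x` on `[a,
b]`, and these can be spliced. The image of the splice is `y` up to `b - r` and `z` from `a + r` on;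
the width `2 * r` makes the two ranges cover everything. -/
theorem IsConj.syncOn (h : IsConj X Y f g r) {x : ℤ → A} (hx : x ∈ X.carrier) {a b : ℤ}
    (hs : SyncOn X x a b) (hab : a + 2 * r ≤ b) : SyncOn Y (f x) (a - r) (b + r) := by
  intro y hy z hz hy' hz'
  have gy : ∀ i, a ≤ i → i ≤ b → g y i = x i := fun i h1 h2 => by
    rw [← h.left_inv x hx]
    exact h.symm.map_eq' hy (h.map_mem x hx) fun l h3 h4 => hy' l (by omega) (by omega)
  have gz : ∀ i, a ≤ i → i ≤ b → g z i = x i := fun i h1 h2 => by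
    rw [← h.left_inv x hx]
    exact h.symm.map_eq' hz (h.map_mem x hx) fun l h3 h4 => hz' l (by omega) (by omega)
  have hu := hs _ (h.inv_mem y hy) _ (h.inv_mem z hz) gy gz
  have e1 : ∀ i, i ≤ b - r → f (splice (g y) (g z) b) i = y i := fun i hi => by
    rw [h.map_eq' hu (h.inv_mem y hy) fun l _ h4 => splice_of_le _ _ (by omega), h.right_inv y hy]
  have e2 : ∀ i, a + r ≤ i → f (splice (g y) (g z) b) i = z i := fun i hi => by
    rw [h.map_eq' hu (h.inv_mem z hz) fun l h3 h4 => ?_, h.right_inv z hz]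
    by_cases hl : l ≤ b
    · rw [splice_of_le _ _ hl, gy l (by omega) hl, gz l (by omega) hl]
    · rw [splice_of_lt _ _ (by omega)]
  convert h.map_mem _ hu using 1
  funext i
  rcases le_or_gt i (b - r) with h1 | h1
  · rw [e1 i h1, splice_of_le _ _ (by omega)]
  · rw [e2 i (by omega)]
    rcases le_or_gt i (b + r) with h2 | h2
    · rw [splice_of_le _ _ h2, hy' i (by omega) h2, hz' i (by omega) h2]
    · rw [splice_of_lt _ _ h2]

/-- The compactness argument of Curtis, Hedlund and Lyndon: finitely many windows on which `F` is
constant cover the subshift. -/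
theorem exists_radius [Finite A] [DiscreteTopology A] [DiscreteTopology B]
    {F : X.carrier → B} (hF : Continuous F) :
    ∃ r : ℕ, ∀ x y : X.carrier, (∀ i, -(r : ℤ) ≤ i → i ≤ r → x.1 i = y.1 i) → F x = F y := by
  have h1 : ∀ x : X.carrier, ∃ m : ℕ, ∀ y : X.carrier,
      (∀ i, -(m : ℤ) ≤ i → i ≤ m → y.1 i = x.1 i) → F y = F x := by
    intro x
    obtain ⟨U, hU, hUF⟩ := isOpen_induced_iff.1 (hF.isOpen_preimage {F x} (isOpen_discrete _))
    obtain ⟨m, hm⟩ := exists_window_of_isOpen hU (x := x.1) (by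
      change x ∈ Subtype.val ⁻¹' U
      rw [hUF]; rfl)
    refine ⟨m, fun y hy => ?_⟩
    have : y ∈ Subtype.val ⁻¹' U := hm y.1 hy
    rw [hUF] at this
    exact this
  choose m hm using h1
  have : CompactSpace X.carrier := isCompact_iff_compactSpace.1 X.isClosed.isCompact
  obtain ⟨t, ht⟩ := isCompact_univ.elim_finite_subcover
    (fun x : X.carrier => Subtype.val ⁻¹' {y : ℤ → A | ∀ i, -(m x : ℤ) ≤ i → i ≤ m x → y i = x.1 i})
    (fun x => (isOpen_window x.1 _ _).preimage continuous_subtype_val)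
    (fun x _ => Set.mem_iUnion.2 ⟨x, fun i _ _ => rfl⟩)
  refine ⟨t.sup m, fun x y hxy => ?_⟩
  obtain ⟨w, hw, hxw⟩ := Set.mem_iUnion₂.1 (ht (Set.mem_univ x))
  have hle : m w ≤ t.sup m := Finset.le_sup hw
  rw [hm w x hxw, hm w y fun i h3 h4 => ?_]
  rw [← hxy i (by omega) (by omega)]
  exact hxw i h3 h4

theorem exists_isConj [Finite A] [DiscreteTopology A] [Finite B] [DiscreteTopology B]
    (hX : X.carrier.Nonempty) (h : TopologicallyConjugate X Y) : ∃ f g r, IsConj X Y f g r := by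
  classical
  obtain ⟨φ, hφ⟩ := h
  obtain ⟨x₀, hx₀⟩ := hX
  have one : ∀ x x' : X.carrier, x'.1 = shift 1 x.1 → (φ x').1 = shift 1 (φ x).1 := by
    intro x x' e
    have : x' = ⟨shift 1 x.1, X.mapsTo 1 x.2⟩ := Subtype.ext e
    rw [this, hφ]
  have comm : ∀ (n : ℕ) (x x' : X.carrier), x'.1 = shift (n : ℤ) x.1 →
      (φ x').1 = shift (n : ℤ) (φ x).1 := by
    intro n
    induction n with
    | zero =>
      intro x x' e
      rw [show x' = x from Subtype.ext (by simpa using e)]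
      simp
    | succ n ih =>
      intro x x' e
      rw [ih ⟨shift 1 x.1, X.mapsTo 1 x.2⟩ x' (by
        rw [e]; funext i; simp only [shift_apply']; exact congrArg _ (by push_cast; ring)), one x _ rfl]
      funext i; simp only [shift_apply']; exact congrArg _ (by push_cast; ring)
  have commZ : ∀ (n : ℤ) (x x' : X.carrier), x'.1 = shift n x.1 →
      (φ x').1 = shift n (φ x).1 := by
    intro n x x' e
    obtain ⟨k, rfl | rfl⟩ := n.eq_nat_or_neg
    · exact comm k x x' e
    · have := comm k x' x (by rw [e]; funext i; simp)
      rw [this]; funext i; simp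
  have commZ' : ∀ (n : ℤ) (y y' : Y.carrier), y'.1 = shift n y.1 →
      (φ.symm y').1 = shift n (φ.symm y).1 := by
    intro n y y' e
    have := commZ n (φ.symm y) ⟨_, X.mapsTo n (φ.symm y).2⟩ rfl
    have h2 : y' = φ ⟨shift n (φ.symm y).1, X.mapsTo n (φ.symm y).2⟩ := by
      apply Subtype.ext; rw [this, e]; simp
    rw [h2]; simp
  obtain ⟨r₁, h₁⟩ := exists_radius (X := X) (F := fun x => (φ x).1 0)
    ((continuous_apply 0).comp (continuous_subtype_val.comp φ.continuous))
  obtain ⟨r₂, h₂⟩ := exists_radius (X := Y) (F := fun x => (φ.symm x).1 0)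
    ((continuous_apply 0).comp (continuous_subtype_val.comp φ.symm.continuous))
  -- The maps are made total by arbitrary values outside the subshifts; no clause of `IsConj` looks
  -- at these values.
  refine ⟨fun x => if h : x ∈ X.carrier then (φ ⟨x, h⟩).1 else (φ ⟨x₀, hx₀⟩).1,
    fun y => if h : y ∈ Y.carrier then (φ.symm ⟨y, h⟩).1 else x₀, max r₁ r₂, ?_, ?_, ?_, ?_, ?_, ?_⟩
  · intro x hx; simp [hx]
  · intro x hx; simp [hx]
  · intro x hx; simp [hx]
  · intro x hx; simp [hx]
  · intro x hx y hy i j hk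
    have := h₁ ⟨shift i x, X.mapsTo i hx⟩ ⟨shift j y, X.mapsTo j hy⟩ fun k h3 h4 => by
      have := le_max_left r₁ r₂
      exact hk k (by omega) (by omega)
    rw [commZ i ⟨x, hx⟩ ⟨shift i x, X.mapsTo i hx⟩ rfl,
      commZ j ⟨y, hy⟩ ⟨shift j y, X.mapsTo j hy⟩ rfl] at this
    simpa [hx, hy, shift_apply'] using this
  · intro x hx y hy i j hk
    have := h₂ ⟨shift i x, Y.mapsTo i hx⟩ ⟨shift j y, Y.mapsTo j hy⟩ fun k h3 h4 => by
      have := le_max_right r₁ r₂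
      exact hk k (by omega) (by omega)
    rw [commZ' i ⟨x, hx⟩ ⟨shift i x, Y.mapsTo i hx⟩ rfl,
      commZ' j ⟨y, hy⟩ ⟨shift j y, Y.mapsTo j hy⟩ rfl] at this
    simpa [hx, hy, shift_apply'] using this

/-- The block at `i` carries the coordinates `i + 1, …, i + n`, so `x i` is the first entry of the
block at `i - 1`. -/
theorem isConj_higherBlock [Finite A] [DiscreteTopology A] (X : Subshift A ℤ) {n : ℕ}
    (hn : 0 < n) :
    IsConj (higherBlock X n) X (fun z i => z (i - 1) ⟨0, hn⟩) (blockMap n) (n + 1) where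
  map_mem := by
    rintro _ ⟨x, hx, rfl⟩
    simpa [blockMap] using hx
  inv_mem x hx := ⟨x, hx, rfl⟩
  left_inv := by
    rintro _ ⟨x, hx, rfl⟩
    simp [blockMap]
  right_inv x hx := by simp [blockMap]
  map_local x _ y _ i j hk := by
    have := hk (-1) (by push_cast; omega) (by push_cast; omega)
    simp only [sub_eq_add_neg, this]
  inv_local x _ y _ i j hk := by
    funext k
    have := hk (1 + k) (by push_cast; omega) (by push_cast; omega)
    simpa [blockMap, add_assoc] using this

end Conj

/-! ### Strong synchronization of higher block systems. -/

section StronglySynchronizing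

variable {A B : Type*} [TopologicalSpace A] [TopologicalSpace B] {X : Subshift A ℤ}
  {Y : Subshift B ℤ} {f : (ℤ → A) → ℤ → B} {g : (ℤ → B) → ℤ → A} {r : ℕ}

theorem IsStronglySynchronizing.exists_bound (h : IsStronglySynchronizing X) :
    ∃ Q : ℕ, ∀ x ∈ X.carrier, ∀ a b, a ≤ b → SyncOn X x a b →
      ∃ j, a - Q ≤ j ∧ j ≤ b + Q ∧ x j ∈ synchro X := by
  obtain ⟨-, -, Q, hQ⟩ := h
  refine ⟨Q, fun x hx a b hab hs => ?_⟩
  have : IsSynchronizing X (seg x a (b + 1)) := by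
    rw [isSynchronizing_seg_iff hx (by omega)]
    simpa using hs
  obtain ⟨j, h1, h2, h3⟩ := hQ x hx a _ this
  exact ⟨j, h1, by omega, h3⟩

theorem IsStronglySynchronizing.exists_synchro (h : IsStronglySynchronizing X) :
    ∃ x ∈ X.carrier, x 0 ∈ synchro X := by
  obtain ⟨-, ⟨v, hv⟩, Q, hQ⟩ := h
  obtain ⟨x, hx, i, e⟩ := hv.2.1
  rw [← e] at hv
  obtain ⟨j, -, -, h3⟩ := hQ x hx i _ hv
  exact ⟨shift j x, shift_mem X hx j, by simpa using h3⟩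

theorem isTopologicallyTransitive_iff [DiscreteTopology A] :
    IsTopologicallyTransitive X ↔ ∀ x ∈ X.carrier, ∀ y ∈ X.carrier, ∀ m : ℕ,
      ∃ n : ℕ, ∃ z ∈ X.carrier, (∀ i, -(m : ℤ) ≤ i → i ≤ m → z i = x i) ∧
        ∀ i, -(m : ℤ) ≤ i → i ≤ m → z (n + i) = y i := by
  constructor
  · intro h x hx y hy m
    obtain ⟨n, z, ⟨hz, hzx⟩, hzy⟩ := h _ _ (isOpen_window x (-m) m) (isOpen_window y (-m) m)
      ⟨x, hx, fun _ _ _ => rfl⟩ ⟨y, hy, fun _ _ _ => rfl⟩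
    exact ⟨n, z, hz, hzx, hzy⟩
  · rintro h U V hU hV ⟨x, hx, hxU⟩ ⟨y, hy, hyV⟩
    obtain ⟨m₁, h₁⟩ := exists_window_of_isOpen hU hxU
    obtain ⟨m₂, h₂⟩ := exists_window_of_isOpen hV hyV
    obtain ⟨n, z, hz, hzx, hzy⟩ := h x hx y hy (max m₁ m₂)
    have := le_max_left m₁ m₂
    have := le_max_right m₁ m₂
    exact ⟨n, z, ⟨hz, h₁ z fun i _ _ => hzx i (by omega) (by omega)⟩,
      h₂ _ fun i _ _ => hzy i (by omega) (by omega)⟩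

theorem IsConj.isTopologicallyTransitive [DiscreteTopology A] [DiscreteTopology B]
    (h : IsConj X Y f g r) (hX : IsTopologicallyTransitive X) : IsTopologicallyTransitive Y := by
  rw [isTopologicallyTransitive_iff] at hX ⊢
  intro x hx y hy m
  obtain ⟨n, z, hz, hzx, hzy⟩ := hX _ (h.inv_mem x hx) _ (h.inv_mem y hy) (m + r)
  refine ⟨n, f z, h.map_mem z hz, fun i h1 h2 => ?_, fun i h1 h2 => ?_⟩
  · conv_rhs => rw [← h.right_inv x hx]
    exact h.map_eq' hz (h.inv_mem x hx) fun l h3 h4 => hzx l (by push_cast; omega) (by push_cast; omega)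
  · conv_rhs => rw [← h.right_inv y hy]
    refine h.map_local _ hz _ (h.inv_mem y hy) _ _ fun k h3 h4 => ?_
    rw [add_assoc]
    exact hzy _ (by push_cast; omega) (by push_cast; omega)

theorem IsConj.exists_synchro_near [DiscreteTopology A] [DiscreteTopology B]
    (h : IsConj X Y f g r) (hY : IsStronglySynchronizing Y) :
    ∃ R : ℕ, ∀ x ∈ X.carrier, ∀ a b, a ≤ b → SyncOn X x a b →
      ∃ q, a - R ≤ q ∧ q ≤ b + R ∧ f x q ∈ synchro Y := by
  obtain ⟨Q, hQ⟩ := hY.exists_bound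
  refine ⟨3 * r + Q, fun x hx a b hab hs => ?_⟩
  obtain ⟨j, h1, h2, h3⟩ := hQ _ (h.map_mem x hx) _ _ (by omega)
    (h.syncOn hx (hs.mono hab le_rfl (show b ≤ b + 2 * r by omega)) (by omega))
  exact ⟨j, by push_cast; omega, by push_cast; omega, h3⟩

/-- The window `{p}` is first widened to `[p - r, p + r]`, the least width that `IsConj.syncOn`
accepts. The conjugacy widens it to `[p - 2r, p + 2r]`, which lies inside the single `n`-block at `p
- 2r - 1`. -/
theorem IsConj.synchro_blockMap [Finite A] [DiscreteTopology A] (h : IsConj X Y f g r)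
    {y : ℤ → B} (hy : y ∈ Y.carrier) {p : ℤ} (hp : y p ∈ synchro Y) {n : ℕ} (hn : 4 * r + 1 ≤ n) :
    blockMap n (g y) (p - 2 * r - 1) ∈ synchro (higherBlock X n) := by
  have hx := h.inv_mem y hy
  have hs := h.symm.syncOn hy (((mem_synchro_iff hy p).1 hp).mono le_rfl
    (show p - r ≤ p by omega) (show p ≤ p + r by omega)) (by omega)
  set x := g y
  have hz : blockMap n x ∈ (higherBlock X n).carrier := ⟨x, hx, rfl⟩
  rw [mem_synchro_iff hz]
  rintro _ ⟨u, hu, rfl⟩ _ ⟨v, hv, rfl⟩ h1 h2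
  have key : ∀ w : ℤ → A, (∀ i, p - 2 * r - 1 ≤ i → i ≤ p - 2 * r - 1 →
      blockMap n w i = blockMap n x i) →
      ∀ l, p - 2 * r ≤ l → l ≤ p - 2 * r - 1 + n → w l = x l := by
    intro w hw l h3 h4
    have := congrFun (hw _ le_rfl le_rfl) ⟨(l - (p - 2 * r)).toNat, by omega⟩
    simp only [blockMap] at this
    rwa [show p - 2 * r - 1 + 1 + (((l - (p - 2 * r)).toNat : ℕ) : ℤ) = l by omega] at this
  have hs' := hs.mono (by omega) (show p - 2 * r ≤ p - r - r by omega)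
    (show p + r + r ≤ p - 2 * r - 1 + n by omega)
  -- The underlying points are spliced at the right end of the block. They agree on the whole block,
  -- so passing to blocks commutes with the splice.
  refine ⟨_, hs' u hu v hv (key u h1) (key v h2), ?_⟩
  funext i
  rcases le_or_gt i (p - 2 * r - 1) with h3 | h3
  · rw [splice_of_le _ _ h3]
    funext k
    exact splice_of_le _ _ (by omega)
  · rw [splice_of_lt _ _ h3]
    funext k
    simp only [blockMap]
    rcases le_or_gt (i + 1 + (k : ℕ)) (p - 2 * r - 1 + n) with h4 | h4
    · rw [splice_of_le _ _ h4, key u h1 _ (by omega) h4, key v h2 _ (by omega) h4]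
    · rw [splice_of_lt _ _ h4]

/-- A synchronizing window of the higher block system forces a synchronizing symbol of `Y` nearby,
and this one forces a synchronizing block at distance `2 * r + 1`. -/
theorem IsConj.isStronglySynchronizing_higherBlock [Finite A] [DiscreteTopology A]
    [DiscreteTopology B] (h : IsConj X Y f g r) (hY : IsStronglySynchronizing Y) {n : ℕ}
    (hn : 4 * r + 1 ≤ n) : IsStronglySynchronizing (higherBlock X n) := by
  have hZ := (isConj_higherBlock X (show 0 < n by omega)).trans h
  have key : ∀ z ∈ (higherBlock X n).carrier, ∀ p,
      (f ∘ fun z i => z (i - 1) ⟨0, by omega⟩) z p ∈ synchro Y →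
      z (p - 2 * r - 1) ∈ synchro (higherBlock X n) := by
    intro z hz p hp
    have := h.synchro_blockMap (hZ.map_mem z hz) hp hn
    rwa [show blockMap n (g _) = z from hZ.left_inv z hz] at this
  refine ⟨hZ.symm.isTopologicallyTransitive hY.1, ?_, ?_⟩
  · obtain ⟨y, hy, h0⟩ := hY.exists_synchro
    exact ⟨_, h.synchro_blockMap hy h0 hn⟩
  · obtain ⟨R, hR⟩ := hZ.exists_synchro_near hY
    refine ⟨R + 2 * r + 1, fun z hz i m hs => ?_⟩
    have hm : 0 < m := by
      rcases Nat.eq_zero_or_pos m with rfl | h0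
      · exact absurd (by simp [block]) hs.1
      · exact h0
    rw [block_eq_seg, isSynchronizing_seg_iff hz (by omega)] at hs
    obtain ⟨q, h1, h2, h3⟩ := hR z hz _ _ (by omega) hs
    exact ⟨_, by push_cast; omega, by push_cast; omega, key z hz q h3⟩

end StronglySynchronizing

/-! ### A follower code determines its relation. -/

section FollowerCode

variable {A : Type*}

theorem followerCode_injective [Finite A] {R R' : Set (List A × A)}
    (h : followerCode R = followerCode R') : R = R' := by
  have : (followerCode R).t = (followerCode R').t := by rw [h]
  ext ⟨w, σ⟩
  have h2 := congrFun this w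
  exact Set.ext_iff.1 h2 σ

end FollowerCode

/-! ### Strongly synchronizing subshifts are coded by `C(X)`. -/

section CodedSystem

variable {A : Type*} [TopologicalSpace A] {X : Subshift A ℤ}

theorem language_of_append_left {u v : List A} (h : u ++ v ∈ language X) : u ∈ language X :=
  language_of_append_append (u := []) (w := v) (by simpa using h)

theorem language_of_append_right {u v : List A} (h : u ++ v ∈ language X) : v ∈ language X :=
  language_of_append_append (u := u) (w := []) (by simpa using h)

theorem mem_of_exists_seg {x : ℤ → A}
    (h : ∀ p q : ℤ, ∃ i ≤ p, ∃ j ≥ q, i ≤ j ∧ seg x i j ∈ language X) : x ∈ X.carrier := by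
  refine mem_of_forall_window X fun m => ?_
  obtain ⟨i, hi, j, hj, hij, h⟩ := h (-m) (m + 1)
  obtain ⟨y, hy, hxy⟩ := (seg_mem_language_iff hij).1 h
  exact ⟨y, hy, fun l h1 h2 => hxy l (by omega) (by omega)⟩

theorem strictMono_int_bounds {i : ℤ → ℤ} (hi : StrictMono i) (n : ℕ) :
    i 0 + n ≤ i n ∧ i (-n) ≤ i 0 - n := by
  induction n with
  | zero => simp
  | succ n ih =>
    have h1 := hi (show (n : ℤ) < (n + 1 : ℕ) by push_cast; omega)
    have h2 := hi (show -((n + 1 : ℕ) : ℤ) < -n by push_cast; omega)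
    push_cast at h1 h2 ⊢
    omega

/-- A concatenation of admissible words that overlap in synchronizing symbols is admissible. -/
theorem mem_of_concat {x : ℤ → A} {i : ℤ → ℤ} (hi : StrictMono i)
    (hs : ∀ k, x (i k) ∈ synchro X)
    (hw : ∀ k, seg x (i k) (i (k + 1)) ++ [x (i (k + 1))] ∈ language X) : x ∈ X.carrier := by
  have key : ∀ (m : ℤ) (n : ℕ), seg x (i m) (i (m + n)) ++ [x (i (m + n))] ∈ language X := by
    intro m n
    induction n with
    | zero => simpa using (hs m).2.1
    | succ n ih =>
      have h1 := hw (m + n)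
      have lt := hi (show m + n < m + n + 1 by omega)
      have le := hi.monotone (show m ≤ m + n by omega)
      rw [show m + ((n + 1 : ℕ) : ℤ) = m + n + 1 by push_cast; ring]
      have e : seg x (i (m + n)) (i (m + n + 1)) ++ [x (i (m + n + 1))] =
          [x (i (m + n))] ++ (seg x (i (m + n) + 1) (i (m + n + 1)) ++ [x (i (m + n + 1))]) := by
        rw [seg_cons x lt]; simp
      have e2 := seg_append x le lt.le
      rw [← e2, List.append_assoc, e, ← List.append_assoc]
      rw [e] at h1
      exact (hs (m + n)).2.2 _ (language_of_append_left ih) _ (language_of_append_right h1) ih h1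
  refine mem_of_exists_seg fun p q => ?_
  set n : ℕ := p.natAbs + q.natAbs + (i 0).natAbs with hn
  have h1 := key (-n) (n + n)
  have b := strictMono_int_bounds hi n
  rw [show -(n : ℤ) + ((n + n : ℕ) : ℤ) = n by push_cast; ring] at h1
  exact ⟨i (-n), by omega, i n, by omega, by omega, language_of_append_left h1⟩

/-- The positions of synchronizing symbols form a locally finite order without end points, hence a
copy of `ℤ`. Its enumeration cuts `x` into words of `C(X)`. -/
theorem mem_points_of_unbounded {x : ℤ → A} [Finite A] (hx : x ∈ X.carrier)
    (h1 : ∀ N, ∃ q > N, x q ∈ synchro X) (h2 : ∀ N, ∃ q < N, x q ∈ synchro X) :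
    x ∈ (followerCode (synchroRel X)).points := by
  classical
  let S := {q : ℤ // x q ∈ synchro X}
  let : LocallyFiniteOrder S := Subtype.instLocallyFiniteOrder _
  have : NoMaxOrder S := ⟨fun a => by
    obtain ⟨q, hq, h⟩ := h1 a.1
    exact ⟨⟨q, h⟩, hq⟩⟩
  have : NoMinOrder S := ⟨fun a => by
    obtain ⟨q, hq, h⟩ := h2 a.1
    exact ⟨⟨q, h⟩, hq⟩⟩
  have : Nonempty S := by
    obtain ⟨q, -, h⟩ := h1 0
    exact ⟨⟨q, h⟩⟩
  let : SuccOrder S := LinearLocallyFiniteOrder.succOrder S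
  let : PredOrder S := LinearLocallyFiniteOrder.predOrder S
  let φ : S ≃o ℤ := orderIsoIntOfLinearSuccPredArch
  have mono : StrictMono fun k => (φ.symm k).1 := fun a b h => φ.symm.strictMono h
  have rel : ∀ k, (seg x (φ.symm k).1 (φ.symm (k + 1)).1, x (φ.symm (k + 1)).1) ∈ synchroRel X := by
    intro k
    have lt := mono (show k < k + 1 by omega)
    simp only at lt
    refine ⟨⟨_, _, seg_cons x lt, (φ.symm k).2, ?_⟩, (φ.symm (k + 1)).2, ?_⟩
    · intro τ hτ hs
      obtain ⟨l, h3, h4, rfl⟩ := mem_seg.1 hτ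
      have h5 : φ.symm k < ⟨l, hs⟩ := show (φ.symm k).1 < l by omega
      have h6 : (⟨l, hs⟩ : S) < φ.symm (k + 1) := h4
      rw [OrderIso.symm_apply_lt] at h5
      rw [OrderIso.lt_symm_apply] at h6
      omega
    · rw [← seg_concat x lt.le]
      exact seg_mem_language hx _ _
  refine ⟨fun k => (φ.symm k).1, mono, fun k => ⟨_, rel k⟩, fun k => ⟨x (φ.symm k).1, ?_, ?_⟩⟩
  · have := rel (k - 1)
    rw [sub_add_cancel] at this
    exact this
  · have lt := mono (show k < k + 1 by omega)
    ext a
    change (seg x _ _).head? = some a ↔ _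
    rw [head?_seg x lt]
    simp [eq_comm]

/-- The transition rule puts the first symbol of each word into the target set of the preceding
word. Consecutive admissible words then overlap in a synchronizing symbol. -/
theorem points_subset [Finite A] : (followerCode (synchroRel X)).points ⊆ X.carrier := by
  rintro x ⟨i, hi, hw, ht⟩
  have rel : ∀ k, (seg x (i (k - 1)) (i k), x (i k)) ∈ synchroRel X := by
    intro k
    obtain ⟨σ, hσ, e⟩ := ht k
    have : x (i k) ∈ ({σ} : Set A) := by
      rw [← e]
      exact head?_seg x (hi (show k < k + 1 by omega))
    rw [Set.mem_singleton_iff] at this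
    rw [this]
    exact hσ
  refine mem_of_concat hi (fun k => (rel k).2.1) fun k => ?_
  have := (rel (k + 1)).2.2
  simpa using this

/-- Transitivity, used twice, gives an admissible word that contains the window of `x` and has the
same synchronizing symbol at both ends. Its periodic repetition is admissible. -/
theorem exists_periodic [DiscreteTopology A] (h : IsStronglySynchronizing X) {x : ℤ → A}
    (hx : x ∈ X.carrier) (m : ℕ) : ∃ p ∈ X.carrier, (∀ i, -(m : ℤ) ≤ i → i ≤ m → p i = x i) ∧
      (∀ N, ∃ q > N, p q ∈ synchro X) ∧ ∀ N, ∃ q < N, p q ∈ synchro X := by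
  obtain ⟨s, hs, hs0⟩ := h.exists_synchro
  have htr := isTopologicallyTransitive_iff.1 h.1
  -- The shifts of `s` place the symbol `s 0` at the edge of each window. It is thereby kept outside
  -- `[-m, m]`, even if the transition times `n` and `n'` vanish.
  obtain ⟨n, z, hz, hz1, hz2⟩ := htr _ (shift_mem X hs (m + 1)) x hx (m + 1)
  obtain ⟨n', y, hy, hy1, hy2⟩ := htr _ (shift_mem X hz n) _ (shift_mem X hs (-(m + 1 + n)))
    (m + 1 + n)
  set a : ℤ := -(m + 1 + n) with ha
  set b : ℤ := n' + (m + 1 + n) with hb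
  have ya : y a = s 0 := by
    rw [hy1 a (by push_cast; omega) (by push_cast; omega), shift_apply',
      hz1 _ (by push_cast; omega) (by push_cast; omega), shift_apply']
    congr 1; omega
  have yb : y b = s 0 := by
    rw [hb, hy2 _ (by push_cast; omega) (by push_cast; omega), shift_apply']
    congr 1; omega
  have yx : ∀ i, -(m : ℤ) ≤ i → i ≤ m → y i = x i := fun i h1 h2 => by
    rw [hy1 i (by push_cast; omega) (by push_cast; omega), shift_apply',
      hz2 _ (by push_cast; omega) (by push_cast; omega)]
  set d : ℤ := b - a with hd
  have hd0 : 0 < d := by omega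
  -- One period is `y` on `[a, b)`; `y a = y b` closes it up.
  let p : ℤ → A := fun i => y (a + (i - a) % d)
  have hpa : ∀ k : ℤ, p (a + k * d) = s 0 := fun k => by
    simp only [p]
    rw [show a + k * d - a = k * d by ring, Int.mul_emod_left, add_zero, ya]
  have hpy : ∀ (k l : ℤ), a ≤ l → l < b → p (l + k * d) = y l := fun k l h1 h2 => by
    simp only [p]
    rw [show l + k * d - a = (l - a) + k * d by ring, Int.add_mul_emod_self_right,
      Int.emod_eq_of_lt (by omega) (by omega)]
    congr 1; ring
  refine ⟨p, ?_, fun i h1 h2 => ?_, fun N => ⟨a + (|N| + |a| + 1) * d, ?_, ?_⟩,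
    fun N => ⟨a + (-(|N| + |a| + 1)) * d, ?_, ?_⟩⟩
  · refine mem_of_concat (i := fun k => a + k * d) (fun k l h => by simp only; nlinarith)
      (fun k => by rw [hpa]; exact hs0) fun k => ?_
    have : seg y a (b + 1) = seg p (a + k * d) (a + (k + 1) * d) ++ [p (a + (k + 1) * d)] := by
      rw [seg_concat y (by omega), hpa, yb, seg_congr (y := p) (d := k * d) fun l h1 h2 =>
        (hpy k l h1 h2).symm]
      congr 2
      rw [hd]; ring
    rw [← this]
    exact seg_mem_language hy _ _
  · rw [← yx i h1 h2, ← hpy 0 i (by omega) (by omega)]; simp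
  · have := abs_nonneg N
    have := abs_nonneg a
    have := le_abs_self N
    have := neg_abs_le a
    nlinarith
  · rw [hpa]; exact hs0
  · have := abs_nonneg N
    have := abs_nonneg a
    have := neg_abs_le N
    have := le_abs_self a
    nlinarith
  · rw [hpa]; exact hs0

theorem eq_codedSystem [Finite A] [DiscreteTopology A] (h : IsStronglySynchronizing X) :
    X = (followerCode (synchroRel X)).codedSystem := by
  have : X.carrier = (followerCode (synchroRel X)).codedSystem.carrier := by
    refine Set.Subset.antisymm (fun x hx => ?_) (closure_minimal points_subset X.isClosed)
    change x ∈ closure _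
    rw [mem_closure_iff]
    intro U hU hxU
    obtain ⟨m, hm⟩ := exists_window_of_isOpen hU hxU
    obtain ⟨p, hp, h1, h2, h3⟩ := exists_periodic h hx m
    exact ⟨p, hm p h1, mem_points_of_unbounded hp h2 h3⟩
  revert this
  generalize (followerCode (synchroRel X)).codedSystem = Y
  intro this
  cases X; cases Y
  simp only at this
  subst this
  rfl

end CodedSystem

/-! ### Canonical Markov codes and normalization. -/

section Canonical

variable {A : Type*} [TopologicalSpace A] {X : Subshift A ℤ}

theorem eq_codedSystem_of_isCanonicalMarkovCode [Finite A] [DiscreteTopology A]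
    (h : IsStronglySynchronizing X) {C : MarkovCode A (Set A)} (hC : IsCanonicalMarkovCode X C) :
    X = C.codedSystem := by
  obtain ⟨-, am, ap, c, I, P, -, -, -, hP, -, rfl⟩ := hC
  rw [← followerCode_injective hP.2]
  have : {p | p ∈ synchroRel X ∧ p.1.length ≤ I} ∪ {p | p ∈ synchroRel X ∧ I < p.1.length} =
      synchroRel X := by
    ext p
    simp only [Set.mem_union, Set.mem_ofPred_eq]
    have := le_or_gt p.1.length I
    tauto
  rw [this]
  exact eq_codedSystem h

/-- The conditions on `km` and `kp` only involve sums of parameters. The minima of `Dm`, `Dp`, `Δm`,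
`Δp` can be moved into the constants, and a common amount can be cancelled from the constants of
both sides. The hypothesis `hE` ensures that the minima over entries are attained. -/
theorem exists_normalized [Finite A] {am ap : A} {c : List A} {I : ℕ} {P : Parameters A}
    (hE : (entries X am).Nonempty) (hP : AreParameters X am ap c I P) :
    ∃ P' : Parameters A, AreParameters X am ap c I P' ∧ P'.IsNormalized X am ap c := by
  classical
  obtain ⟨Dm, Mm, Mp, Dp, Δm, Jm, Jp, Δp⟩ := P
  set a := sInf (Dm '' entries X am)
  set b := sInf (Dp '' resetExits X am ap c)
  set a' := sInf {δ | ∃ e ∈ entries X am, δ ∈ Δm e}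
  set b' := sInf {δ | ∃ w ∈ counterExits X am ap c, δ ∈ Δp w}
  have ha : ∀ e ∈ entries X am, a ≤ Dm e := fun e he => Nat.sInf_le ⟨e, he, rfl⟩
  have hb : ∀ w ∈ resetExits X am ap c, b ≤ Dp w := fun e he => Nat.sInf_le ⟨e, he, rfl⟩
  have ha' : ∀ e ∈ entries X am, ∀ δ ∈ Δm e, a' ≤ δ := fun e he δ hδ => Nat.sInf_le ⟨e, he, hδ⟩
  have hb' : ∀ w ∈ counterExits X am ap c, ∀ δ ∈ Δp w, b' ≤ δ :=
    fun e he δ hδ => Nat.sInf_le ⟨e, he, hδ⟩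
  -- The truncated subtractions are exact on the words that matter, since each subtracted number is
  -- a lower bound there.
  let P' : Parameters A :=
    { Dm := fun e => Dm e - a
      Mm := Mm + a - min (Mm + a) (Mp + b)
      Mp := Mp + b - min (Mm + a) (Mp + b)
      Dp := fun w => Dp w - b
      Δm := fun e => (Δm e).image (· - a')
      Jm := Jm + a' - min (Jm + a') (Jp + b')
      Jp := Jp + b' - min (Jm + a') (Jp + b')
      Δp := fun w => (Δp w).image (· - b') }
  have hr : resetRel X am ap c P' = resetRel X am ap c ⟨Dm, Mm, Mp, Dp, Δm, Jm, Jp, Δp⟩ := by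
    ext p
    refine exists_congr fun e => and_congr_right fun he => exists_congr fun d =>
      and_congr_right fun hd => exists_congr fun km => exists_congr fun kp =>
      and_congr_right fun _ => and_congr_right fun _ => and_congr_left fun _ => ?_
    have := ha e he
    have := hb _ hd
    simp only [P']
    omega
  have hc : counterRel X am ap c P' = counterRel X am ap c ⟨Dm, Mm, Mp, Dp, Δm, Jm, Jp, Δp⟩ := by
    ext p
    refine exists_congr fun e => and_congr_right fun he => exists_congr fun d =>
      and_congr_right fun hd => exists_congr fun km => exists_congr fun kp =>
      and_congr_right fun _ => and_congr_right fun _ => and_congr_left fun _ => ?_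
    simp only [P', Finset.exists_mem_image]
    refine exists_congr fun δ => and_congr_right fun hδ => exists_congr fun δ' =>
      and_congr_right fun hδ' => ?_
    have := ha' e he δ hδ
    have := hb' _ hd δ' hδ'
    omega
  refine ⟨P', ⟨⟨fun e he => (hP.1.1 e he).image _, fun w hw => (hP.1.2 w hw).image _⟩, ?_⟩, ?_, ?_⟩
  · rw [hP.2]
    simp only [parameterRel, hr, hc]
  · intro hne
    obtain ⟨e, he, h1⟩ := Nat.sInf_mem (hE.image Dm)
    obtain ⟨w, hw, h2⟩ := Nat.sInf_mem (hne.image Dp)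
    refine ⟨by simp only [P']; omega, ⟨e, he, ?_⟩, ⟨w, hw, ?_⟩⟩
    · simp only [P', h1]; exact Nat.sub_self _
    · simp only [P', h2]; exact Nat.sub_self _
  · intro hne
    obtain ⟨e₀, he₀⟩ := hE
    obtain ⟨δ₀, hδ₀⟩ := hP.1.1 e₀ he₀
    obtain ⟨w₀, hw₀⟩ := hne
    obtain ⟨δ₁, hδ₁⟩ := hP.1.2 w₀ hw₀
    obtain ⟨e, he, h1⟩ := Nat.sInf_mem (⟨δ₀, e₀, he₀, hδ₀⟩ :
      {δ | ∃ e ∈ entries X am, δ ∈ Δm e}.Nonempty)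
    obtain ⟨w, hw, h2⟩ := Nat.sInf_mem (⟨δ₁, w₀, hw₀, hδ₁⟩ :
      {δ | ∃ w ∈ counterExits X am ap c, δ ∈ Δp w}.Nonempty)
    exact ⟨by simp only [P']; omega, ⟨e, he, Finset.mem_image.2 ⟨_, h1, Nat.sub_self _⟩⟩,
      ⟨w, hw, Finset.mem_image.2 ⟨_, h2, Nat.sub_self _⟩⟩⟩

theorem exists_isCanonicalMarkovCode [Finite A] (hX : IsStandardOneCounterShift X)
    (hE : ∀ am ap c, IsCharacteristicPair X am ap → IsConnectingWord X am ap c →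
      sigmaMinusPlus X ap = ∅ → (entries X am).Nonempty) :
    ∃ C, IsCanonicalMarkovCode X C := by
  classical
  obtain ⟨-, am, ap, c, h1, h2, h3, -, hP⟩ := id hX
  obtain ⟨P, hP'⟩ := Nat.find_spec hP
  obtain ⟨P', h4, h5⟩ := exists_normalized (hE am ap c h1 h2 h3) hP'
  exact ⟨_, hX, am, ap, c, Nat.find hP, P', h1, h2,
    ⟨⟨P', h4⟩, fun J hJ => Nat.find_min' hP hJ⟩, h4, h5, rfl⟩

end Canonical

/-! ### Entries, exits and characteristic pairs in terms of points. -/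

section PointForms

variable {A : Type*} [TopologicalSpace A] {X : Subshift A ℤ}

/-- `x` is admissible, ends in `e a^∞` with `a^∞` starting at `0`, where `e` begins with the last
synchronizing symbol of `x` and does not end with `a`. -/
structure IsEntryPoint (X : Subshift A ℤ) (a : A) (e : List A) (x : ℤ → A) : Prop where
  mem : x ∈ X.carrier
  tail : ∀ i ≥ 0, x i = a
  ne : x (-1) ≠ a
  seg_eq : seg x (-e.length) 0 = e
  sync : x (-e.length) ∈ synchro X
  nosync : ∀ i > -(e.length : ℤ), x i ∉ synchro X

/-- `y` is admissible, begins with `a^∞ w` with `w` starting at `0`, where `w` ends with the first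
synchronizing symbol of `y` and does not begin with `a`. -/
structure IsExitPoint (X : Subshift A ℤ) (a : A) (w : List A) (y : ℤ → A) : Prop where
  mem : y ∈ X.carrier
  tail : ∀ i < 0, y i = a
  ne : y 0 ≠ a
  seg_eq : seg y 0 w.length = w
  sync : y (w.length - 1) ∈ synchro X
  nosync : ∀ i < (w.length : ℤ) - 1, y i ∉ synchro X

theorem IsEntryPoint.length_pos {a : A} {e : List A} {x : ℤ → A} (h : IsEntryPoint X a e x)
    (ha : a ∉ synchro X) : 0 < e.length := by
  by_contra h0
  have h1 := h.sync
  rw [show (e.length : ℤ) = 0 by omega, neg_zero, h.tail 0 le_rfl] at h1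
  exact ha h1

theorem IsExitPoint.length_pos {a : A} {e : List A} {x : ℤ → A} (h : IsExitPoint X a e x)
    (ha : a ∉ synchro X) : 0 < e.length := by
  by_contra h0
  have h1 := h.sync
  rw [show (e.length : ℤ) = 0 by omega, h.tail _ (by omega)] at h1
  exact ha h1

/-- The admissible words with arbitrarily long runs of `a` converge to a point with tail `a^∞`. As
`a` is not synchronizing, the coordinate before the tail differs from `a` even if the stem is empty.
-/
theorem mem_entries_iff [Finite A] [DiscreteTopology A] {a : A} (ha : a ∉ synchro X) {e : List A} :
    e ∈ entries X a ↔ ∃ x, IsEntryPoint X a e x := by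
  constructor
  · rintro ⟨σ, d, hσ, ⟨-, hd, hl, hk⟩, rfl⟩
    obtain ⟨t, ht, -, htail⟩ := exists_seg_eq (fun _ => a) (-((σ :: d).length : ℤ)) (σ :: d)
    rw [neg_add_cancel] at ht htail
    have key : ∀ k : ℕ, ∃ x ∈ X.carrier,
        ∀ i ∈ {i : ℤ | -((σ :: d).length : ℤ) ≤ i ∧ i < k + 1}, x i = t i := by
      intro k
      have h1 := hk (k + 1) (by omega)
      have h2 : seg t (-((σ :: d).length : ℤ)) (k + 1) = σ :: d ++ List.replicate (k + 1) a := by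
        rw [← seg_append t (show -((σ :: d).length : ℤ) ≤ 0 by omega) (by omega), ht,
          seg_eq_replicate fun l h3 _ => htail l h3]
        congr 2
      rw [← h2, seg_mem_language_iff (by omega)] at h1
      obtain ⟨x, hx, h⟩ := h1
      exact ⟨x, hx, fun i hi => h i hi.1 hi.2⟩
    obtain ⟨x, hx, hxt⟩ := exists_mem_of_monotone_windows X t
      (fun k : ℕ => {i : ℤ | -((σ :: d).length : ℤ) ≤ i ∧ i < k + 1})
      (fun k l hkl i hi => ⟨hi.1, by have := hi.2; omega⟩) key
    have hx' : ∀ i ≥ -((σ :: d).length : ℤ), x i = t i := fun i hi =>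
      hxt i.natAbs i ⟨hi, by omega⟩
    have hpos : 0 < (σ :: d).length := by simp
    have hseg : seg x (-((σ :: d).length : ℤ)) 0 = σ :: d := by
      rw [seg_congr' fun l h1 _ => hx' l h1, ht]
    have hhead := head?_seg x (show -((σ :: d).length : ℤ) < 0 by omega)
    have hlast := getLast?_seg x (show -((σ :: d).length : ℤ) < 0 by omega)
    rw [hseg] at hhead hlast
    have hσ' : σ = x (-((σ :: d).length : ℤ)) := by simpa using hhead
    refine ⟨x, hx, fun i hi => ?_, fun h => ?_, hseg, by rw [← hσ']; exact hσ, fun i hi => ?_⟩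
    · rw [hx' i (by omega), htail i hi]
    · rw [zero_sub, h, List.getLast?_cons, Option.some.injEq] at hlast
      rcases hd0 : d.getLast? with _ | b
      · rw [hd0] at hlast
        exact ha (hlast ▸ hσ)
      · rw [hd0] at hlast
        exact hl (by rw [hd0]; simpa using hlast)
    · rcases lt_or_ge i 0 with h0 | h0
      · have hs := seg_cons x (show -((σ :: d).length : ℤ) < 0 by omega)
        rw [hseg, List.cons.injEq] at hs
        refine hd _ ?_
        rw [hs.2]
        exact mem_seg.2 ⟨i, by omega, h0, rfl⟩
      · rw [hx' i (by omega), htail i h0]; exact ha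
  · rintro ⟨x, h⟩
    have hpos := h.length_pos ha
    refine ⟨x (-e.length), seg x (-e.length + 1) 0, h.sync,
      ⟨seg_mem_language h.mem _ _, fun τ hτ => ?_, fun hl => ?_, fun k _ => ?_⟩, ?_⟩
    · obtain ⟨l, h1, h2, rfl⟩ := mem_seg.1 hτ
      exact h.nosync l (by omega)
    · rcases eq_or_lt_of_le (show -(e.length : ℤ) + 1 ≤ 0 by omega) with h1 | h1
      · rw [h1] at hl; simp at hl
      · rw [getLast?_seg x h1] at hl
        exact h.ne (by simpa using hl)
    · rw [← seg_cons x (by omega)]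
      have : List.replicate k a = seg x 0 k := by
        rw [seg_eq_replicate fun l h1 _ => h.tail l h1]; simp
      rw [this, seg_append x (by omega) (by omega)]
      exact seg_mem_language h.mem _ _
    · rw [← seg_cons x (by omega), h.seg_eq]

theorem mem_exits_iff [Finite A] [DiscreteTopology A] {a : A} (ha : a ∉ synchro X) {w : List A} :
    w ∈ exits X a ↔ ∃ y, IsExitPoint X a w y := by
  constructor
  · rintro ⟨σ, d, hσ, ⟨-, hd, hl, hk⟩, rfl⟩
    obtain ⟨t, ht, htail, -⟩ := exists_seg_eq (fun _ => a) 0 (d ++ [σ])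
    rw [zero_add] at ht
    have key : ∀ k : ℕ, ∃ x ∈ X.carrier,
        ∀ i ∈ {i : ℤ | -(k + 1 : ℤ) ≤ i ∧ i < (d ++ [σ]).length}, x i = t i := by
      intro k
      have h1 := hk (k + 1) (by omega)
      have h2 : seg t (-(k + 1)) (d ++ [σ]).length = List.replicate (k + 1) a ++ d ++ [σ] := by
        rw [← seg_append t (show -(k + 1 : ℤ) ≤ 0 by omega) (by omega), ht,
          seg_eq_replicate fun l _ h3 => htail l h3, List.append_assoc]
        congr 2
        omega
      rw [← h2, seg_mem_language_iff (by omega)] at h1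
      obtain ⟨x, hx, h⟩ := h1
      exact ⟨x, hx, fun i hi => h i hi.1 hi.2⟩
    obtain ⟨x, hx, hxt⟩ := exists_mem_of_monotone_windows X t
      (fun k : ℕ => {i : ℤ | -(k + 1 : ℤ) ≤ i ∧ i < (d ++ [σ]).length})
      (fun k l hkl i hi => ⟨by have := hi.1; omega, hi.2⟩) key
    have hx' : ∀ i < ((d ++ [σ]).length : ℤ), x i = t i := fun i hi =>
      hxt i.natAbs i ⟨by omega, hi⟩
    have hpos : 0 < (d ++ [σ]).length := by simp
    have hseg : seg x 0 (d ++ [σ]).length = d ++ [σ] := by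
      rw [seg_congr' fun l _ h1 => hx' l h1, ht]
    have hhead := head?_seg x (show 0 < ((d ++ [σ]).length : ℤ) by omega)
    have hlast := getLast?_seg x (show 0 < ((d ++ [σ]).length : ℤ) by omega)
    rw [hseg] at hhead hlast
    have hσ' : σ = x ((d ++ [σ]).length - 1) := by simpa using hlast
    refine ⟨x, hx, fun i hi => ?_, fun h => ?_, hseg, by rw [← hσ']; exact hσ, fun i hi => ?_⟩
    · rw [hx' i (by omega), htail i hi]
    · rw [h] at hhead
      rcases d with _ | ⟨b, d⟩
      · have : σ = a := by simpa using hhead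
        exact ha (this ▸ hσ)
      · exact hl (by simpa using hhead)
    · rcases lt_or_ge i 0 with h0 | h0
      · rw [hx' i (by omega), htail i h0]; exact ha
      · have hs := seg_concat x (show 0 ≤ ((d ++ [σ]).length : ℤ) - 1 by omega)
        rw [sub_add_cancel, hseg] at hs
        refine hd _ ?_
        rw [(List.append_inj' hs rfl).1]
        exact mem_seg.2 ⟨i, by omega, hi, rfl⟩
  · rintro ⟨y, h⟩
    have hpos := h.length_pos ha
    have hw : seg y 0 (w.length - 1) ++ [y (w.length - 1)] = w := by
      rw [← seg_concat y (by omega), sub_add_cancel, h.seg_eq]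
    refine ⟨y (w.length - 1), seg y 0 (w.length - 1), h.sync,
      ⟨seg_mem_language h.mem _ _, fun τ hτ => ?_, fun hl => ?_, fun k _ => ?_⟩, hw.symm⟩
    · obtain ⟨l, h1, h2, rfl⟩ := mem_seg.1 hτ
      exact h.nosync l (by omega)
    · rcases eq_or_lt_of_le (show 0 ≤ (w.length : ℤ) - 1 by omega) with h1 | h1
      · rw [← h1] at hl; simp at hl
      · rw [head?_seg y h1] at hl
        exact h.ne (by simpa using hl)
    · rw [List.append_assoc, hw]
      have : List.replicate k a = seg y (-k) 0 := by
        rw [seg_eq_replicate fun l _ h1 => h.tail l h1]; simp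
      rw [this, ← h.seg_eq, seg_append y (by omega) (by omega)]
      exact seg_mem_language h.mem _ _

theorem exists_last {P : ℤ → Prop} {p N : ℤ} (hp : P p) (hN : ∀ q, P q → q ≤ N) :
    ∃ q, P q ∧ p ≤ q ∧ ∀ l > q, ¬ P l := by
  obtain ⟨q, hq, h⟩ := Int.exists_greatest_of_bdd ⟨N, hN⟩ ⟨p, hp⟩
  exact ⟨q, hq, h p hp, fun l hl h' => by have := h l h'; omega⟩

theorem exists_first {P : ℤ → Prop} {p N : ℤ} (hp : P p) (hN : ∀ q, P q → N ≤ q) :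
    ∃ q, P q ∧ q ≤ p ∧ ∀ l < q, ¬ P l := by
  obtain ⟨q, hq, h⟩ := Int.exists_least_of_bdd ⟨N, hN⟩ ⟨p, hp⟩
  exact ⟨q, hq, h p hp, fun l hl h' => by have := h l h'; omega⟩

/-- The tail of `a` bounds the synchronizing positions, so there is a last one. The translation
moves the coordinate after the last symbol different from `a` to `0`. -/
theorem exists_isEntryPoint {a : A} (ha : a ∉ synchro X) {x : ℤ → A} (hx : x ∈ X.carrier)
    (hr : RightAsymptotic x a) {p : ℤ} (hp : x p ∈ synchro X) :
    ∃ s e, IsEntryPoint X a e (shift s x) := by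
  obtain ⟨N, hN⟩ := hr
  obtain ⟨q, hq, -, hq'⟩ := exists_last (P := fun i => x i ∈ synchro X) (N := N) hp fun i hi => by
    by_contra h
    rw [hN i (by omega)] at hi
    exact ha hi
  obtain ⟨s, hs, hqs, hs'⟩ := exists_last (P := fun i => x i ≠ a) (p := q) (N := N)
    (fun h => ha (by rw [← h]; exact hq)) fun i hi => by
      by_contra h
      exact hi (hN i (by omega))
  have hl := length_seg x (show q ≤ s + 1 by omega)
  refine ⟨s + 1, seg x q (s + 1), shift_mem X hx _, fun i hi => ?_, ?_, ?_, ?_, fun i hi => ?_⟩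
  · exact not_not.1 (hs' _ (show s + 1 + i > s by omega))
  · rw [shift_apply']; simpa using hs
  · rw [seg_shift, hl]; congr 1 <;> ring
  · rw [shift_apply', hl]; convert hq using 2; ring
  · exact hq' _ (show s + 1 + i > q by omega)

theorem exists_isExitPoint {a : A} (ha : a ∉ synchro X) {x : ℤ → A} (hx : x ∈ X.carrier)
    (hr : LeftAsymptotic x a) {p : ℤ} (hp : x p ∈ synchro X) :
    ∃ s e, IsExitPoint X a e (shift s x) := by
  obtain ⟨N, hN⟩ := hr
  obtain ⟨q, hq, -, hq'⟩ := exists_first (P := fun i => x i ∈ synchro X) (N := N) hp fun i hi => by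
    by_contra h
    rw [hN i (by omega)] at hi
    exact ha hi
  obtain ⟨s, hs, hqs, hs'⟩ := exists_first (P := fun i => x i ≠ a) (p := q) (N := N)
    (fun h => ha (by rw [← h]; exact hq)) fun i hi => by
      by_contra h
      exact hi (hN i (by omega))
  have hl := length_seg x (show s ≤ q + 1 by omega)
  refine ⟨s, seg x s (q + 1), shift_mem X hx _, fun i hi => ?_, ?_, ?_, ?_, fun i hi => ?_⟩
  · exact not_not.1 (hs' _ (show s + i < s by omega))
  · rw [shift_apply']; simpa using hs
  · rw [seg_shift, hl]; congr 1 <;> ring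
  · rw [shift_apply', hl]; convert hq using 2; ring
  · exact hq' _ (show s + i < q by omega)

theorem sigmaMinusPlus_eq_empty_iff [Finite A] [DiscreteTopology A] {a : A}
    (ha : a ∉ synchro X) : sigmaMinusPlus X a = ∅ ↔
      ∀ x ∈ X.carrier, RightAsymptotic x a → ∀ p, x p ∉ synchro X := by
  rw [Set.eq_empty_iff_forall_notMem]
  constructor
  · intro h x hx hr p hp
    obtain ⟨s, e, he⟩ := exists_isEntryPoint ha hx hr hp
    obtain ⟨σ, d, hσ, hd, -⟩ := (mem_entries_iff ha).2 ⟨_, he⟩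
    exact h σ ⟨hσ, d, hd⟩
  · rintro h σ ⟨hσ, d, hd⟩
    obtain ⟨x, hx⟩ := (mem_entries_iff ha).1 ⟨σ, d, hσ, hd, rfl⟩
    exact h x hx.mem ⟨0, hx.tail⟩ _ hx.sync

/-- Conditions (a), (b), (c⁻), (c⁺) in terms of synchronizing symbols. -/
structure HasCharacteristicPoints (X : Subshift A ℤ) (am ap : A) : Prop where
  left_mem : (fun _ => am) ∈ X.carrier
  right_mem : (fun _ => ap) ∈ X.carrier
  connecting : ∃ o ∈ X.carrier, LeftAsymptotic o am ∧ RightAsymptotic o ap ∧ ∀ p, o p ∉ synchro X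
  unique : ∀ x ∈ X.carrier, LeftAsymptotic x am → RightAsymptotic x ap → (∀ p, x p ∉ synchro X) →
    ∀ y ∈ X.carrier, LeftAsymptotic y am → RightAsymptotic y ap → (∀ p, y p ∉ synchro X) →
    ∃ g : ℤ, y = shift g x
  returning : ∃ x ∈ X.carrier, LeftAsymptotic x ap ∧ RightAsymptotic x am ∧ ∃ p, x p ∈ synchro X
  entering : ∃ K : ℕ, ∀ x ∈ X.carrier, RightAsymptotic x am → ∀ p, x p ∈ synchro X →
    (∀ q > p, x q ∉ synchro X) → ∀ l ≥ p + K, x l = am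
  leaving : ∃ K : ℕ, ∀ x ∈ X.carrier, LeftAsymptotic x ap → ∀ p, x p ∈ synchro X →
    (∀ q < p, x q ∉ synchro X) → ∀ l ≤ p - K, x l = ap

theorem containsSynchronizingWord_iff (h : IsStronglySynchronizing X) {x : ℤ → A}
    (hx : x ∈ X.carrier) : ContainsSynchronizingWord X x ↔ ∃ p, x p ∈ synchro X := by
  constructor
  · rintro ⟨i, n, hs⟩
    obtain ⟨-, -, Q, hQ⟩ := h
    obtain ⟨j, -, -, hj⟩ := hQ x hx i n hs
    exact ⟨j, hj⟩
  · rintro ⟨p, hp⟩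
    refine ⟨p, 1, ?_⟩
    have : block x p 1 = [x p] := by simp [block]
    rw [this]
    exact hp

theorem block_pos_of_isSynchronizing {x : ℤ → A} {i : ℤ} {n : ℕ}
    (hs : IsSynchronizing X (block x i n)) : 0 < n := by
  rcases Nat.eq_zero_or_pos n with rfl | h0
  · exact absurd (by simp [block]) hs.1
  · exact h0

theorem isSynchronizing_block_iff {x : ℤ → A} (hx : x ∈ X.carrier) {i : ℤ} {n : ℕ} (hn : 0 < n) :
    IsSynchronizing X (block x i n) ↔ SyncOn X x i (i + n - 1) := by
  rw [block_eq_seg, isSynchronizing_seg_iff hx (by omega)]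

/-- Every synchronizing word has a synchronizing symbol within distance `Q`, so replacing words by
symbols only changes the constant. -/
theorem conditionCMinus_iff (h : IsStronglySynchronizing X) {am : A} : ConditionCMinus X am ↔
    ∃ K : ℕ, ∀ x ∈ X.carrier, RightAsymptotic x am → ∀ p, x p ∈ synchro X →
      (∀ q > p, x q ∉ synchro X) → ∀ l ≥ p + K, x l = am := by
  obtain ⟨-, -, Q, hQ⟩ := h
  constructor
  · rintro ⟨K, hK⟩
    refine ⟨Q + K, fun x hx hr p hp hq l hl => ?_⟩
    -- The window `[p, p + Q]` is chosen so long that a synchronizing word to its right would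
    -- produce a synchronizing symbol to the right of `p`.
    obtain ⟨j, -, h2, h3⟩ := hK x hx hr p (Q + 1) (by
        rw [isSynchronizing_block_iff hx (by omega)]
        exact ((mem_synchro_iff hx p).1 hp).mono le_rfl le_rfl (by push_cast; omega))
      (fun k _ hs => by
        obtain ⟨j, h1, -, h3⟩ := hQ x hx _ _ hs
        exact hq j (by push_cast at h1; omega) h3)
    exact h3 l (by push_cast at h2 hl; omega)
  · rintro ⟨K, hK⟩
    refine ⟨K + 1, fun x hx hr i n hs hk => ?_⟩
    have hn := block_pos_of_isSynchronizing hs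
    obtain ⟨j, h1, h2, h3⟩ := hQ x hx i n hs
    obtain ⟨q, hq, hjq, hq'⟩ := exists_last (P := fun i => x i ∈ synchro X) (N := i + n - 1) h3
      fun q hq => by
        by_contra hlt
        -- This is the length of the interval `[i + n, q]`; the word there is synchronizing because
        -- its last symbol is.
        refine hk (q - (i + n) + 1).toNat (by omega) ?_
        rw [isSynchronizing_block_iff hx (by omega)]
        exact ((mem_synchro_iff hx q).1 hq).mono le_rfl (by omega) (by omega)
    have hqle : q ≤ i + n - 1 := by
      by_contra hlt
      refine hk (q - (i + n) + 1).toNat (by omega) ?_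
      rw [isSynchronizing_block_iff hx (by omega)]
      exact ((mem_synchro_iff hx q).1 hq).mono le_rfl (by omega) (by omega)
    exact ⟨i + n - 1 + (K + 1), by omega, by push_cast; omega,
      fun l hl => hK x hx hr q hq hq' l (by omega)⟩

theorem conditionCPlus_iff (h : IsStronglySynchronizing X) {ap : A} : ConditionCPlus X ap ↔
    ∃ K : ℕ, ∀ x ∈ X.carrier, LeftAsymptotic x ap → ∀ p, x p ∈ synchro X →
      (∀ q < p, x q ∉ synchro X) → ∀ l ≤ p - K, x l = ap := by
  obtain ⟨-, -, Q, hQ⟩ := h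
  constructor
  · rintro ⟨K, hK⟩
    refine ⟨Q + K, fun x hx hr p hp hq l hl => ?_⟩
    obtain ⟨j, h1, -, h3⟩ := hK x hx hr (p - Q) (Q + 1) (by
        rw [isSynchronizing_block_iff hx (by omega)]
        exact ((mem_synchro_iff hx p).1 hp).mono le_rfl (by omega) (by push_cast; omega))
      (fun k _ hs => by
        obtain ⟨j, -, h2, h3⟩ := hQ x hx _ _ hs
        exact hq j (by omega) h3)
    exact h3 l (by push_cast at hl; omega)
  · rintro ⟨K, hK⟩
    refine ⟨K + 1, fun x hx hr i n hs hk => ?_⟩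
    have hn := block_pos_of_isSynchronizing hs
    have hbd : ∀ q, x q ∈ synchro X → i ≤ q := fun q hq => by
      by_contra hlt
      refine hk (i - q).toNat (by omega) ?_
      rw [isSynchronizing_block_iff hx (by omega)]
      exact ((mem_synchro_iff hx q).1 hq).mono le_rfl (by omega) (by omega)
    obtain ⟨j, h1, h2, h3⟩ := hQ x hx i n hs
    obtain ⟨q, hq, hjq, hq'⟩ := exists_first (P := fun i => x i ∈ synchro X) h3 hbd
    have := hbd q hq
    exact ⟨i - (K + 1), by push_cast; omega, by omega,
      fun l hl => hK x hx hr q hq hq' l (by omega)⟩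

theorem satisfiesABC_iff (h : IsStronglySynchronizing X) {am ap : A} :
    SatisfiesABC X am ap ↔ HasCharacteristicPoints X am ap := by
  have e : ∀ x ∈ X.carrier, ¬ ContainsSynchronizingWord X x ↔ ∀ p, x p ∉ synchro X := by
    intro x hx
    rw [containsSynchronizingWord_iff h hx, not_exists]
  constructor
  · rintro ⟨h1, h2, ⟨⟨o, ho, hl, hr, hs⟩, hu⟩, ⟨x, hx, hxl, hxr, hxs⟩, h5, h6⟩
    exact ⟨h1, h2, ⟨o, ho, hl, hr, (e o ho).1 hs⟩,
      fun x hx hl hr hs y hy hl' hr' hs' =>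
        hu x ⟨hx, hl, hr, (e x hx).2 hs⟩ y ⟨hy, hl', hr', (e y hy).2 hs'⟩,
      ⟨x, hx, hxl, hxr, (containsSynchronizingWord_iff h hx).1 hxs⟩,
      (conditionCMinus_iff h).1 h5, (conditionCPlus_iff h).1 h6⟩
  · rintro ⟨h1, h2, ⟨o, ho, hl, hr, hs⟩, hu, ⟨x, hx, hxl, hxr, hxs⟩, h5, h6⟩
    exact ⟨h1, h2, ⟨⟨o, ho, hl, hr, (e o ho).2 hs⟩,
      fun x hx y hy => hu x hx.1 hx.2.1 hx.2.2.1 ((e x hx.1).1 hx.2.2.2) y hy.1 hy.2.1 hy.2.2.1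
        ((e y hy.1).1 hy.2.2.2)⟩,
      ⟨x, hx, hxl, hxr, (containsSynchronizingWord_iff h hx).2 hxs⟩,
      (conditionCMinus_iff h).2 h5, (conditionCPlus_iff h).2 h6⟩

end PointForms

/-! ### Transport of the characteristic pair. -/

section SyncConj

variable {A B : Type*} [TopologicalSpace A] [TopologicalSpace B] {X : Subshift A ℤ}
  {Y : Subshift B ℤ} {f : (ℤ → A) → ℤ → B} {g : (ℤ → B) → ℤ → A} {r R : ℕ}

/-- A conjugacy for which synchronizing symbols of a point and of its image have
distance at most `R`. -/
structure IsSyncConj (X : Subshift A ℤ) (Y : Subshift B ℤ) (f : (ℤ → A) → ℤ → B)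
    (g : (ℤ → B) → ℤ → A) (r R : ℕ) : Prop extends IsConj X Y f g r where
  map_sync : ∀ x ∈ X.carrier, ∀ p, x p ∈ synchro X → ∃ q, p - R ≤ q ∧ q ≤ p + R ∧
    f x q ∈ synchro Y
  inv_sync : ∀ y ∈ Y.carrier, ∀ p, y p ∈ synchro Y → ∃ q, p - R ≤ q ∧ q ≤ p + R ∧
    g y q ∈ synchro X

theorem IsSyncConj.symm (h : IsSyncConj X Y f g r R) : IsSyncConj Y X g f r R :=
  ⟨h.toIsConj.symm, h.inv_sync, h.map_sync⟩

theorem IsConj.exists_isSyncConj [DiscreteTopology A] [DiscreteTopology B]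
    (h : IsConj X Y f g r) (hX : IsStronglySynchronizing X) (hY : IsStronglySynchronizing Y) :
    ∃ R, IsSyncConj X Y f g r R := by
  obtain ⟨R₁, h₁⟩ := h.exists_synchro_near hY
  obtain ⟨R₂, h₂⟩ := h.symm.exists_synchro_near hX
  refine ⟨max R₁ R₂, h, fun x hx p hp => ?_, fun x hx p hp => ?_⟩
  · obtain ⟨q, h3, h4, h5⟩ := h₁ x hx p p le_rfl ((mem_synchro_iff hx p).1 hp)
    have := le_max_left R₁ R₂
    exact ⟨q, by omega, by omega, h5⟩
  · obtain ⟨q, h3, h4, h5⟩ := h₂ x hx p p le_rfl ((mem_synchro_iff hx p).1 hp)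
    have := le_max_right R₁ R₂
    exact ⟨q, by omega, by omega, h5⟩

theorem IsConj.map_const (h : IsConj X Y f g r) {a : A} (ha : (fun _ => a) ∈ X.carrier) :
    f (fun _ => a) = fun _ => f (fun _ => a) 0 := by
  funext i
  exact h.map_local _ ha _ ha _ _ fun _ _ _ => rfl

theorem IsConj.map_apply_of_const (h : IsConj X Y f g r) {a : A} (ha : (fun _ => a) ∈ X.carrier)
    {x : ℤ → A} (hx : x ∈ X.carrier) {i : ℤ} (hi : ∀ l, i - r ≤ l → l ≤ i + r → x l = a) :
    f x i = f (fun _ => a) 0 := by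
  rw [h.map_eq' hx ha hi, h.map_const ha]

theorem IsConj.leftAsymptotic (h : IsConj X Y f g r) {a : A} (ha : (fun _ => a) ∈ X.carrier)
    {x : ℤ → A} (hx : x ∈ X.carrier) (hl : LeftAsymptotic x a) :
    LeftAsymptotic (f x) (f (fun _ => a) 0) := by
  obtain ⟨N, hN⟩ := hl
  exact ⟨N - r, fun i hi => h.map_apply_of_const ha hx fun l _ h2 => hN l (by omega)⟩

theorem IsConj.rightAsymptotic (h : IsConj X Y f g r) {a : A} (ha : (fun _ => a) ∈ X.carrier)
    {x : ℤ → A} (hx : x ∈ X.carrier) (hl : RightAsymptotic x a) :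
    RightAsymptotic (f x) (f (fun _ => a) 0) := by
  obtain ⟨N, hN⟩ := hl
  exact ⟨N + r, fun i hi => h.map_apply_of_const ha hx fun l h1 _ => hN l (by omega)⟩

theorem IsConj.inv_const (h : IsConj X Y f g r) {a : A} (ha : (fun _ => a) ∈ X.carrier) :
    g (fun _ => f (fun _ => a) 0) 0 = a := by
  rw [← h.map_const ha, h.left_inv _ ha]

theorem IsConj.const_mem (h : IsConj X Y f g r) {a : A} (ha : (fun _ => a) ∈ X.carrier) :
    (fun _ => f (fun _ => a) 0) ∈ Y.carrier := by
  rw [← h.map_const ha]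
  exact h.map_mem _ ha

theorem IsSyncConj.nosync (h : IsSyncConj X Y f g r R) {x : ℤ → A} (hx : x ∈ X.carrier)
    (hs : ∀ p, x p ∉ synchro X) (p : ℤ) : f x p ∉ synchro Y := by
  intro hp
  obtain ⟨q, -, -, hq⟩ := h.inv_sync _ (h.map_mem x hx) p hp
  rw [h.left_inv x hx] at hq
  exact hs q hq

/-- Asymptotics to fixed points and the absence of synchronizing symbols are preserved. In the
entering and leaving conditions the extreme synchronizing position moves by at most `R` and the tail
by at most `r`, so `R + K + r` serves as the new bound. -/
theorem IsSyncConj.hasCharacteristicPoints (h : IsSyncConj X Y f g r R) {am ap : A}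
    (hc : HasCharacteristicPoints X am ap) :
    HasCharacteristicPoints Y (f (fun _ => am) 0) (f (fun _ => ap) 0) := by
  have hm := hc.left_mem
  have hp := hc.right_mem
  have ginv : ∀ {a : A} (ha : (fun _ => a) ∈ X.carrier) {y : ℤ → B}, y ∈ Y.carrier →
      (LeftAsymptotic y (f (fun _ => a) 0) → LeftAsymptotic (g y) a) ∧
      (RightAsymptotic y (f (fun _ => a) 0) → RightAsymptotic (g y) a) := by
    intro a ha y hy
    constructor
    · intro hl
      have := h.toIsConj.symm.leftAsymptotic (h.const_mem ha) hy hl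
      rwa [h.inv_const ha] at this
    · intro hl
      have := h.toIsConj.symm.rightAsymptotic (h.const_mem ha) hy hl
      rwa [h.inv_const ha] at this
  refine ⟨h.const_mem hm, h.const_mem hp, ?_, ?_, ?_, ?_, ?_⟩
  · obtain ⟨o, ho, hl, hr, hs⟩ := hc.connecting
    exact ⟨f o, h.map_mem o ho, h.leftAsymptotic hm ho hl, h.rightAsymptotic hp ho hr,
      h.nosync ho hs⟩
  · intro x hx hl hr hs y hy hl' hr' hs'
    obtain ⟨s, e⟩ := hc.unique _ (h.inv_mem x hx) ((ginv hm hx).1 hl) ((ginv hp hx).2 hr)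
      (h.symm.nosync hx hs) _ (h.inv_mem y hy) ((ginv hm hy).1 hl') ((ginv hp hy).2 hr')
      (h.symm.nosync hy hs')
    refine ⟨s, ?_⟩
    rw [← h.right_inv y hy, e, h.map_shift (h.inv_mem x hx), h.right_inv x hx]
  · obtain ⟨x, hx, hl, hr, p, hs⟩ := hc.returning
    obtain ⟨q, -, -, hq⟩ := h.map_sync x hx p hs
    exact ⟨f x, h.map_mem x hx, h.leftAsymptotic hp hx hl, h.rightAsymptotic hm hx hr, q, hq⟩
  · obtain ⟨K, hK⟩ := hc.entering
    refine ⟨R + K + r, fun y hy hr p hs hq l hl => ?_⟩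
    have bd : ∀ q, g y q ∈ synchro X → q ≤ p + R := fun q hq' => by
      by_contra hlt
      obtain ⟨q', h1, -, h3⟩ := h.map_sync _ (h.inv_mem y hy) q hq'
      rw [h.right_inv y hy] at h3
      exact hq q' (by omega) h3
    obtain ⟨q, h1, h2, h3⟩ := h.inv_sync y hy p hs
    obtain ⟨q', h4, h5, h6⟩ := exists_last (P := fun i => g y i ∈ synchro X) h3 bd
    have h7 := hK _ (h.inv_mem y hy) ((ginv hm hy).2 hr) q' h4 h6
    rw [← h.right_inv y hy]
    have := bd q' h4
    exact h.map_apply_of_const hm (h.inv_mem y hy) fun l' h8 _ => h7 l' (by push_cast at hl; omega)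
  · obtain ⟨K, hK⟩ := hc.leaving
    refine ⟨R + K + r, fun y hy hr p hs hq l hl => ?_⟩
    have bd : ∀ q, g y q ∈ synchro X → p - R ≤ q := fun q hq' => by
      by_contra hlt
      obtain ⟨q', -, h1, h3⟩ := h.map_sync _ (h.inv_mem y hy) q hq'
      rw [h.right_inv y hy] at h3
      exact hq q' (by omega) h3
    obtain ⟨q, h1, h2, h3⟩ := h.inv_sync y hy p hs
    obtain ⟨q', h4, h5, h6⟩ := exists_first (P := fun i => g y i ∈ synchro X) h3 bd
    have h7 := hK _ (h.inv_mem y hy) ((ginv hp hy).1 hr) q' h4 h6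
    rw [← h.right_inv y hy]
    have := bd q' h4
    exact h.map_apply_of_const hp (h.inv_mem y hy) fun l' _ h8 => h7 l' (by push_cast at hl; omega)

theorem IsSyncConj.isCharacteristicPair (h : IsSyncConj X Y f g r R)
    (hX : IsStronglySynchronizing X) (hY : IsStronglySynchronizing Y) {am ap : A}
    (hc : IsCharacteristicPair X am ap) :
    IsCharacteristicPair Y (f (fun _ => am) 0) (f (fun _ => ap) 0) := by
  obtain ⟨h1, h2⟩ := hc
  refine ⟨(satisfiesABC_iff hY).2 (h.hasCharacteristicPoints ((satisfiesABC_iff hX).1 h1)),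
    fun bm bp hb => ?_⟩
  have hb' := (satisfiesABC_iff hY).1 hb
  obtain ⟨e1, e2⟩ := h2 _ _ ((satisfiesABC_iff hX).2 (h.symm.hasCharacteristicPoints hb'))
  rw [← e1, ← e2]
  exact ⟨(h.toIsConj.symm.inv_const hb'.left_mem).symm, (h.toIsConj.symm.inv_const hb'.right_mem).symm⟩

end SyncConj

/-! ### The common setting, with a normalized connecting point. -/

section Base

variable {A : Type*} [TopologicalSpace A] {X : Subshift A ℤ}

/-- A strongly synchronizing subshift with characteristic pair `(am, ap)` and connecting point `o`,
normalized such that the connecting word `c` begins at `0`. The number `K` bounds the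
lengths of the words in `entries X am` and in `exits X ap`. -/
structure IsBase (X : Subshift A ℤ) (am ap : A) (c : List A) (o : ℤ → A) (K : ℕ) : Prop where
  strong : IsStronglySynchronizing X
  points : HasCharacteristicPoints X am ap
  norec : ∀ x ∈ X.carrier, RightAsymptotic x ap → ∀ p, x p ∉ synchro X
  o_mem : o ∈ X.carrier
  o_left : ∀ i < 0, o i = am
  o_right : ∀ i ≥ (c.length : ℤ), o i = ap
  o_seg : seg o 0 c.length = c
  o_nosync : ∀ i, o i ∉ synchro X
  head_ne : c.head? ≠ some am
  last_ne : c.getLast? ≠ some ap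
  ne : am ≠ ap
  entries_le : ∀ e ∈ entries X am, e.length ≤ K
  exits_le : ∀ w ∈ exits X ap, w.length ≤ K
  entries_nonempty : (entries X am).Nonempty

theorem HasCharacteristicPoints.nosync {am ap : A} (h : HasCharacteristicPoints X am ap) :
    am ∉ synchro X ∧ ap ∉ synchro X := by
  obtain ⟨o, -, ⟨N, hN⟩, ⟨N', hN'⟩, hs⟩ := h.connecting
  exact ⟨by rw [← hN N le_rfl]; exact hs N, by rw [← hN' N' le_rfl]; exact hs N'⟩

theorem IsBase.left_nosync {am ap : A} {c : List A} {o : ℤ → A} {K : ℕ}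
    (h : IsBase X am ap c o K) : am ∉ synchro X := h.points.nosync.1

theorem IsBase.right_nosync {am ap : A} {c : List A} {o : ℤ → A} {K : ℕ}
    (h : IsBase X am ap c o K) : ap ∉ synchro X := h.points.nosync.2

/-- If the fixed points coincided, the returning point of condition (b) would run into `ap` after a
synchronizing symbol. -/
theorem HasCharacteristicPoints.ne {am ap : A} (h : HasCharacteristicPoints X am ap)
    (hn : ∀ x ∈ X.carrier, RightAsymptotic x ap → ∀ p, x p ∉ synchro X) : am ≠ ap := by
  rintro rfl
  obtain ⟨x, hx, -, hr, p, hp⟩ := h.returning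
  exact hn x hx hr p hp

/-- The bounds in (c⁻) and (c⁺) limit the lengths of entries at `am` and of exits at `ap`, so both
sets are finite. The point of condition (b) supplies an entry. -/
theorem exists_isBase [Finite A] [DiscreteTopology A] {am ap : A} {c : List A}
    (hs : IsStronglySynchronizing X) (hp : SatisfiesABC X am ap)
    (hc : IsConnectingWord X am ap c) (hn : sigmaMinusPlus X ap = ∅) :
    ∃ o K, IsBase X am ap c o K := by
  have hp' := (satisfiesABC_iff hs).1 hp
  have hm := hp'.nosync
  have hn' := (sigmaMinusPlus_eq_empty_iff hm.2).1 hn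
  obtain ⟨h1, h2, x, ⟨hx, -, -, hxs⟩, i, hl, hb, hr⟩ := hc
  rw [containsSynchronizingWord_iff hs hx, not_exists] at hxs
  obtain ⟨K₁, hK₁⟩ := hp'.entering
  obtain ⟨K₂, hK₂⟩ := hp'.leaving
  refine ⟨shift i x, K₁ + K₂, hs, hp', hn', shift_mem X hx i, fun j hj => hl _ (by omega),
    fun j hj => hr _ (by omega), ?_, fun j => hxs _, h1, h2, hp'.ne hn', fun e he => ?_,
    fun w hw => ?_, ?_⟩
  · rw [seg_shift, add_zero, ← block_eq_seg, hb]
  · obtain ⟨x, hx⟩ := (mem_entries_iff hm.1).1 he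
    by_contra hlt
    exact hx.ne (hK₁ x hx.mem ⟨0, hx.tail⟩ _ hx.sync hx.nosync (-1) (by omega))
  · obtain ⟨x, hx⟩ := (mem_exits_iff hm.2).1 hw
    by_contra hlt
    exact hx.ne (hK₂ x hx.mem ⟨-1, fun i hi => hx.tail i (by omega)⟩ _ hx.sync hx.nosync 0
      (by omega))
  · obtain ⟨x, hx, -, hr, p, hp⟩ := hp'.returning
    obtain ⟨s, e, he⟩ := exists_isEntryPoint hm.1 hx hr hp
    exact ⟨e, (mem_entries_iff hm.1).2 ⟨_, he⟩⟩

/-- The word lies between the first coordinate different from `am` and the last one different from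
`ap`. These cannot cross by more than one step, since some coordinate would then equal both symbols.
-/
theorem exists_isConnectingWord {am ap : A} (hs : IsStronglySynchronizing X)
    (hp : HasCharacteristicPoints X am ap) (hne : am ≠ ap) : ∃ c, IsConnectingWord X am ap c := by
  obtain ⟨o, ho, hl, hr, hos⟩ := hp.connecting
  obtain ⟨N, hN⟩ := id hl
  obtain ⟨N', hN'⟩ := id hr
  have hx : o ∈ connectingPoints X am ap :=
    ⟨ho, hl, hr, by rw [containsSynchronizingWord_iff hs ho, not_exists]; exact hos⟩
  obtain ⟨i, hi, -, hi'⟩ := exists_first (P := fun i => o i ≠ am) (p := N') (N := N)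
    (by rw [hN' N' le_rfl]; exact hne.symm) fun q hq => by
      by_contra h
      exact hq (hN q (by omega))
  obtain ⟨j, hj, -, hj'⟩ := exists_last (P := fun i => o i ≠ ap) (p := N) (N := N')
    (by rw [hN N le_rfl]; exact hne) fun q hq => by
      by_contra h
      exact hq (hN' q (by omega))
  have hij : i ≤ j + 1 := by
    by_contra hlt
    exact hne ((not_not.1 (hi' (j + 1) (by omega))).symm.trans (not_not.1 (hj' (j + 1) (by omega))))
  have hlen := length_seg o hij
  refine ⟨seg o i (j + 1), fun h => ?_, fun h => ?_, o, hx, i,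
    fun l hl => not_not.1 (hi' l hl), ?_, fun l hl => not_not.1 (hj' l (by omega))⟩
  · rcases eq_or_lt_of_le hij with h1 | h1
    · rw [h1] at h; simp at h
    · rw [head?_seg o h1] at h
      exact hi (by simpa using h)
  · rcases eq_or_lt_of_le hij with h1 | h1
    · rw [h1] at h; simp at h
    · rw [getLast?_seg o h1] at h
      exact hj (by simpa using h)
  · rw [block_eq_seg, hlen]; congr 1; ring

end Base

/-! ### Unique decomposition around a long run. -/

section WordDecomposition

variable {A : Type*}

theorem replicate_append_inj {a : A} {k k' : ℕ} {v v' : List A} (hv : v.head? ≠ some a)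
    (hv' : v'.head? ≠ some a) (h : List.replicate k a ++ v = List.replicate k' a ++ v') :
    k = k' ∧ v = v' := by
  induction k generalizing k' with
  | zero =>
    cases k' with
    | zero => exact ⟨rfl, by simpa using h⟩
    | succ k' =>
      simp only [List.replicate_zero, List.nil_append] at h
      rw [h, List.replicate_succ] at hv
      simp at hv
  | succ k ih =>
    cases k' with
    | zero =>
      simp only [List.replicate_zero, List.nil_append] at h
      rw [← h, List.replicate_succ] at hv'
      simp at hv'
    | succ k' =>
      simp only [List.replicate_succ, List.cons_append, List.cons.injEq, true_and] at h
      obtain ⟨h1, h2⟩ := ih h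
      exact ⟨by rw [h1], h2⟩

/-- If `e'` were longer than `e`, its last symbol would fall into the run `a^k`, which is at least
as long as `e'`. -/
theorem append_replicate_prefix {a : A} {k k' : ℕ} {e e' v v' : List A}
    (he' : e'.getLast? ≠ some a) (hle : e'.length ≤ k)
    (h : e ++ List.replicate k a ++ v = e' ++ List.replicate k' a ++ v') :
    e'.length ≤ e.length := by
  by_contra hlt
  have h1 : (e ++ List.replicate k a ++ v)[e'.length - 1]? =
      (e' ++ List.replicate k' a ++ v')[e'.length - 1]? := by rw [h]
  rw [List.append_assoc, List.getElem?_append_right (by omega),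
    List.getElem?_append_left (by simp; omega), List.append_assoc,
    List.getElem?_append_left (by omega), List.getElem?_replicate, if_pos (by omega)] at h1
  exact he' (by rw [List.getLast?_eq_getElem?]; exact h1.symm)

theorem append_replicate_append_inj {a : A} {k k' : ℕ} {e e' v v' : List A}
    (he : e.getLast? ≠ some a) (he' : e'.getLast? ≠ some a) (hv : v.head? ≠ some a)
    (hv' : v'.head? ≠ some a) (hk : e'.length ≤ k) (hk' : e.length ≤ k')
    (h : e ++ List.replicate k a ++ v = e' ++ List.replicate k' a ++ v') :
    e = e' ∧ k = k' ∧ v = v' := by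
  have h1 := append_replicate_prefix he' hk h
  have h2 := append_replicate_prefix he hk' h.symm
  rw [List.append_assoc, List.append_assoc] at h
  obtain ⟨h3, h4⟩ := List.append_inj h (by omega)
  exact ⟨h3, replicate_append_inj hv hv' h4⟩

theorem exists_nat_bound {α : Type*} {S : Set α} (hS : S.Finite) (F : α → ℕ) :
    ∃ b, ∀ x ∈ S, F x ≤ b := by
  obtain ⟨b, hb⟩ := (hS.image F).bddAbove
  exact ⟨b, fun x hx => hb ⟨x, hx, rfl⟩⟩

end WordDecomposition

/-! ### From parameters to the counter structure. -/

section Words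

variable {A : Type*} [TopologicalSpace A] {X : Subshift A ℤ} {am ap : A} {c : List A} {o : ℤ → A}
  {K : ℕ}

theorem IsBase.getLast?_entries (h : IsBase X am ap c o K) {e : List A} (he : e ∈ entries X am) :
    e.getLast? ≠ some am := by
  obtain ⟨σ, d, hσ, ⟨-, -, hd, -⟩, rfl⟩ := he
  rw [List.getLast?_cons]
  rcases hd' : d.getLast? with _ | b
  · intro h'
    simp at h'
    exact h.left_nosync (h' ▸ hσ)
  · rw [hd'] at hd
    simpa using hd

theorem head?_exits {a : A} (ha : a ∉ synchro X) {w : List A} (hw : w ∈ exits X a) :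
    w.head? ≠ some a := by
  obtain ⟨σ, d, hσ, ⟨-, -, hd, -⟩, rfl⟩ := hw
  cases d with
  | nil =>
    intro h'
    simp at h'
    exact ha (h' ▸ hσ)
  | cons b d => simpa using hd

theorem IsBase.head?_arc (h : IsBase X am ap c o K) {k : ℕ} (hk : 1 ≤ k) (w : List A) :
    (c ++ List.replicate k ap ++ w).head? ≠ some am := by
  have := h.head_ne
  cases c with
  | nil =>
    obtain ⟨k, rfl⟩ := Nat.exists_eq_add_of_le' hk
    simp [List.replicate_succ, h.ne.symm]
  | cons b c => simpa using this

theorem IsBase.arc_inj (h : IsBase X am ap c o K) {k k' : ℕ} {w w' : List A}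
    (hw : w ∈ exits X ap) (hw' : w' ∈ exits X ap)
    (e : c ++ List.replicate k ap ++ w = c ++ List.replicate k' ap ++ w') : k = k' ∧ w = w' := by
  rw [List.append_assoc, List.append_assoc] at e
  exact replicate_append_inj (head?_exits h.right_nosync hw) (head?_exits h.right_nosync hw')
    (List.append_cancel_left e)

/-- `v` ends with its only synchronizing symbol. -/
def EndsSynchronizing (X : Subshift A ℤ) (v : List A) : Prop :=
  ∃ d σ, v = d ++ [σ] ∧ σ ∈ synchro X ∧ ∀ τ ∈ d, τ ∉ synchro X

theorem endsSynchronizing_exits {a : A} {w : List A} (hw : w ∈ exits X a) :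
    EndsSynchronizing X w := by
  obtain ⟨σ, d, hσ, ⟨-, hd, -, -⟩, rfl⟩ := hw
  exact ⟨d, σ, rfl, hσ, hd⟩

theorem IsBase.nosync_connecting (h : IsBase X am ap c o K) : ∀ τ ∈ c, τ ∉ synchro X := by
  intro τ hτ
  rw [← h.o_seg] at hτ
  obtain ⟨l, -, -, rfl⟩ := mem_seg.1 hτ
  exact h.o_nosync l

theorem IsBase.endsSynchronizing_arc (h : IsBase X am ap c o K) {k : ℕ} {w : List A}
    (hw : w ∈ exits X ap) : EndsSynchronizing X (c ++ List.replicate k ap ++ w) := by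
  obtain ⟨σ, d, hσ, ⟨-, hd, -, -⟩, rfl⟩ := hw
  refine ⟨c ++ List.replicate k ap ++ d, σ, by simp, hσ, fun τ hτ => ?_⟩
  simp only [List.mem_append, List.mem_replicate] at hτ
  rcases hτ with (hτ | hτ) | hτ
  · exact h.nosync_connecting τ hτ
  · rw [hτ.2]; exact h.right_nosync
  · exact hd τ hτ

/-- The word begins and ends with a synchronizing symbol and has none in between, so admissibility
is all that membership in `C(X)` requires. -/
theorem IsBase.mem_synchroRel_iff (h : IsBase X am ap c o K) {e : List A} (he : e ∈ entries X am)
    {k : ℕ} {v : List A} (hv : EndsSynchronizing X v) {p : List A × A}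
    (hp : p.1 ++ [p.2] = e ++ List.replicate k am ++ v) :
    p ∈ synchroRel X ↔ e ++ List.replicate k am ++ v ∈ language X := by
  obtain ⟨d, σ, rfl, hσ, hd⟩ := hv
  rw [← List.append_assoc] at hp
  obtain ⟨h1, h2⟩ := List.append_inj' hp rfl
  have h2' : p.2 = σ := by simpa using h2
  rw [← List.append_assoc, ← hp]
  refine ⟨fun h => h.2.2, fun hl => ⟨?_, by rw [h2']; exact hσ, hl⟩⟩
  obtain ⟨τ, b, hτ, ⟨-, hb, -, -⟩, rfl⟩ := he
  refine ⟨τ, b ++ List.replicate k am ++ d, by simpa using h1, hτ, fun ρ hρ => ?_⟩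
  simp only [List.mem_append, List.mem_replicate] at hρ
  rcases hρ with (hρ | hρ) | hρ
  · exact hb ρ hρ
  · rw [hρ.2]; exact h.left_nosync
  · exact hd ρ hρ

theorem resetDelay_spec {w : List A} (hw : w ∈ resetExits X am ap c) :
    ResetsFrom X am ap c w (resetDelay X am ap c w) := Nat.sInf_mem hw.2

theorem IsBase.arc_mem_exits (h : IsBase X am ap c o K) {k : ℕ} {w : List A}
    (hw : w ∈ exits X ap) (hk : 1 ≤ k)
    (hl : ∀ km, 1 ≤ km → List.replicate km am ++ (c ++ List.replicate k ap ++ w) ∈ language X) :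
    c ++ List.replicate k ap ++ w ∈ exits X am := by
  obtain ⟨d, σ, e, hσ, hd⟩ := h.endsSynchronizing_arc (k := k) hw
  refine ⟨σ, d, hσ, ⟨?_, hd, ?_, fun km hkm => ?_⟩, e⟩
  · have := hl 1 le_rfl
    rw [e] at this
    exact language_of_append_left (language_of_append_right this)
  · have := h.head?_arc hk w
    rw [e] at this
    cases d with
    | nil => simp
    | cons b d => simpa using this
  · have := hl km hkm
    rw [e] at this
    simpa using this

theorem IsBase.resetMinusExits_subset (h : IsBase X am ap c o K) :
    resetMinusExits X am ap c ⊆ exits X am := by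
  rintro _ ⟨w, hw, kp, hkp, rfl⟩
  refine h.arc_mem_exits hw.1 (by omega) fun km hkm => ?_
  have := resetDelay_spec hw km kp hkm hkp
  simpa using this

theorem IsBase.finite_entries [Finite A] (h : IsBase X am ap c o K) : (entries X am).Finite :=
  (List.finite_length_le A K).subset h.entries_le

theorem IsBase.finite_exits [Finite A] (h : IsBase X am ap c o K) : (exits X ap).Finite :=
  (List.finite_length_le A K).subset h.exits_le

/-- A description of the long words of the code `C(X)` that does not mention
lengths of particular words. -/
structure HasCounterStructure (X : Subshift A ℤ) (am ap : A) (c : List A) : Prop where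
  reset : ∃ B : ℕ, ∀ v ∈ exits X am, B < v.length → v ∈ resetMinusExits X am ap c
  short_exit : ∀ B : ℕ, ∃ N : ℕ, ∀ e ∈ entries X am, ∀ v ∈ exits X am, v.length ≤ B →
    ∀ k ≥ N, e ++ List.replicate k am ++ v ∈ language X
  reset_iff : ∃ (W : ℕ) (De Dw : List A → ℤ), ∀ e ∈ entries X am, ∀ w ∈ resetExits X am ap c,
    ∀ km ≥ W, ∀ kp ≥ W,
      (e ++ List.replicate km am ++ (c ++ List.replicate kp ap ++ w) ∈ language X ↔
        kp + Dw w ≤ km + De e)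
  counter_iff : ∃ (W : ℕ) (Δe Δw : List A → Finset ℤ), (∀ e ∈ entries X am, (Δe e).Nonempty) ∧
    (∀ w ∈ counterExits X am ap c, (Δw w).Nonempty) ∧
    ∀ e ∈ entries X am, ∀ w ∈ counterExits X am ap c, ∀ km ≥ W, ∀ kp ≥ W,
      (e ++ List.replicate km am ++ (c ++ List.replicate kp ap ++ w) ∈ language X ↔
        ∃ δ ∈ Δe e, ∃ δ' ∈ Δw w, δ + km = kp + δ')
  long : ∀ W : ℕ, ∃ N B : ℕ, ∀ p ∈ synchroRel X, N < p.1.length → ∃ e ∈ entries X am, ∃ km ≥ W,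
    (∃ v ∈ exits X am, v.length ≤ B ∧ p.1 ++ [p.2] = e ++ List.replicate km am ++ v) ∨
    ∃ w ∈ exits X ap, ∃ kp ≥ W,
      p.1 ++ [p.2] = e ++ List.replicate km am ++ (c ++ List.replicate kp ap ++ w)

/-- The long words of `C₋ ∪ C_reset ∪ C_counter` contain a long power of `am`. -/
theorem IsBase.exists_of_parameterRel [Finite A] (h : IsBase X am ap c o K)
    {P : Parameters A} {B : ℕ}
    (hB : ∀ v ∈ exits X am \ resetMinusExits X am ap c, v.length ≤ B) (W : ℕ) :
    ∃ N, ∀ p ∈ parameterRel X am ap c P, N < p.1.length → ∃ e ∈ entries X am, ∃ km ≥ W,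
      (∃ v ∈ exits X am \ resetMinusExits X am ap c,
        p.1 ++ [p.2] = e ++ List.replicate km am ++ v) ∨
      (∃ w ∈ resetExits X am ap c, ∃ kp ≥ 1, P.Mp + kp + P.Dp w ≤ P.Dm e + km + P.Mm ∧
        p.1 ++ [p.2] = e ++ List.replicate km am ++
          (c ++ List.replicate (kp + resetDelay X am ap c w) ap ++ w)) ∨
      ∃ w ∈ counterExits X am ap c, ∃ kp ≥ W,
        (∃ δ ∈ P.Δm e, ∃ δ' ∈ P.Δp w, δ + km + P.Jm = P.Jp + kp + δ') ∧
        p.1 ++ [p.2] = e ++ List.replicate km am ++ (c ++ List.replicate kp ap ++ w) := by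
  obtain ⟨b₁, h₁⟩ := exists_nat_bound h.finite_entries P.Dm
  obtain ⟨b₂, h₂⟩ := exists_nat_bound h.finite_exits (resetDelay X am ap c)
  obtain ⟨b₃, h₃⟩ := exists_nat_bound h.finite_entries fun e => (P.Δm e).sup id
  obtain ⟨b₄, h₄⟩ := exists_nat_bound h.finite_exits fun w => (P.Δp w).sup id
  refine ⟨2 * K + B + c.length + 2 * W + b₁ + b₂ + b₃ + b₄ + P.Mm + P.Jm + P.Jp + 1, ?_⟩
  rintro p ((⟨e, he, d, hd, km, -, hp⟩ | ⟨e, he, d, hd, km, kp, -, hkp, hle, hp⟩) |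
    ⟨e, he, d, hd, km, kp, -, -, ⟨δ, hδ, δ', hδ', hle⟩, hp⟩) hN
  · have hl := congrArg List.length hp
    simp only [List.length_append, List.length_replicate] at hl
    have l1 := h.entries_le e he
    have l2 := hB _ hd
    simp only [List.length_append] at l2
    exact ⟨e, he, km, by omega, Or.inl ⟨_, hd, by rw [hp]; simp⟩⟩
  · have hl := congrArg List.length hp
    simp only [List.length_append, List.length_replicate] at hl
    have l1 := h.entries_le e he
    have l2 := h.exits_le _ hd.1
    simp only [List.length_append] at l2
    have l3 := h₁ e he
    have l4 := h₂ _ hd.1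
    exact ⟨e, he, km, by omega, Or.inr (Or.inl ⟨_, hd, kp, hkp, hle, by rw [hp]; simp⟩)⟩
  · have hl := congrArg List.length hp
    simp only [List.length_append, List.length_replicate] at hl
    have l1 := h.entries_le e he
    have l2 := h.exits_le _ hd.1
    simp only [List.length_append] at l2
    have l3 := h₃ e he
    have l4 := h₄ _ hd.1
    have l5 : δ ≤ (P.Δm e).sup id := Finset.le_sup (f := id) hδ
    have l6 : δ' ≤ (P.Δp (d ++ [p.2])).sup id := Finset.le_sup (f := id) hδ'
    exact ⟨e, he, km, by omega,
      Or.inr (Or.inr ⟨_, hd, kp, by omega, ⟨δ, hδ, δ', hδ', hle⟩, by rw [hp]; simp⟩)⟩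

theorem mem_minusRel {P : Parameters A} {e : List A} (he : e ∈ entries X am) {v : List A}
    (hv : v ∈ exits X am \ resetMinusExits X am ap c) {km : ℕ} (hkm : 1 ≤ km) {p : List A × A}
    (hp : p.1 ++ [p.2] = e ++ List.replicate km am ++ v) : p ∈ parameterRel X am ap c P := by
  obtain ⟨d, σ, rfl, -, -⟩ := endsSynchronizing_exits hv.1
  rw [← List.append_assoc] at hp
  obtain ⟨h1, h2⟩ := List.append_inj' hp rfl
  rw [← h2] at hv
  exact Or.inl (Or.inl ⟨e, he, d, hv, km, hkm, h1⟩)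

theorem mem_resetRel {P : Parameters A} {e : List A} (he : e ∈ entries X am) {w : List A}
    (hw : w ∈ resetExits X am ap c) {km kp : ℕ} (hkm : 1 ≤ km) (hkp : 1 ≤ kp)
    (hle : P.Mp + kp + P.Dp w ≤ P.Dm e + km + P.Mm) {p : List A × A}
    (hp : p.1 ++ [p.2] = e ++ List.replicate km am ++
      (c ++ List.replicate (kp + resetDelay X am ap c w) ap ++ w)) :
    p ∈ parameterRel X am ap c P := by
  obtain ⟨d, σ, rfl, -, -⟩ := endsSynchronizing_exits hw.1
  rw [← List.append_assoc, ← List.append_assoc] at hp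
  obtain ⟨h1, h2⟩ := List.append_inj' hp rfl
  rw [← h2] at hw h1 hle
  exact Or.inl (Or.inr ⟨e, he, d, hw, km, kp, hkm, hkp, hle, by rw [h1]; simp⟩)

theorem mem_counterRel {P : Parameters A} {e : List A} (he : e ∈ entries X am) {w : List A}
    (hw : w ∈ counterExits X am ap c) {km kp : ℕ} (hkm : 1 ≤ km) (hkp : 1 ≤ kp)
    (hle : ∃ δ ∈ P.Δm e, ∃ δ' ∈ P.Δp w, δ + km + P.Jm = P.Jp + kp + δ') {p : List A × A}
    (hp : p.1 ++ [p.2] = e ++ List.replicate km am ++ (c ++ List.replicate kp ap ++ w)) :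
    p ∈ parameterRel X am ap c P := by
  obtain ⟨d, σ, rfl, -, -⟩ := endsSynchronizing_exits hw.1
  rw [← List.append_assoc, ← List.append_assoc] at hp
  obtain ⟨h1, h2⟩ := List.append_inj' hp rfl
  rw [← h2] at hw hle
  exact Or.inr ⟨e, he, d, hw, km, kp, hkm, hkp, hle, by rw [h1]; simp⟩

theorem exists_pair {X : Subshift A ℤ} {v : List A} (hv : EndsSynchronizing X v) (u : List A) :
    ∃ p : List A × A, p.1 ++ [p.2] = u ++ v ∧ p.1.length + 1 = u.length + v.length := by
  obtain ⟨d, σ, rfl, -, -⟩ := hv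
  exact ⟨(u ++ d, σ), by simp, by simp; omega⟩

/-- Words with long runs decompose uniquely, so membership of a long word in the parametrized code
is decided by the condition on its own `e`, `km`, `kp`, `w`. The equality of the two codes then
gives admissibility. -/
theorem IsBase.hasCounterStructure [Finite A] (h : IsBase X am ap c o K)
    (hr : ResetCondition X am ap c) {I : ℕ} {P : Parameters A} (hP : AreParameters X am ap c I P) :
    HasCounterStructure X am ap c := by
  classical
  obtain ⟨B, hB⟩ := exists_nat_bound hr List.length
  have hrel : ∀ p : List A × A, I < p.1.length →
      (p ∈ synchroRel X ↔ p ∈ parameterRel X am ap c P) := fun p hp => by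
    have := Set.ext_iff.1 (followerCode_injective hP.2) p
    simpa [hp] using this
  obtain ⟨N₀, hN₀⟩ := h.exists_of_parameterRel (P := P) hB (K + 1)
  obtain ⟨b₂, h₂⟩ := exists_nat_bound h.finite_exits (resetDelay X am ap c)
  obtain ⟨b₃, h₃⟩ := exists_nat_bound h.finite_exits P.Dp
  have hdec : ∀ e ∈ entries X am, ∀ w ∈ exits X ap, ∀ km ≥ K, ∀ kp ≥ 1,
      ∀ e' ∈ entries X am, ∀ km' ≥ K, ∀ v', v'.head? ≠ some am →
      e ++ List.replicate km am ++ (c ++ List.replicate kp ap ++ w) =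
        e' ++ List.replicate km' am ++ v' →
      e = e' ∧ km = km' ∧ c ++ List.replicate kp ap ++ w = v' :=
    fun e he w hw km hkm kp hkp e' he' km' hkm' v' hv' hh =>
      append_replicate_append_inj (h.getLast?_entries he) (h.getLast?_entries he')
        (h.head?_arc hkp w) hv' ((h.entries_le e' he').trans hkm)
        ((h.entries_le e he).trans hkm') hh
  refine ⟨⟨B, fun v hv hlt => ?_⟩, fun B' => ?_, ?_, ?_, fun W => ?_⟩
  · by_contra hv'
    have := hB v ⟨hv, hv'⟩
    omega
  · refine ⟨I + P.Mp + B' + b₃ + 1, fun e he v hv hlen k hk => ?_⟩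
    obtain ⟨p, hp, hpl⟩ := exists_pair (endsSynchronizing_exits hv) (e ++ List.replicate k am)
    rw [← h.mem_synchroRel_iff he (endsSynchronizing_exits hv) hp]
    simp only [List.length_append, List.length_replicate] at hpl
    have hvpos : 0 < v.length := by
      obtain ⟨σ, d, -, -, rfl⟩ := hv
      simp
    rw [hrel p (by omega)]
    by_cases hv' : v ∈ resetMinusExits X am ap c
    · obtain ⟨w, hw, kp, hkp, rfl⟩ := hv'
      simp only [List.length_append, List.length_replicate] at hlen
      have := h₃ w hw.1
      exact mem_resetRel he hw (by omega) hkp (by omega) hp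
    · exact mem_minusRel he ⟨hv, hv'⟩ (by omega) hp
  · refine ⟨I + N₀ + b₂ + K + 1, fun e => P.Dm e + P.Mm,
      fun w => P.Mp + P.Dp w - resetDelay X am ap c w, fun e he w hw km hkm kp hkp => ?_⟩
    have hes := h.endsSynchronizing_arc (k := kp) hw.1
    obtain ⟨p, hp, hpl⟩ := exists_pair hes (e ++ List.replicate km am)
    rw [← h.mem_synchroRel_iff he hes hp]
    simp only [List.length_append, List.length_replicate] at hpl
    rw [hrel p (by omega)]
    have hD := h₂ w hw.1
    beta_reduce
    have hkpD : kp - resetDelay X am ap c w + resetDelay X am ap c w = kp := by omega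
    constructor
    · intro hpar
      obtain ⟨e', he', km', hkm', hh⟩ := hN₀ p hpar (by omega)
      rw [hp] at hh
      rcases hh with ⟨v, hv, hh⟩ | ⟨w', hw', kp', hkp', hle, hh⟩ | ⟨w', hw', kp', hkp', -, hh⟩
      · obtain ⟨-, -, rfl⟩ := hdec e he w hw.1 km (by omega) kp (by omega) e' he' km' (by omega) v
          (head?_exits h.left_nosync hv.1) hh
        exact absurd ⟨w, hw, kp - resetDelay X am ap c w, by omega, by rw [hkpD]⟩ hv.2
      · obtain ⟨rfl, rfl, h3⟩ := hdec e he w hw.1 km (by omega) kp (by omega) e' he' km' (by omega)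
          _ (h.head?_arc (by omega) w') hh
        obtain ⟨h4, rfl⟩ := h.arc_inj hw.1 hw'.1 h3
        omega
      · obtain ⟨rfl, rfl, h3⟩ := hdec e he w hw.1 km (by omega) kp (by omega) e' he' km' (by omega)
          _ (h.head?_arc (by omega) w') hh
        obtain ⟨h4, rfl⟩ := h.arc_inj hw.1 hw'.1 h3
        exact absurd hw hw'.2
    · intro hle
      exact mem_resetRel (km := km) (kp := kp - resetDelay X am ap c w) he hw (by omega) (by omega)
        (by omega)
        (by rw [hkpD]; exact hp)
  · refine ⟨I + N₀ + B + K + 1, fun e => (P.Δm e).image fun δ : ℕ => (δ : ℤ) + P.Jm,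
      fun w => (P.Δp w).image fun δ : ℕ => (δ : ℤ) + P.Jp, fun e he => (hP.1.1 e he).image _,
      fun w hw => (hP.1.2 w hw).image _, fun e he w hw km hkm kp hkp => ?_⟩
    have hes := h.endsSynchronizing_arc (k := kp) hw.1
    obtain ⟨p, hp, hpl⟩ := exists_pair hes (e ++ List.replicate km am)
    rw [← h.mem_synchroRel_iff he hes hp]
    simp only [List.length_append, List.length_replicate] at hpl
    rw [hrel p (by omega)]
    constructor
    · intro hpar
      obtain ⟨e', he', km', hkm', hh⟩ := hN₀ p hpar (by omega)
      rw [hp] at hh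
      rcases hh with ⟨v, hv, hh⟩ | ⟨w', hw', kp', hkp', hle, hh⟩ |
        ⟨w', hw', kp', hkp', ⟨δ, hδ, δ', hδ', hle⟩, hh⟩
      -- A non-reset exit at `am` has length at most `B`, while this one contains a run of more than
      -- `B` symbols `ap`.
      · obtain ⟨-, -, rfl⟩ := hdec e he w hw.1 km (by omega) kp (by omega) e' he' km' (by omega) v
          (head?_exits h.left_nosync hv.1) hh
        have := hB _ hv
        simp only [List.length_append, List.length_replicate] at this
        omega
      · obtain ⟨rfl, rfl, h3⟩ := hdec e he w hw.1 km (by omega) kp (by omega) e' he' km' (by omega)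
          _ (h.head?_arc (by omega) w') hh
        obtain ⟨h4, rfl⟩ := h.arc_inj hw.1 hw'.1 h3
        exact absurd hw' hw.2
      · obtain ⟨rfl, rfl, h3⟩ := hdec e he w hw.1 km (by omega) kp (by omega) e' he' km' (by omega)
          _ (h.head?_arc (by omega) w') hh
        obtain ⟨rfl, rfl⟩ := h.arc_inj hw.1 hw'.1 h3
        exact ⟨_, Finset.mem_image_of_mem _ hδ, _, Finset.mem_image_of_mem _ hδ', by omega⟩
    · rintro ⟨_, h1, _, h2, hle⟩
      obtain ⟨δ, hδ, rfl⟩ := Finset.mem_image.1 h1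
      obtain ⟨δ', hδ', rfl⟩ := Finset.mem_image.1 h2
      exact mem_counterRel he hw (by omega) (by omega) ⟨δ, hδ, δ', hδ', by omega⟩ hp
  · obtain ⟨N, hN⟩ := h.exists_of_parameterRel (P := P) hB W
    refine ⟨I + N, B + c.length + W + K, fun p hp hlen => ?_⟩
    rw [hrel p (by omega)] at hp
    obtain ⟨e, he, km, hkm, ⟨v, hv, hh⟩ | ⟨w, hw, kp, hkp, -, hh⟩ | ⟨w, hw, kp, hkp, -, hh⟩⟩ :=
      hN p hp (by omega)
    · exact ⟨e, he, km, hkm, Or.inl ⟨v, hv.1, (hB v hv).trans (by omega), hh⟩⟩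
    · rcases le_or_gt W (kp + resetDelay X am ap c w) with hW | hW
      · exact ⟨e, he, km, hkm, Or.inr ⟨w, hw.1, _, hW, hh⟩⟩
      -- A reset word whose run of `ap` is shorter than `W` counts as an exit at `am` of bounded
      -- length.
      · refine ⟨e, he, km, hkm, Or.inl ⟨_, h.resetMinusExits_subset ⟨w, hw, kp, hkp, rfl⟩, ?_, hh⟩⟩
        have := h.exits_le w hw.1
        simp only [List.length_append, List.length_replicate]
        omega
    · exact ⟨e, he, km, hkm, Or.inr ⟨w, hw.1, kp, hkp, hh⟩⟩

end Words

/-! ### From the counter structure back to parameters. -/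

section Parameters

variable {A : Type*} [TopologicalSpace A] {X : Subshift A ℤ} {am ap : A} {c : List A} {o : ℤ → A}
  {K : ℕ}

theorem HasCounterStructure.resetCondition [Finite A] (hS : HasCounterStructure X am ap c) :
    ResetCondition X am ap c := by
  obtain ⟨B, hB⟩ := hS.reset
  refine (List.finite_length_le A B).subset fun v hv => ?_
  by_contra hlt
  exact hv.2 (hB v hv.1 (by simpa using hlt))

/-- Integer offsets become natural numbers by adding bounds for their absolute values. Words with
short runs of `ap`, which the counter conditions do not cover, are handled by the clause on short
exits. -/
theorem IsBase.exists_areParameters [Finite A] (h : IsBase X am ap c o K)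
    (hS : HasCounterStructure X am ap c) : ∃ I P, AreParameters X am ap c I P := by
  classical
  obtain ⟨B₀, hB₀⟩ := hS.reset
  obtain ⟨W₁, De, Dw, hreset⟩ := hS.reset_iff
  obtain ⟨W₂, Δe, Δw, hΔe, hΔw, hcounter⟩ := hS.counter_iff
  obtain ⟨bE, hbE⟩ := exists_nat_bound h.finite_entries fun e => (De e).natAbs
  obtain ⟨bW, hbW⟩ := exists_nat_bound h.finite_exits fun e => (Dw e).natAbs
  obtain ⟨bD, hbD⟩ := exists_nat_bound h.finite_exits (resetDelay X am ap c)
  obtain ⟨dE, hdE⟩ := exists_nat_bound h.finite_entries fun e => (Δe e).sup Int.natAbs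
  obtain ⟨dW, hdW⟩ := exists_nat_bound h.finite_exits fun e => (Δw e).sup Int.natAbs
  obtain ⟨N, B, hlong⟩ := hS.long (W₁ + W₂ + bD + 1)
  obtain ⟨N₁, hshort⟩ := hS.short_exit (B₀ + c.length + W₁ + K)
  have hdE' : ∀ e ∈ entries X am, ∀ δ ∈ Δe e, δ.natAbs ≤ dE := fun e he δ hδ =>
    (Finset.le_sup (f := Int.natAbs) hδ).trans (hdE e he)
  have hdW' : ∀ e ∈ exits X ap, ∀ δ ∈ Δw e, δ.natAbs ≤ dW := fun e he δ hδ =>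
    (Finset.le_sup (f := Int.natAbs) hδ).trans (hdW e he)
  -- The bound added to the offset of an entry is put on the exit side as `Mp` or `Jp`, and
  -- conversely, so the conditions are unchanged.
  let P : Parameters A :=
    { Dm := fun e => (De e + bE).toNat
      Mm := bW
      Mp := bE
      Dp := fun w => (Dw w + resetDelay X am ap c w + bW).toNat
      Δm := fun e => (Δe e).image fun δ : ℤ => (δ + dE).toNat
      Jm := dW
      Jp := dE
      Δp := fun w => (Δw w).image fun δ : ℤ => (δ + dW).toNat }
  have hB₀' : ∀ v ∈ exits X am \ resetMinusExits X am ap c, v.length ≤ B₀ := fun v hv => by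
    by_contra hlt
    exact hv.2 (hB₀ v hv.1 (by omega))
  have hR : ∀ e ∈ entries X am, ∀ w ∈ exits X ap, ∀ km kp : ℕ,
      P.Mp + kp + P.Dp w ≤ P.Dm e + km + P.Mm ↔
        ((kp + resetDelay X am ap c w : ℕ) : ℤ) + Dw w ≤ km + De e := fun e he w hw km kp => by
    have h1 := hbE e he
    have h2 := hbW w hw
    simp only [P]
    push_cast
    omega
  have hC : ∀ e ∈ entries X am, ∀ w ∈ exits X ap, ∀ km kp : ℕ,
      (∃ δ ∈ P.Δm e, ∃ δ' ∈ P.Δp w, δ + km + P.Jm = P.Jp + kp + δ') ↔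
        ∃ δ ∈ Δe e, ∃ δ' ∈ Δw w, δ + km = kp + δ' := fun e he w hw km kp => by
    simp only [P, Finset.exists_mem_image]
    refine exists_congr fun δ => and_congr_right fun hδ => exists_congr fun δ' =>
      and_congr_right fun hδ' => ?_
    have h1 := hdE' e he δ hδ
    have h2 := hdW' w hw δ' hδ'
    omega
  obtain ⟨N₂, hN₂⟩ := h.exists_of_parameterRel (P := P) hB₀' (W₁ + W₂ + N₁ + 1)
  refine ⟨N + N₂ + K + 2 * B + bD + 2 * bE + 2 * bW + 1, P, ⟨fun e he => (hΔe e he).image _,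
    fun w hw => (hΔw w hw).image _⟩, congrArg _ (Set.ext fun p => and_congr_left fun hp => ?_)⟩
  constructor
  · intro hps
    obtain ⟨e, he, km, hkm, ⟨v, hv, hvl, hh⟩ | ⟨w, hw, kp, hkp, hh⟩⟩ := hlong p hps (by omega)
    · by_cases hv' : v ∈ resetMinusExits X am ap c
      · obtain ⟨w, hw, kp, hkp, rfl⟩ := hv'
        -- The exit is short and the word is long, so `km` is large enough for the inequality.
        refine mem_resetRel he hw (by omega) hkp ((hR e he w hw.1 km kp).2 ?_) hh
        have hl := congrArg List.length hh
        simp only [List.length_append, List.length_replicate, List.length_singleton] at hl hvl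
        have h1 := hbE e he
        have h2 := hbW w hw.1
        have h3 := hbD w hw.1
        have h4 := h.entries_le e he
        push_cast
        omega
      · exact mem_minusRel he ⟨hv, hv'⟩ (by omega) hh
    · have hL := (h.mem_synchroRel_iff he (h.endsSynchronizing_arc hw) hh).1 hps
      by_cases hw' : w ∈ resetExits X am ap c
      · have h3 := hbD w hw
        have h4 : kp - resetDelay X am ap c w + resetDelay X am ap c w = kp := by omega
        refine mem_resetRel (km := km) (kp := kp - resetDelay X am ap c w) he hw' (by omega)
          (by omega) ((hR e he w hw _ _).2 ?_) (by rw [h4]; exact hh)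
        rw [h4]
        exact (hreset e he w hw' km (by omega) kp (by omega)).1 hL
      · exact mem_counterRel he ⟨hw, hw'⟩ (by omega) (by omega) ((hC e he w hw _ _).2
          ((hcounter e he w ⟨hw, hw'⟩ km (by omega) kp (by omega)).1 hL)) hh
  · intro hpp
    obtain ⟨e, he, km, hkm, ⟨v, hv, hh⟩ | ⟨w, hw, kp, hkp, hle, hh⟩ | ⟨w, hw, kp, hkp, hle, hh⟩⟩ :=
      hN₂ p hpp (by omega)
    · rw [h.mem_synchroRel_iff he (endsSynchronizing_exits hv.1) hh]
      have := hB₀' v hv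
      exact hshort e he v hv.1 (by omega) km (by omega)
    · rw [h.mem_synchroRel_iff he (h.endsSynchronizing_arc hw.1) hh]
      rcases le_or_gt W₁ (kp + resetDelay X am ap c w) with hW | hW
      · exact (hreset e he w hw km (by omega) _ hW).2 ((hR e he w hw.1 km kp).1 hle)
      · refine hshort e he _ (h.resetMinusExits_subset ⟨w, hw, kp, hkp, rfl⟩) ?_ km (by omega)
        have := h.exits_le w hw.1
        simp only [List.length_append, List.length_replicate]
        omega
    · rw [h.mem_synchroRel_iff he (h.endsSynchronizing_arc hw.1) hh]
      exact (hcounter e he w hw km (by omega) kp (by omega)).2 ((hC e he w hw.1 km kp).1 hle)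

end Parameters

/-! ### Gluing half-infinite points. -/

section Joins

variable {A : Type*}

/-- The sequence that agrees with a translate of `x` on the negative integers and with `u` on the
non-negative integers. -/
def join (x : ℤ → A) (k : ℤ) (u : ℤ → A) : ℤ → A := fun i => if i < 0 then x (i + k) else u i

/-- The sequence that agrees with `o` up to `l` and with a translate of `y` from `l` on. -/
def arc (o : ℤ → A) (l : ℤ) (y : ℤ → A) (q : ℤ) : ℤ → A :=
  fun i => if i < l then o i else y (i - l - q)

theorem join_of_neg (x u : ℤ → A) (k : ℤ) {i : ℤ} (h : i < 0) : join x k u i = x (i + k) := if_pos h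

theorem join_of_nonneg (x u : ℤ → A) (k : ℤ) {i : ℤ} (h : 0 ≤ i) : join x k u i = u i :=
  if_neg (not_lt.2 h)

theorem arc_of_lt (o y : ℤ → A) (q : ℤ) {i l : ℤ} (h : i < l) : arc o l y q i = o i := if_pos h

theorem arc_of_le (o y : ℤ → A) (q : ℤ) {i l : ℤ} (h : l ≤ i) : arc o l y q i = y (i - l - q) :=
  if_neg (not_lt.2 h)

theorem join_eq_of_tail {x u : ℤ → A} {a : A} {k i : ℤ} (hx : ∀ j ≥ 0, x j = a)
    (hu : ∀ j < 0, u j = a) (h : -k ≤ i) : join x k u i = u i := by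
  rcases lt_or_ge i 0 with h1 | h1
  · rw [join_of_neg _ _ _ h1, hx _ (by omega), hu i h1]
  · exact join_of_nonneg _ _ _ h1

theorem arc_eq_of_tail {o y : ℤ → A} {a : A} {l q i : ℤ} (ho : ∀ j ≥ l, o j = a)
    (hy : ∀ j < 0, y j = a) (h : i < l + q) : arc o l y q i = o i := by
  rcases lt_or_ge i l with h1 | h1
  · exact arc_of_lt _ _ _ h1
  · rw [arc_of_le _ _ _ h1, hy _ (by omega), ho i h1]

end Joins

/-! ### Admissible words as glued points. -/

section JoinWords

variable {A : Type*} [TopologicalSpace A] {X : Subshift A ℤ} {am ap : A} {c : List A} {o : ℤ → A}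
  {K : ℕ}

theorem mem_of_agree {x y z t : ℤ → A} (hx : x ∈ X.carrier) (hy : y ∈ X.carrier)
    (hz : z ∈ X.carrier) {p q : ℤ} (hpq : p ≤ q) (hp : t p ∈ synchro X) (hq : t q ∈ synchro X)
    (h1 : ∀ i ≤ p, t i = x i) (h2 : ∀ i, p ≤ i → i ≤ q → t i = z i) (h3 : ∀ i ≥ q, t i = y i) :
    t ∈ X.carrier := by
  rw [h1 p le_rfl, mem_synchro_iff hx] at hp
  have hu := hp x hx z hz (fun _ _ _ => rfl) fun i h4 h5 => by
    obtain rfl : i = p := by omega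
    rw [← h1 i le_rfl, ← h2 i le_rfl hpq]
  have hu' : ∀ i ≤ q, splice x z p i = t i := fun i hi => by
    rcases le_or_gt i p with h | h
    · rw [splice_of_le _ _ h, h1 i h]
    · rw [splice_of_lt _ _ h, h2 i h.le hi]
  rw [← hu' q le_rfl, mem_synchro_iff hu] at hq
  have := hq _ hu y hy (fun _ _ _ => rfl) fun i h4 h5 => by
    obtain rfl : i = q := by omega
    rw [hu' i le_rfl, h3 i le_rfl]
  convert this using 1
  funext i
  rcases le_or_gt i q with h | h
  · rw [splice_of_le _ _ h, hu' i h]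
  · rw [splice_of_lt _ _ h, h3 i h.le]

theorem splice_mem {x y : ℤ → A} (hx : x ∈ X.carrier) (hy : y ∈ X.carrier) {p : ℤ}
    (hp : x p ∈ synchro X) (h : x p = y p) : splice x y p ∈ X.carrier :=
  (mem_synchro_iff hx p).1 hp x hx y hy (fun _ _ _ => rfl) fun i h1 h2 => by
    obtain rfl : i = p := by omega
    exact h.symm

/-- The word has synchronizing symbols at both ends, so a point that carries it can be replaced by
`x` on the left and by `y` on the right. -/
theorem IsEntryPoint.mem_language_iff {e : List A} {x : ℤ → A} (hx : IsEntryPoint X am e x)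
    (ham : am ∉ synchro X) {u : ℤ → A} {v : List A} (huv : seg u 0 v.length = v)
    (hv : 0 < v.length) (hs : u (v.length - 1) ∈ synchro X)
    (hu : ∃ y ∈ X.carrier, ∀ i ≥ (v.length : ℤ) - 1, u i = y i) (k : ℕ) :
    e ++ List.replicate k am ++ v ∈ language X ↔ join x k u ∈ X.carrier := by
  have he := hx.length_pos ham
  have hword : seg (join x k u) (-k - e.length) v.length = e ++ List.replicate k am ++ v := by
    rw [← seg_append _ (show -(k : ℤ) - e.length ≤ 0 by omega) (by omega),
      ← seg_append _ (show -(k : ℤ) - e.length ≤ -k by omega) (by omega)]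
    refine congrArg₂ _ ?_ ?_
    · congr 1
      · conv_rhs => rw [← hx.seg_eq]
        rw [seg_congr (y := x) (d := k) fun l _ h2 => join_of_neg _ _ _ (by omega)]
        congr 1 <;> ring
      · rw [seg_eq_replicate (a := am) fun l h1 h2 => ?_]
        · congr 1; omega
        · rw [join_of_neg _ _ _ h2, hx.tail _ (by omega)]
    · conv_rhs => rw [← huv]
      exact seg_congr' fun l h1 _ => join_of_nonneg _ _ _ h1
  rw [← hword]
  refine ⟨fun h => ?_, fun h => seg_mem_language h _ _⟩
  obtain ⟨z, hz, hzt⟩ := (seg_mem_language_iff (by omega)).1 h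
  obtain ⟨y, hy, hyu⟩ := hu
  refine mem_of_agree (shift_mem X hx.mem k) hy hz (p := -k - e.length) (q := v.length - 1)
    (by omega) ?_ ?_ (fun i hi => ?_) (fun i h1 h2 => (hzt i h1 (by omega)).symm) fun i hi => ?_
  · rw [join_of_neg _ _ _ (by omega)]
    convert hx.sync using 2; ring
  · rw [join_of_nonneg _ _ _ (by omega)]
    exact hs
  · rw [join_of_neg _ _ _ (by omega), shift_apply', add_comm]
  · rw [join_of_nonneg _ _ _ (by omega), hyu i hi]

theorem IsEntryPoint.mem_language_iff_exit {e : List A} {x : ℤ → A} (hx : IsEntryPoint X am e x)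
    (ham : am ∉ synchro X) {y : ℤ → A} {v : List A} (hy : IsExitPoint X am v y) (k : ℕ) :
    e ++ List.replicate k am ++ v ∈ language X ↔ join x k y ∈ X.carrier :=
  hx.mem_language_iff ham hy.seg_eq (hy.length_pos ham) hy.sync ⟨y, hy.mem, fun _ _ => rfl⟩ k

theorem IsBase.seg_arc (h : IsBase X am ap c o K) {w : List A} {y : ℤ → A}
    (hy : IsExitPoint X ap w y) (kp : ℕ) : seg (arc o c.length y kp) 0
      (c ++ List.replicate kp ap ++ w).length = c ++ List.replicate kp ap ++ w := by
  simp only [List.length_append, List.length_replicate]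
  push_cast
  rw [← seg_append _ (show (0 : ℤ) ≤ c.length + kp by omega) (by omega),
    ← seg_append _ (show (0 : ℤ) ≤ c.length by omega) (by omega)]
  congr 1
  · congr 1
    · conv_rhs => rw [← h.o_seg]
      exact seg_congr' fun l _ h2 => arc_of_lt _ _ _ h2
    · rw [seg_eq_replicate (a := ap) fun l h1 h2 => ?_]
      · congr 1; omega
      · rw [arc_of_le _ _ _ h1, hy.tail _ (by omega)]
  · conv_rhs => rw [← hy.seg_eq]
    rw [seg_congr (y := y) (d := -(c.length + kp : ℤ)) fun l h1 _ => ?_]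
    · congr 1 <;> ring
    · rw [arc_of_le _ _ _ (by omega)]; congr 1; ring

theorem IsBase.arc_right (h : IsBase X am ap c o K) {w : List A} {y : ℤ → A}
    (hy : IsExitPoint X ap w y) (kp : ℕ) {i : ℤ}
    (hi : ((c ++ List.replicate kp ap ++ w).length : ℤ) - 1 ≤ i) :
    arc o c.length y kp i = shift (-(c.length + kp : ℤ)) y i := by
  have := hy.length_pos h.right_nosync
  simp only [List.length_append, List.length_replicate] at hi
  push_cast at hi
  rw [arc_of_le _ _ _ (by omega), shift_apply']
  congr 1; ring

theorem IsBase.arc_sync (h : IsBase X am ap c o K) {w : List A} {y : ℤ → A}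
    (hy : IsExitPoint X ap w y) (kp : ℕ) :
    arc o c.length y kp ((c ++ List.replicate kp ap ++ w).length - 1) ∈ synchro X := by
  rw [h.arc_right hy kp le_rfl, shift_apply']
  convert hy.sync using 2
  simp only [List.length_append, List.length_replicate]
  push_cast
  ring

theorem IsBase.mem_language_iff_arc (h : IsBase X am ap c o K) {e : List A} {x : ℤ → A}
    (hx : IsEntryPoint X am e x) {y : ℤ → A} {w : List A} (hy : IsExitPoint X ap w y) (km kp : ℕ) :
    e ++ List.replicate km am ++ (c ++ List.replicate kp ap ++ w) ∈ language X ↔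
      join x km (arc o c.length y kp) ∈ X.carrier := by
  have := hy.length_pos h.right_nosync
  refine hx.mem_language_iff h.left_nosync (h.seg_arc hy kp) (by simp; omega) (h.arc_sync hy kp)
    ⟨_, shift_mem X hy.mem _, fun i hi => h.arc_right hy kp hi⟩ km

theorem IsBase.isExitPoint_arc (h : IsBase X am ap c o K) {y : ℤ → A} {w : List A}
    (hy : IsExitPoint X ap w y) {kp : ℕ} (hkp : 1 ≤ kp) (hm : arc o c.length y kp ∈ X.carrier) :
    IsExitPoint X am (c ++ List.replicate kp ap ++ w) (arc o c.length y kp) := by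
  have hpos := hy.length_pos h.right_nosync
  refine ⟨hm, fun i hi => ?_, ?_, h.seg_arc hy kp, h.arc_sync hy kp, fun i hi => ?_⟩
  · rw [arc_of_lt _ _ _ (by omega), h.o_left i hi]
  · have h1 := h.head?_arc hkp w
    rw [← h.seg_arc hy kp, head?_seg _ (by simp; omega)] at h1
    exact fun h2 => h1 (by rw [h2])
  · simp only [List.length_append, List.length_replicate] at hi
    push_cast at hi
    rcases lt_or_ge i c.length with h1 | h1
    · rw [arc_of_lt _ _ _ h1]; exact h.o_nosync i
    · rw [arc_of_le _ _ _ h1]; exact hy.nosync _ (by omega)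

/-- A point that realizes the exit word agrees with the arc up to the synchronizing symbol at the
end of the word, where it can be spliced with the translate of `y`. -/
theorem IsBase.arc_mem_iff [Finite A] [DiscreteTopology A] (h : IsBase X am ap c o K) {y : ℤ → A}
    {w : List A} (hy : IsExitPoint X ap w y) {kp : ℕ} (hkp : 1 ≤ kp) :
    arc o c.length y kp ∈ X.carrier ↔ c ++ List.replicate kp ap ++ w ∈ exits X am := by
  rw [mem_exits_iff h.left_nosync]
  refine ⟨fun hm => ⟨_, h.isExitPoint_arc hy hkp hm⟩, ?_⟩
  rintro ⟨u, hu⟩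
  have hpos := hu.length_pos h.left_nosync
  have hseg := hu.seg_eq.trans (h.seg_arc hy kp).symm
  have hlt : ∀ i < ((c ++ List.replicate kp ap ++ w).length : ℤ),
      u i = arc o c.length y kp i := fun i hi => by
    rcases lt_or_ge i 0 with h1 | h1
    · rw [hu.tail i h1, arc_of_lt _ _ _ (by omega), h.o_left i h1]
    · exact eq_of_seg_eq' hseg h1 hi
  have := splice_mem hu.mem (shift_mem X hy.mem (-(c.length + kp : ℤ)))
    (p := (c ++ List.replicate kp ap ++ w).length - 1) hu.sync
    (by rw [hlt _ (by omega), h.arc_right hy kp le_rfl])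
  convert this using 1
  funext i
  rcases le_or_gt i ((c ++ List.replicate kp ap ++ w).length - 1) with h1 | h1
  · rw [splice_of_le _ _ h1, hlt i (by omega)]
  · rw [splice_of_lt _ _ h1, h.arc_right hy kp h1.le]

/-- This removes `km` and the words from the definition of reset, and makes it transportable. -/
theorem IsBase.mem_resetExits_iff [Finite A] [DiscreteTopology A] (h : IsBase X am ap c o K)
    {y : ℤ → A} {w : List A} (hy : IsExitPoint X ap w y) : w ∈ resetExits X am ap c ↔
      ∃ D : ℕ, ∀ kp ≥ D, arc o c.length y (kp : ℕ) ∈ X.carrier := by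
  have hw := (mem_exits_iff h.right_nosync).2 ⟨y, hy⟩
  constructor
  · rintro ⟨-, D, hD⟩
    refine ⟨D + 1, fun kp hkp => (h.arc_mem_iff hy (by omega)).2 ?_⟩
    refine h.arc_mem_exits hw (by omega) fun km hkm => ?_
    have := hD km (kp - D) hkm (by omega)
    rw [show kp - D + D = kp by omega] at this
    simpa using this
  · rintro ⟨D, hD⟩
    refine ⟨hw, D, fun km kp hkm hkp => ?_⟩
    obtain ⟨σ, d, -, ⟨-, -, -, hk⟩, e⟩ := (h.arc_mem_iff hy (by omega)).1 (hD (kp + D) (by omega))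
    have := hk km hkm
    rw [List.append_assoc, ← e] at this
    simpa using this

/-- The origin is the first coordinate different from `a`, which rules out translations, and the
first synchronizing symbol fixes the end of the word. -/
theorem IsExitPoint.unique {a : A} {y : ℤ → A} {w w' : List A} {d : ℤ} (hy : IsExitPoint X a w y)
    (hy' : IsExitPoint X a w' (shift d y)) : w = w' := by
  have h1 : d = 0 := by
    rcases lt_trichotomy d 0 with h | h | h
    · have := hy'.ne
      rw [shift_apply', add_zero, hy.tail d h] at this
      exact absurd rfl this
    · exact h
    · have := hy'.tail (-d) (by omega)
      rw [shift_apply', add_neg_cancel] at this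
      exact absurd this hy.ne
  subst h1
  have e : shift (0 : ℤ) y = y := by funext i; rw [shift_apply', zero_add]
  rw [e] at hy'
  have h2 : w.length = w'.length := by
    rcases lt_trichotomy w.length w'.length with h | h | h
    · exact absurd hy.sync (hy'.nosync _ (by omega))
    · exact h
    · exact absurd hy'.sync (hy.nosync _ (by omega))
  rw [← hy.seg_eq, ← hy'.seg_eq, h2]

end JoinWords

/-! ### Images of glued points under a conjugacy. -/

section Transport

variable {A B : Type*} [TopologicalSpace A] [TopologicalSpace B] {X : Subshift A ℤ}
  {Y : Subshift B ℤ} {f : (ℤ → A) → ℤ → B} {g : (ℤ → B) → ℤ → A} {r R : ℕ}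
  {am ap : A} {c : List A} {o : ℤ → A} {K : ℕ} {am' ap' : B} {c' : List B} {o' : ℤ → B} {K' : ℕ}
  {δ : ℤ}

/-- A conjugacy that matches the characteristic pairs and the connecting points. -/
structure IsBaseConj (X : Subshift A ℤ) (Y : Subshift B ℤ) (f : (ℤ → A) → ℤ → B)
    (g : (ℤ → B) → ℤ → A) (r R : ℕ) (am ap : A) (c : List A) (o : ℤ → A) (K : ℕ)
    (am' ap' : B) (c' : List B) (o' : ℤ → B) (K' : ℕ) (δ : ℤ) : Prop where
  conj : IsSyncConj X Y f g r R
  source : IsBase X am ap c o K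
  target : IsBase Y am' ap' c' o' K'
  map_left : f (fun _ => am) 0 = am'
  map_right : f (fun _ => ap) 0 = ap'
  map_conn : o' = shift δ (f o)

theorem IsConj.eq_shift_inv (h : IsConj X Y f g r) {x : ℤ → A} (hx : x ∈ X.carrier) {y : ℤ → B}
    {s : ℤ} (hy : y = shift s (f x)) : x = shift (-s) (g y) := by
  rw [hy, h.symm.map_shift (h.map_mem x hx), h.left_inv x hx]
  funext i
  simp

theorem IsBaseConj.symm (h : IsBaseConj X Y f g r R am ap c o K am' ap' c' o' K' δ) :
    IsBaseConj Y X g f r R am' ap' c' o' K' am ap c o K (-δ) where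
  conj := h.conj.symm
  source := h.target
  target := h.source
  map_left := by
    rw [← h.map_left]
    exact h.conj.inv_const h.source.points.left_mem
  map_right := by
    rw [← h.map_right]
    exact h.conj.inv_const h.source.points.right_mem
  map_conn := h.conj.eq_shift_inv h.source.o_mem h.map_conn

/-- An entry point of `X` together with the corresponding normalized entry point of `Y`. -/
structure IsEntryPair (X : Subshift A ℤ) (Y : Subshift B ℤ) (f : (ℤ → A) → ℤ → B) (r : ℕ)
    (am : A) (am' : B) (e : List A) (x : ℤ → A) (e' : List B) (x' : ℤ → B) (s : ℤ) : Prop where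
  source : IsEntryPoint X am e x
  target : IsEntryPoint Y am' e' x'
  map_eq : x' = shift s (f x)
  le : -(r : ℤ) ≤ s ∧ s ≤ r

/-- An exit point of `X` together with the corresponding normalized exit point of `Y`. -/
structure IsExitPair (X : Subshift A ℤ) (Y : Subshift B ℤ) (f : (ℤ → A) → ℤ → B) (r : ℕ)
    (a : A) (a' : B) (w : List A) (y : ℤ → A) (w' : List B) (y' : ℤ → B) (b : ℤ) : Prop where
  source : IsExitPoint X a w y
  target : IsExitPoint Y a' w' y'
  map_eq : y' = shift b (f y)
  le : -(r : ℤ) ≤ b ∧ b ≤ r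

theorem IsEntryPair.symm (h : IsConj X Y f g r) {a : A} {a' : B} {e : List A} {x : ℤ → A}
    {e' : List B} {x' : ℤ → B} {s : ℤ} (hp : IsEntryPair X Y f r a a' e x e' x' s) :
    IsEntryPair Y X g r a' a e' x' e x (-s) :=
  ⟨hp.target, hp.source, h.eq_shift_inv hp.source.mem hp.map_eq, by have := hp.le; omega⟩

theorem IsExitPair.symm (h : IsConj X Y f g r) {a : A} {a' : B} {e : List A} {x : ℤ → A}
    {e' : List B} {x' : ℤ → B} {s : ℤ} (hp : IsExitPair X Y f r a a' e x e' x' s) :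
    IsExitPair Y X g r a' a e' x' e x (-s) :=
  ⟨hp.target, hp.source, h.eq_shift_inv hp.source.mem hp.map_eq, by have := hp.le; omega⟩

/-- The start of the constant tail moves by at most `r`: more to the right is excluded by the map,
more to the left by its inverse. -/
theorem IsSyncConj.exists_isEntryPair (h : IsSyncConj X Y f g r R) {a : A} {a' : B}
    (ha : (fun _ => a) ∈ X.carrier) (ha' : f (fun _ => a) 0 = a') (hs' : a' ∉ synchro Y)
    {e : List A} {x : ℤ → A} (hx : IsEntryPoint X a e x) :
    ∃ e' x' s, IsEntryPair X Y f r a a' e x e' x' s := by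
  subst ha'
  obtain ⟨q, -, -, hq⟩ := h.map_sync x hx.mem _ hx.sync
  obtain ⟨s, e', he'⟩ := exists_isEntryPoint hs' (h.map_mem x hx.mem)
    (h.rightAsymptotic ha hx.mem ⟨0, hx.tail⟩) hq
  refine ⟨e', _, s, hx, he', rfl, ?_, ?_⟩
  · by_contra hlt
    refine hx.ne ?_
    rw [← h.left_inv x hx.mem]
    rw [h.symm.map_apply_of_const (h.const_mem ha) (h.map_mem x hx.mem) (i := -1) fun l h1 _ => ?_,
      h.inv_const ha]
    have := he'.tail (l - s) (by omega)
    rwa [shift_apply', show s + (l - s) = l by ring] at this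
  · by_contra hlt
    refine he'.ne ?_
    rw [shift_apply']
    exact h.map_apply_of_const ha hx.mem fun l h1 _ => hx.tail l (by omega)

theorem IsSyncConj.exists_isExitPair (h : IsSyncConj X Y f g r R) {a : A} {a' : B}
    (ha : (fun _ => a) ∈ X.carrier) (ha' : f (fun _ => a) 0 = a') (hs' : a' ∉ synchro Y)
    {w : List A} {y : ℤ → A} (hy : IsExitPoint X a w y) :
    ∃ w' y' b, IsExitPair X Y f r a a' w y w' y' b := by
  subst ha'
  obtain ⟨q, -, -, hq⟩ := h.map_sync y hy.mem _ hy.sync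
  obtain ⟨s, w', hw'⟩ := exists_isExitPoint hs' (h.map_mem y hy.mem)
    (h.leftAsymptotic ha hy.mem ⟨-1, fun i hi => hy.tail i (by omega)⟩) hq
  refine ⟨w', _, s, hy, hw', rfl, ?_, ?_⟩
  · by_contra hlt
    refine hw'.ne ?_
    rw [shift_apply']
    exact h.map_apply_of_const ha hy.mem fun l _ h1 => hy.tail l (by omega)
  · by_contra hlt
    refine hy.ne ?_
    rw [← h.left_inv y hy.mem]
    rw [h.symm.map_apply_of_const (h.const_mem ha) (h.map_mem y hy.mem) (i := 0) fun l _ h1 => ?_,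
      h.inv_const ha]
    have := hw'.tail (l - s) (by omega)
    rwa [shift_apply', show s + (l - s) = l by ring] at this

theorem IsExitPair.length_le (h : IsSyncConj X Y f g r R) {a : A} {a' : B} {w : List A}
    {y : ℤ → A} {w' : List B} {y' : ℤ → B} {b : ℤ}
    (hp : IsExitPair X Y f r a a' w y w' y' b) : w'.length ≤ w.length + R + r := by
  obtain ⟨q, -, h2, hq⟩ := h.map_sync y hp.source.mem _ hp.source.sync
  by_contra hlt
  have hle := hp.le
  refine hp.target.nosync (q - b) (by omega) ?_
  rw [hp.map_eq, shift_apply']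
  convert hq using 2; ring

/-- The runs are so long that every window of radius `r` sees only `x`, only `o` or only `y`. On the
three ranges the image is therefore that of `x`, of `o` or of `y`. Comparing the translations `s`,
`δ`, `b` and the lengths of `c` and `c'` gives the new exponents. -/
theorem IsBaseConj.map_join_arc (h : IsBaseConj X Y f g r R am ap c o K am' ap' c' o' K' δ)
    {x y : ℤ → A} {x' y' : ℤ → B} {s b : ℤ} (hx : x ∈ X.carrier) (hy : y ∈ X.carrier)
    (hxt : ∀ i ≥ 0, x i = am) (hyt : ∀ i < 0, y i = ap) (hx' : x' = shift s (f x))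
    (hy' : y' = shift b (f y)) (hxt' : ∀ i ≥ 0, x' i = am') (hyt' : ∀ i < 0, y' i = ap')
    (hs : -(r : ℤ) ≤ s ∧ s ≤ r) (hb : -(r : ℤ) ≤ b ∧ b ≤ r) {k q : ℤ}
    (hk : 4 * r + 4 * δ.natAbs + 2 * c.length + 2 * c'.length + 1 ≤ k)
    (hq : 4 * r + 4 * δ.natAbs + 2 * c.length + 2 * c'.length + 1 ≤ q)
    (ht : join x k (arc o c.length y q) ∈ X.carrier) :
    join x' (k + δ - s) (arc o' c'.length y' (q + c.length - c'.length + b - δ)) =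
      shift δ (f (join x k (arc o c.length y q))) := by
  have ho := h.source.o_mem
  funext j
  rw [shift_apply']
  rcases lt_or_ge j (-(r + δ.natAbs : ℤ)) with h1 | h1
  · rw [join_of_neg _ _ _ (by omega), hx', shift_apply', h.conj.map_eq ht hx k fun l _ h3 =>
      join_of_neg _ _ _ (by omega)]
    congr 1; ring
  -- On the middle range both glued points coincide with the connecting points, as the tails of `x`
  -- and `y` continue the runs of `o`.
  rcases lt_or_ge j (c.length + c'.length + r + δ.natAbs) with h2 | h2
  · rw [h.conj.map_eq' (i := δ + j) ht ho fun l h3 h4 => ?_]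
    · have e1 := arc_eq_of_tail (i := j) (l := c'.length) (q := q + c.length - c'.length + b - δ)
        h.target.o_right hyt' (by omega)
      rcases lt_or_ge j 0 with h5 | h5
      · rw [join_of_neg _ _ _ h5, hxt' _ (by omega), ← h.target.o_left j h5, h.map_conn,
          shift_apply']
      · rw [join_of_nonneg _ _ _ h5, e1, h.map_conn, shift_apply']
    · rcases lt_or_ge l 0 with h5 | h5
      · rw [join_of_neg _ _ _ h5, hxt _ (by omega), h.source.o_left l h5]
      · rw [join_of_nonneg _ _ _ h5,
          arc_eq_of_tail (i := l) h.source.o_right hyt (by omega)]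
  · rw [join_of_nonneg _ _ _ (by omega), arc_of_le _ _ _ (by omega), hy', shift_apply',
      h.conj.map_eq ht hy (-(c.length + q)) fun l h3 _ => ?_]
    · congr 1; ring
    · rw [join_of_nonneg _ _ _ (by omega), arc_of_le _ _ _ (by omega)]
      congr 1; ring

theorem IsBaseConj.map_join (h : IsBaseConj X Y f g r R am ap c o K am' ap' c' o' K' δ)
    {x y : ℤ → A} {x' y' : ℤ → B} {s b : ℤ} (hx : x ∈ X.carrier) (hy : y ∈ X.carrier)
    (hxt : ∀ i ≥ 0, x i = am) (hyt : ∀ i < 0, y i = am) (hx' : x' = shift s (f x))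
    (hy' : y' = shift b (f y)) (hxt' : ∀ i ≥ 0, x' i = am') (hyt' : ∀ i < 0, y' i = am')
    (hs : -(r : ℤ) ≤ s ∧ s ≤ r) (hb : -(r : ℤ) ≤ b ∧ b ≤ r) {k : ℤ}
    (hk : 4 * r + 1 ≤ k) (ht : join x k y ∈ X.carrier) :
    join x' (k + b - s) y' = shift b (f (join x k y)) := by
  funext j
  rw [shift_apply']
  rcases lt_or_ge j (-(2 * r : ℤ)) with h1 | h1
  · rw [join_of_neg _ _ _ (by omega), hx', shift_apply', h.conj.map_eq ht hx k fun l _ h3 =>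
      join_of_neg _ _ _ (by omega)]
    congr 1; ring
  · rw [join_eq_of_tail hxt' hyt' (by omega), hy', shift_apply',
      h.conj.map_eq' ht hy fun l h3 _ => join_eq_of_tail hxt hyt (by omega)]

/-- An arc is a join whose left part is the fixed point `am`, of any exponent. -/
theorem IsBaseConj.map_arc (h : IsBaseConj X Y f g r R am ap c o K am' ap' c' o' K' δ)
    {y : ℤ → A} {y' : ℤ → B} {b : ℤ} (hy : y ∈ X.carrier) (hyt : ∀ i < 0, y i = ap)
    (hy' : y' = shift b (f y)) (hyt' : ∀ i < 0, y' i = ap')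
    (hb : -(r : ℤ) ≤ b ∧ b ≤ r) {q : ℤ}
    (hq : 4 * r + 4 * δ.natAbs + 2 * c.length + 2 * c'.length + 1 ≤ q)
    (ht : arc o c.length y q ∈ X.carrier) :
    arc o' c'.length y' (q + c.length - c'.length + b - δ) =
      shift δ (f (arc o c.length y q)) := by
  have e1 : ∀ k, join (fun _ => am) k (arc o c.length y q) = arc o c.length y q := fun k => by
    funext i
    rcases lt_or_ge i 0 with h1 | h1
    · rw [join_of_neg _ _ _ h1, arc_of_lt _ _ _ (by omega), h.source.o_left i h1]
    · rw [join_of_nonneg _ _ _ h1]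
  have e2 : ∀ k q', join (fun _ => am') k (arc o' c'.length y' q') = arc o' c'.length y' q' :=
    fun k q' => by
      funext i
      rcases lt_or_ge i 0 with h1 | h1
      · rw [join_of_neg _ _ _ h1, arc_of_lt _ _ _ (by omega), h.target.o_left i h1]
      · rw [join_of_nonneg _ _ _ h1]
  have := h.map_join_arc (x := fun _ => am) (x' := fun _ => am') (s := 0)
    (k := 4 * r + 4 * δ.natAbs + 2 * c.length + 2 * c'.length + 1) (q := q)
    h.source.points.left_mem hy
    (fun _ _ => rfl) hyt (by
      funext i
      rw [shift_apply', zero_add, h.conj.map_const h.source.points.left_mem, h.map_left]) hy'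
    (fun _ _ => rfl) hyt' (by omega) hb le_rfl hq (by rw [e1]; exact ht)
  rwa [e2, e1] at this

end Transport

/-! ### Transport of the counter structure. -/

section TransportStructure

variable {A B : Type*} [TopologicalSpace A] [TopologicalSpace B] {X : Subshift A ℤ}
  {Y : Subshift B ℤ} {f : (ℤ → A) → ℤ → B} {g : (ℤ → B) → ℤ → A} {r R : ℕ}
  {am ap : A} {c : List A} {o : ℤ → A} {K : ℕ} {am' ap' : B} {c' : List B} {o' : ℤ → B} {K' : ℕ}
  {δ : ℤ}

theorem IsBaseConj.arc_language (h : IsBaseConj X Y f g r R am ap c o K am' ap' c' o' K' δ)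
    {e : List A} {x : ℤ → A} {e' : List B} {x' : ℤ → B} {s : ℤ}
    (hE : IsEntryPair X Y f r am am' e x e' x' s) {w : List A} {y : ℤ → A} {w' : List B}
    {y' : ℤ → B} {b : ℤ} (hW : IsExitPair X Y f r ap ap' w y w' y' b) {km kp km' kp' : ℕ}
    (hkm : 4 * r + 4 * δ.natAbs + 2 * c.length + 2 * c'.length + 1 ≤ km)
    (hkp : 4 * r + 4 * δ.natAbs + 2 * c.length + 2 * c'.length + 1 ≤ kp)
    (hkm' : (km' : ℤ) = km + δ - s) (hkp' : (kp' : ℤ) = kp + c.length - c'.length + b - δ)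
    (hL : e ++ List.replicate km am ++ (c ++ List.replicate kp ap ++ w) ∈ language X) :
    e' ++ List.replicate km' am' ++ (c' ++ List.replicate kp' ap' ++ w') ∈ language Y := by
  rw [h.source.mem_language_iff_arc hE.source hW.source] at hL
  rw [h.target.mem_language_iff_arc hE.target hW.target, hkm', hkp',
    h.map_join_arc hE.source.mem hW.source.mem hE.source.tail hW.source.tail hE.map_eq hW.map_eq
      hE.target.tail hW.target.tail hE.le hW.le (by exact_mod_cast hkm) (by exact_mod_cast hkp) hL]
  exact shift_mem Y (h.conj.map_mem _ hL) _

/-- The factor `2` keeps the changed exponents above the threshold that the inverse conjugacy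
requires. -/
theorem IsBaseConj.arc_language_iff (h : IsBaseConj X Y f g r R am ap c o K am' ap' c' o' K' δ)
    {e : List A} {x : ℤ → A} {e' : List B} {x' : ℤ → B} {s : ℤ}
    (hE : IsEntryPair X Y f r am am' e x e' x' s) {w : List A} {y : ℤ → A} {w' : List B}
    {y' : ℤ → B} {b : ℤ} (hW : IsExitPair X Y f r ap ap' w y w' y' b) {km kp km' kp' : ℕ}
    (hkm : 2 * (4 * r + 4 * δ.natAbs + 2 * c.length + 2 * c'.length + 1) ≤ km)
    (hkp : 2 * (4 * r + 4 * δ.natAbs + 2 * c.length + 2 * c'.length + 1) ≤ kp)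
    (hkm' : (km' : ℤ) = km + δ - s) (hkp' : (kp' : ℤ) = kp + c.length - c'.length + b - δ) :
    e ++ List.replicate km am ++ (c ++ List.replicate kp ap ++ w) ∈ language X ↔
    e' ++ List.replicate km' am' ++ (c' ++ List.replicate kp' ap' ++ w') ∈ language Y := by
  have h1 := hE.le
  have h2 := hW.le
  refine ⟨h.arc_language hE hW (by omega) (by omega) hkm' hkp',
    h.symm.arc_language (hE.symm h.conj.toIsConj) (hW.symm h.conj.toIsConj) ?_ ?_ ?_ ?_⟩ <;>
  · try rw [Int.natAbs_neg]
    omega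

theorem IsBaseConj.short_language (h : IsBaseConj X Y f g r R am ap c o K am' ap' c' o' K' δ)
    {e : List A} {x : ℤ → A} {e' : List B} {x' : ℤ → B} {s : ℤ}
    (hE : IsEntryPair X Y f r am am' e x e' x' s) {v : List A} {y : ℤ → A} {v' : List B}
    {y' : ℤ → B} {b : ℤ} (hV : IsExitPair X Y f r am am' v y v' y' b) {k k' : ℕ}
    (hk : 4 * r + 1 ≤ k) (hk' : (k' : ℤ) = k + b - s)
    (hL : e ++ List.replicate k am ++ v ∈ language X) :
    e' ++ List.replicate k' am' ++ v' ∈ language Y := by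
  rw [hE.source.mem_language_iff_exit h.source.left_nosync hV.source] at hL
  rw [hE.target.mem_language_iff_exit h.target.left_nosync hV.target, hk',
    h.map_join hE.source.mem hV.source.mem hE.source.tail hV.source.tail hE.map_eq hV.map_eq
      hE.target.tail hV.target.tail hE.le hV.le (by exact_mod_cast hk) hL]
  exact shift_mem Y (h.conj.map_mem _ hL) _

theorem IsBaseConj.exists_entryPair [Finite A] [DiscreteTopology A]
    (h : IsBaseConj X Y f g r R am ap c o K am' ap' c' o' K' δ)
    {e : List A} (he : e ∈ entries X am) : ∃ x e' x' s, IsEntryPair X Y f r am am' e x e' x' s := by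
  obtain ⟨x, hx⟩ := (mem_entries_iff h.source.left_nosync).1 he
  exact ⟨x, h.conj.exists_isEntryPair h.source.points.left_mem h.map_left h.target.left_nosync hx⟩

theorem IsBaseConj.exists_leftExitPair [Finite A] [DiscreteTopology A]
    (h : IsBaseConj X Y f g r R am ap c o K am' ap' c' o' K' δ)
    {w : List A} (hw : w ∈ exits X am) :
    ∃ y w' y' b, IsExitPair X Y f r am am' w y w' y' b := by
  obtain ⟨x, hx⟩ := (mem_exits_iff h.source.left_nosync).1 hw
  exact ⟨x, h.conj.exists_isExitPair h.source.points.left_mem h.map_left h.target.left_nosync hx⟩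

theorem IsBaseConj.exists_rightExitPair [Finite A] [DiscreteTopology A]
    (h : IsBaseConj X Y f g r R am ap c o K am' ap' c' o' K' δ)
    {w : List A} (hw : w ∈ exits X ap) :
    ∃ y w' y' b, IsExitPair X Y f r ap ap' w y w' y' b := by
  obtain ⟨x, hx⟩ := (mem_exits_iff h.source.right_nosync).1 hw
  exact ⟨x, h.conj.exists_isExitPair h.source.points.right_mem h.map_right h.target.right_nosync hx⟩

theorem IsEntryPair.mem_entries [Finite B] [DiscreteTopology B]
    (h : IsBaseConj X Y f g r R am ap c o K am' ap' c' o' K' δ)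
    {e : List A} {x : ℤ → A} {e' : List B} {x' : ℤ → B} {s : ℤ}
    (hE : IsEntryPair X Y f r am am' e x e' x' s) : e' ∈ entries Y am' :=
  (mem_entries_iff h.target.left_nosync).2 ⟨_, hE.target⟩

variable [Finite A] [DiscreteTopology A] [Finite B] [DiscreteTopology B]

theorem IsBaseConj.mem_resetExits (h : IsBaseConj X Y f g r R am ap c o K am' ap' c' o' K' δ)
    {w : List A} {y : ℤ → A} {w' : List B} {y' : ℤ → B} {b : ℤ}
    (hW : IsExitPair X Y f r ap ap' w y w' y' b) (hw : w ∈ resetExits X am ap c) :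
    w' ∈ resetExits Y am' ap' c' := by
  rw [h.source.mem_resetExits_iff hW.source] at hw
  rw [h.target.mem_resetExits_iff hW.target]
  obtain ⟨D, hD⟩ := hw
  have hb := hW.le
  refine ⟨D + 2 * (4 * r + 4 * δ.natAbs + 2 * c.length + 2 * c'.length + 1), fun kp' hkp' => ?_⟩
  obtain ⟨kp, hkp⟩ := Int.eq_ofNat_of_zero_le
    (show 0 ≤ (kp' : ℤ) - c.length + c'.length - b + δ by omega)
  have h1 := hD kp (by omega)
  have h2 := h.map_arc hW.source.mem hW.source.tail hW.map_eq hW.target.tail hb (q := kp)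
    (by omega) h1
  rw [show (kp : ℤ) + c.length - c'.length + b - δ = kp' by omega] at h2
  rw [h2]
  exact shift_mem Y (h.conj.map_mem _ h1) _

theorem IsBaseConj.mem_resetExits_iff (h : IsBaseConj X Y f g r R am ap c o K am' ap' c' o' K' δ)
    {w : List A} {y : ℤ → A} {w' : List B} {y' : ℤ → B} {b : ℤ}
    (hW : IsExitPair X Y f r ap ap' w y w' y' b) :
    w ∈ resetExits X am ap c ↔ w' ∈ resetExits Y am' ap' c' :=
  ⟨h.mem_resetExits hW, h.symm.mem_resetExits (hW.symm h.conj.toIsConj)⟩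

theorem IsBaseConj.short_exit (h : IsBaseConj X Y f g r R am ap c o K am' ap' c' o' K' δ)
    (hS : HasCounterStructure Y am' ap' c') (N : ℕ) : ∃ M : ℕ, ∀ e ∈ entries X am,
      ∀ v ∈ exits X am, v.length ≤ N → ∀ k ≥ M, e ++ List.replicate k am ++ v ∈ language X := by
  obtain ⟨M, hM⟩ := hS.short_exit (N + R + r)
  refine ⟨M + 8 * r + 1, fun e he v hv hvl k hk => ?_⟩
  obtain ⟨x, e', x', s, hE⟩ := h.exists_entryPair he
  obtain ⟨y, v', y', b, hV⟩ := h.exists_leftExitPair hv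
  have h1 := hE.le
  have h2 := hV.le
  have h3 := hV.length_le h.conj
  obtain ⟨k', hk'⟩ := Int.eq_ofNat_of_zero_le (show 0 ≤ (k : ℤ) + b - s by omega)
  exact h.symm.short_language (hE.symm h.conj.toIsConj) (hV.symm h.conj.toIsConj) (k := k')
    (by omega) (by omega) (hM e' (hE.mem_entries h) v'
      ((mem_exits_iff h.target.left_nosync).2 ⟨_, hV.target⟩) (by omega) k' (by omega))

/-- One pair is chosen for each entry and for each exit, so the change of `km` depends on `e` only
and that of `kp` on `w` only, and each is added to the corresponding offset. -/
theorem IsBaseConj.reset_iff (h : IsBaseConj X Y f g r R am ap c o K am' ap' c' o' K' δ)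
    (hS : HasCounterStructure Y am' ap' c') : ∃ (W : ℕ) (De Dw : List A → ℤ),
      ∀ e ∈ entries X am, ∀ w ∈ resetExits X am ap c, ∀ km ≥ W, ∀ kp ≥ W,
      (e ++ List.replicate km am ++ (c ++ List.replicate kp ap ++ w) ∈ language X ↔
        kp + Dw w ≤ km + De e) := by
  obtain ⟨W, De', Dw', hD⟩ := hS.reset_iff
  have hA : Nonempty A := ⟨am⟩
  have hB : Nonempty B := ⟨am'⟩
  choose! x e' x' s hE using fun e (he : e ∈ entries X am) => h.exists_entryPair he
  choose! y w' y' b hW using fun w (hw : w ∈ exits X ap) => h.exists_rightExitPair hw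
  refine ⟨W + 2 * (4 * r + 4 * δ.natAbs + 2 * c.length + 2 * c'.length + 1),
    fun e => De' (e' e) + δ - s e, fun w => Dw' (w' w) + c.length - c'.length + b w - δ,
    fun e he w hw km hkm kp hkp => ?_⟩
  have h1 := (hE e he).le
  have h2 := (hW w hw.1).le
  obtain ⟨km', hkm'⟩ := Int.eq_ofNat_of_zero_le (show 0 ≤ (km : ℤ) + δ - s e by omega)
  obtain ⟨kp', hkp'⟩ := Int.eq_ofNat_of_zero_le
    (show 0 ≤ (kp : ℤ) + c.length - c'.length + b w - δ by omega)
  rw [h.arc_language_iff (hE e he) (hW w hw.1) (by omega) (by omega) hkm'.symm hkp'.symm,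
    hD _ ((hE e he).mem_entries h) _ ((h.mem_resetExits_iff (hW w hw.1)).1 hw) km' (by omega) kp'
      (by omega)]
  beta_reduce
  omega

theorem IsBaseConj.counter_iff (h : IsBaseConj X Y f g r R am ap c o K am' ap' c' o' K' δ)
    (hS : HasCounterStructure Y am' ap' c') : ∃ (W : ℕ) (Δe Δw : List A → Finset ℤ),
      (∀ e ∈ entries X am, (Δe e).Nonempty) ∧ (∀ w ∈ counterExits X am ap c, (Δw w).Nonempty) ∧
      ∀ e ∈ entries X am, ∀ w ∈ counterExits X am ap c, ∀ km ≥ W, ∀ kp ≥ W,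
      (e ++ List.replicate km am ++ (c ++ List.replicate kp ap ++ w) ∈ language X ↔
        ∃ δ ∈ Δe e, ∃ δ' ∈ Δw w, δ + km = kp + δ') := by
  obtain ⟨W, Δe, Δw, hΔe, hΔw, hD⟩ := hS.counter_iff
  have hA : Nonempty A := ⟨am⟩
  have hB : Nonempty B := ⟨am'⟩
  choose! x e' x' s hE using fun e (he : e ∈ entries X am) => h.exists_entryPair he
  choose! y w' y' b hW using fun w (hw : w ∈ exits X ap) => h.exists_rightExitPair hw
  have hcount : ∀ w ∈ counterExits X am ap c, w' w ∈ counterExits Y am' ap' c' := fun w hw =>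
    ⟨(mem_exits_iff h.target.right_nosync).2 ⟨_, (hW w hw.1).target⟩,
      fun h' => hw.2 ((h.mem_resetExits_iff (hW w hw.1)).2 h')⟩
  refine ⟨W + 2 * (4 * r + 4 * δ.natAbs + 2 * c.length + 2 * c'.length + 1),
    fun e => (Δe (e' e)).image fun d : ℤ => d + δ - s e,
    fun w => (Δw (w' w)).image fun d : ℤ => d + c.length - c'.length + b w - δ,
    fun e he => (hΔe _ ((hE e he).mem_entries h)).image _, fun w hw => (hΔw _ (hcount w hw)).image _,
    fun e he w hw km hkm kp hkp => ?_⟩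
  have h1 := (hE e he).le
  have h2 := (hW w hw.1).le
  obtain ⟨km', hkm'⟩ := Int.eq_ofNat_of_zero_le (show 0 ≤ (km : ℤ) + δ - s e by omega)
  obtain ⟨kp', hkp'⟩ := Int.eq_ofNat_of_zero_le
    (show 0 ≤ (kp : ℤ) + c.length - c'.length + b w - δ by omega)
  rw [h.arc_language_iff (hE e he) (hW w hw.1) (by omega) (by omega) hkm'.symm hkp'.symm,
    hD _ ((hE e he).mem_entries h) _ (hcount w hw) km' (by omega) kp' (by omega)]
  simp only [Finset.exists_mem_image]
  refine exists_congr fun d => and_congr_right fun _ => exists_congr fun d' =>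
    and_congr_right fun _ => ?_
  omega

/-- The image of a long exit is long, hence of the form `c' ap'^m w'` with a reset word `w'`, and
its point is an arc over an exit point `z`. The inverse conjugacy turns this arc into an arc over
the exit point that corresponds to `z`. By uniqueness of exit words, `v` is read off from this arc.
-/
theorem IsBaseConj.reset (h : IsBaseConj X Y f g r R am ap c o K am' ap' c' o' K' δ)
    (hS : HasCounterStructure Y am' ap' c') : ∃ N : ℕ, ∀ v ∈ exits X am, N < v.length →
      v ∈ resetMinusExits X am ap c := by
  obtain ⟨N, hN⟩ := hS.reset
  obtain ⟨bD, hbD⟩ := exists_nat_bound h.source.finite_exits (resetDelay X am ap c)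
  refine ⟨N + R + r + K' + bD + 2 * (4 * r + 4 * δ.natAbs + 2 * c.length + 2 * c'.length + 1),
    fun v hv hlt => ?_⟩
  obtain ⟨y, v', y', b, hV⟩ := h.exists_leftExitPair hv
  have hVs := hV.symm h.conj.toIsConj
  have hl := hVs.length_le h.conj.symm
  have hb := hV.le
  have hv' := (mem_exits_iff h.target.left_nosync).2 ⟨_, hV.target⟩
  obtain ⟨w', hw', kp, hkp, rfl⟩ := hN v' hv' (by omega)
  have hlw := h.target.exits_le w' hw'.1
  obtain ⟨z₀, hz₀⟩ := (mem_exits_iff h.target.right_nosync).1 hw'.1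
  set m := kp + resetDelay Y am' ap' c' w' with hm
  simp only [List.length_append, List.length_replicate] at hl
  have hpos := hz₀.length_pos h.target.right_nosync
  -- the tail of `y'`, with `ap'` to its left
  have hy'm : ∀ i : ℤ, 0 ≤ i → i < w'.length → y' (c'.length + m + i) = z₀ i := fun i h1 h2 => by
    have h3 := hV.target.seg_eq.trans (h.target.seg_arc hz₀ m).symm
    rw [eq_of_seg_eq' h3 (l := c'.length + m + i) (by omega)
      (by simp only [List.length_append, List.length_replicate]; push_cast; omega),
      arc_of_le _ _ _ (by omega)]
    congr 1; ring
  -- The point `z` has the past `ap'^∞ w'` of `z₀` and the future of `y'`.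
  have hz := splice_mem hz₀.mem (shift_mem Y hV.target.mem (c'.length + m : ℤ)) hz₀.sync
    (by rw [shift_apply', hy'm _ (by omega) (by omega)])
  set z := splice z₀ (shift (c'.length + m : ℤ) y') (w'.length - 1) with hzdef
  have hz1 : ∀ i < (w'.length : ℤ), z i = z₀ i := fun i hi => splice_of_le _ _ (by omega)
  have hz2 : ∀ i ≥ 0, z i = y' (c'.length + m + i) := fun i hi => by
    rcases lt_or_ge i w'.length with h1 | h1
    · rw [hz1 i h1, hy'm i hi h1]
    · exact splice_of_lt _ _ (by omega)
  have hzE : IsExitPoint Y ap' w' z := by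
    refine ⟨hz, fun i hi => ?_, ?_, ?_, ?_, fun i hi => ?_⟩
    · rw [hz1 i (by omega), hz₀.tail i hi]
    · rw [hz1 0 (by omega)]; exact hz₀.ne
    · conv_rhs => rw [← hz₀.seg_eq]
      exact seg_congr' fun l _ h2 => hz1 l h2
    · rw [hz1 _ (by omega)]; exact hz₀.sync
    · rw [hz1 i (by omega)]; exact hz₀.nosync i hi
  have harc : arc o' c'.length z m = y' := by
    funext i
    rcases lt_or_ge i (c'.length + m) with h1 | h1
    · rw [arc_eq_of_tail h.target.o_right hzE.tail h1]
      rcases lt_or_ge i 0 with h2 | h2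
      · rw [h.target.o_left i h2, hV.target.tail i h2]
      · have h3 := hV.target.seg_eq.trans (h.target.seg_arc hz₀ m).symm
        rw [eq_of_seg_eq' h3 h2
          (by simp only [List.length_append, List.length_replicate]; push_cast; omega),
          arc_eq_of_tail h.target.o_right hz₀.tail h1]
    · rw [arc_of_le _ _ _ (by omega), hz2 _ (by omega)]
      congr 1; ring
  obtain ⟨w, u, d, hW⟩ := h.conj.symm.exists_isExitPair h.target.points.right_mem
    h.symm.map_right h.source.right_nosync hzE
  have hd := hW.le
  have hm' := h.symm.map_arc hzE.mem hzE.tail hW.map_eq hW.target.tail hd (q := m)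
    (by rw [Int.natAbs_neg]; omega) (by rw [harc]; exact hV.target.mem)
  rw [harc] at hm'
  obtain ⟨n, hn⟩ := Int.eq_ofNat_of_zero_le
    (show 0 ≤ (m : ℤ) + c'.length - c.length + d - -δ by omega)
  rw [hn] at hm'
  have hmem : arc o c.length u n ∈ X.carrier := by
    rw [hm']; exact shift_mem X (h.conj.inv_mem _ hV.target.mem) _
  have hex := h.source.isExitPoint_arc hW.target (kp := n) (by omega) hmem
  have hsh : arc o c.length u n = shift (-δ + b) y := by
    rw [hm', hVs.map_eq]
    funext i
    simp only [shift_apply']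
    congr 1; ring
  rw [hsh] at hex
  have hvw := hV.source.unique hex
  have hw : w ∈ resetExits X am ap c := h.symm.mem_resetExits hW hw'
  have hdw := hbD w hw.1
  -- The length of `v` makes the run `n` exceed the delay of `w`, so the remaining exponent is
  -- positive.
  exact ⟨w, hw, n - resetDelay X am ap c w, by omega, by
    rw [hvw, show n - resetDelay X am ap c w + resetDelay X am ap c w = n by omega]⟩

end TransportStructure

/-! ### Shape of the long words of `C(X)`, and the conclusion. -/

section LongWords

variable {A B : Type*} [TopologicalSpace A] [TopologicalSpace B] {X : Subshift A ℤ}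
  {Y : Subshift B ℤ} {f : (ℤ → A) → ℤ → B} {g : (ℤ → B) → ℤ → A} {r R : ℕ}
  {am ap : A} {c : List A} {o : ℤ → A} {K : ℕ} {am' ap' : B} {c' : List B} {o' : ℤ → B} {K' : ℕ}
  {δ : ℤ}

theorem exists_of_mem_synchroRel {p : List A × A} (hp : p ∈ synchroRel X) : ∃ z ∈ X.carrier,
    seg z 0 (p.1.length + 1) = p.1 ++ [p.2] ∧ z 0 ∈ synchro X ∧ z p.1.length ∈ synchro X ∧
    ∀ i : ℤ, 0 < i → i < p.1.length → z i ∉ synchro X := by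
  obtain ⟨⟨σ, d, h1, hσ, hd⟩, hp2, hL⟩ := hp
  obtain ⟨z, hz, hzs⟩ := exists_seg_of_mem_language hL 0
  simp only [List.length_append, List.length_singleton, zero_add, Nat.cast_add, Nat.cast_one]
    at hzs
  have h2 := hzs
  rw [seg_concat z (by omega)] at h2
  obtain ⟨h3, h4⟩ := List.append_inj' h2 rfl
  have h5 : 0 < p.1.length := by rw [h1]; simp
  rw [seg_cons z (by omega), h1] at h3
  simp only [List.cons.injEq] at h3 h4
  refine ⟨z, hz, hzs, by rw [h3.1]; exact hσ, by rw [h4.1]; exact hp2, fun i hi hi' => hd _ ?_⟩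
  rw [← h3.2, mem_seg]
  exact ⟨i, by omega, by rw [h1] at hi'; exact hi', rfl⟩

theorem mem_synchroRel_of_points {z : ℤ → A} (hz : z ∈ X.carrier) {i j : ℤ} (hij : i < j)
    (hi : z i ∈ synchro X) (hj : z j ∈ synchro X) (h : ∀ l, i < l → l < j → z l ∉ synchro X) :
    (seg z i j, z j) ∈ synchroRel X := by
  refine ⟨⟨_, _, seg_cons z hij, hi, fun τ hτ => ?_⟩, hj, ?_⟩
  · obtain ⟨l, h1, h2, rfl⟩ := mem_seg.1 hτ
    exact h l (by omega) h2
  · rw [← seg_concat z hij.le]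
    exact seg_mem_language hz _ _

variable [Finite A] [DiscreteTopology A] [Finite B] [DiscreteTopology B]

/-- Everything to the left of the run can be replaced by `a'^∞`, by splicing at the synchronizing
end of `v`. Under `g` this changes nothing from `α + r` on and makes all coordinates before `β - r`
equal to `a`. The word up to the first synchronizing symbol is thus an exit. -/
theorem IsSyncConj.exists_exit (h : IsSyncConj X Y f g r R) {a : A} {a' : B}
    (ha : (fun _ => a) ∈ X.carrier) (ha' : f (fun _ => a) 0 = a') (hs : a ∉ synchro X)
    (hs' : a' ∉ synchro Y) {y : ℤ → B} (hy : y ∈ Y.carrier) {α β : ℤ} (hαβ : α + 2 * r ≤ β)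
    (hrun : ∀ i, α ≤ i → i < β → y i = a') {v : List B} (hv : v ∈ exits Y a')
    (hseg : seg y β (β + v.length) = v) {n : ℤ} (hn : g y n ∈ synchro X)
    (hno : ∀ i, α + r ≤ i → i < n → g y i ∉ synchro X) (hαn : α + r ≤ n) :
    ∃ t, α + r ≤ t ∧ β - r ≤ t ∧ t ≤ n ∧ (∀ i, α + r ≤ i → i < t → g y i = a) ∧
      seg (g y) t (n + 1) ∈ exits X a := by
  subst ha'
  obtain ⟨u, hu⟩ := (mem_exits_iff hs').1 hv
  have hpos := hu.length_pos hs'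
  have huy : ∀ i, β ≤ i → i < β + v.length → u (-β + i) = y i := fun i h1 h2 => by
    rw [eq_of_seg_eq (hseg.trans hu.seg_eq.symm) h1 h2]
    congr 1; ring
  have hy2 := splice_mem (shift_mem Y hu.mem (-β)) hy (p := β + v.length - 1)
    (by rw [shift_apply']; convert hu.sync using 2; ring)
    (by rw [shift_apply', huy _ (by omega) (by omega)])
  set y₂ := splice (shift (-β) u) y (β + v.length - 1)
  have e1 : ∀ i < β, y₂ i = f (fun _ => a) 0 := fun i hi => by
    rw [show y₂ i = _ from splice_of_le _ _ (by omega), shift_apply', hu.tail _ (by omega)]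
  have e2 : ∀ i ≥ α, y₂ i = y i := fun i hi => by
    rcases lt_or_ge i β with h1 | h1
    · rw [e1 i h1, hrun i hi h1]
    rcases lt_or_ge i (β + v.length) with h2 | h2
    · rw [← huy i h1 h2]
      exact splice_of_le _ _ (by omega)
    · exact splice_of_lt _ _ (by omega)
  have z1 : ∀ i < β - r, g y₂ i = a := fun i hi => by
    rw [h.symm.map_apply_of_const (h.const_mem ha) hy2 fun l _ h1 => e1 l (by omega),
      h.inv_const ha]
  have z2 : ∀ i ≥ α + r, g y₂ i = g y i := fun i hi =>
    h.symm.map_eq' hy2 hy fun l h1 _ => e2 l (by omega)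
  obtain ⟨t, ⟨ht, htα⟩, htn, ht'⟩ := exists_first (P := fun i => g y i ≠ a ∧ α + r ≤ i) (p := n)
    (N := α + r) ⟨fun h1 => hs (by rw [← h1]; exact hn), hαn⟩ fun q hq => hq.2
  have hrun' : ∀ i, α + r ≤ i → i < t → g y i = a := fun i h1 h2 => by
    by_contra h3
    exact ht' i h2 ⟨h3, h1⟩
  have hβt : β - r ≤ t := by
    by_contra hlt
    exact ht (by rw [← z2 t htα, z1 t (by omega)])
  have hl := length_seg (g y) (show t ≤ n + 1 by omega)
  refine ⟨t, htα, hβt, htn, hrun', (mem_exits_iff hs).2 ⟨shift t (g y₂),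
    shift_mem X (h.inv_mem _ hy2) t, fun i hi => ?_, ?_, ?_, ?_, fun i hi => ?_⟩⟩
  · rw [shift_apply']
    rcases lt_or_ge (t + i) (β - r) with h1 | h1
    · exact z1 _ h1
    · rw [z2 _ (by omega), hrun' _ (by omega) (by omega)]
  · rw [shift_apply', z2 _ (by omega), add_zero]
    exact ht
  · rw [seg_shift, hl, add_zero, show t + (n + 1 - t) = n + 1 by ring]
    exact seg_congr' fun l h1 _ => z2 l (by omega)
  · rw [shift_apply', hl, show t + (n + 1 - t - 1) = n by ring, z2 n (by omega)]
    exact hn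
  · rw [shift_apply']
    rcases lt_or_ge (t + i) (β - r) with h1 | h1
    · rw [z1 _ h1]; exact hs
    · rw [z2 _ (by omega)]
      exact hno _ (by omega) (by omega)

theorem IsSyncConj.exists_entry (h : IsSyncConj X Y f g r R) {a : A} {a' : B}
    (ha : (fun _ => a) ∈ X.carrier) (ha' : f (fun _ => a) 0 = a') (hs : a ∉ synchro X)
    (hs' : a' ∉ synchro Y) {y : ℤ → B} (hy : y ∈ Y.carrier) {α β : ℤ} (hαβ : α + 2 * r ≤ β)
    (hrun : ∀ i, α ≤ i → i < β → y i = a') {e : List B} (he : e ∈ entries Y a')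
    (hseg : seg y (α - e.length) α = e) {n : ℤ} (hn : g y n ∈ synchro X)
    (hno : ∀ i, n < i → i < α + r → g y i ∉ synchro X) (hnβ : n < β - r) :
    ∃ s, n < s ∧ s ≤ α + r ∧ (∀ i, s ≤ i → i < β - r → g y i = a) ∧
      seg (g y) n s ∈ entries X a := by
  subst ha'
  obtain ⟨u, hu⟩ := (mem_entries_iff hs').1 he
  have hpos := hu.length_pos hs'
  have huy : ∀ i, α - e.length ≤ i → i < α → u (-α + i) = y i := fun i h1 h2 => by
    rw [eq_of_seg_eq (hseg.trans hu.seg_eq.symm) h1 h2]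
    congr 1; ring
  have hy2 := splice_mem hy (shift_mem Y hu.mem (-α)) (p := α - e.length)
    (by rw [← huy _ (by omega) (by omega)]; convert hu.sync using 2; ring)
    (by rw [shift_apply', huy _ (by omega) (by omega)])
  set y₂ := splice y (shift (-α) u) (α - e.length)
  have e1 : ∀ i ≥ α, y₂ i = f (fun _ => a) 0 := fun i hi => by
    rw [show y₂ i = _ from splice_of_lt _ _ (by omega), shift_apply', hu.tail _ (by omega)]
  have e2 : ∀ i < β, y₂ i = y i := fun i hi => by
    rcases le_or_gt α i with h1 | h1
    · rw [e1 i h1, hrun i h1 hi]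
    rcases le_or_gt i (α - e.length) with h2 | h2
    · exact splice_of_le _ _ h2
    · rw [← huy i (by omega) h1]
      exact splice_of_lt _ _ (by omega)
  have z1 : ∀ i ≥ α + r, g y₂ i = a := fun i hi => by
    rw [h.symm.map_apply_of_const (h.const_mem ha) hy2 fun l h1 _ => e1 l (by omega),
      h.inv_const ha]
  have z2 : ∀ i < β - r, g y₂ i = g y i := fun i hi =>
    h.symm.map_eq' hy2 hy fun l _ h1 => e2 l (by omega)
  obtain ⟨t, ⟨ht, htα⟩, htn, ht'⟩ := exists_last (P := fun i => g y i ≠ a ∧ i < β - r) (p := n)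
    (N := β - r) ⟨fun h1 => hs (by rw [← h1]; exact hn), hnβ⟩ fun q hq => hq.2.le
  have hrun' : ∀ i, t + 1 ≤ i → i < β - r → g y i = a := fun i h1 h2 => by
    by_contra h3
    exact ht' i (by omega) ⟨h3, h2⟩
  have hβt : t < α + r := by
    by_contra hlt
    exact ht (by rw [← z2 t htα, z1 t (by omega)])
  have hl := length_seg (g y) (show n ≤ t + 1 by omega)
  refine ⟨t + 1, by omega, by omega, hrun', (mem_entries_iff hs).2 ⟨shift (t + 1) (g y₂),
    shift_mem X (h.inv_mem _ hy2) (t + 1), fun i hi => ?_, ?_, ?_, ?_, fun i hi => ?_⟩⟩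
  · rw [shift_apply']
    rcases lt_or_ge (t + 1 + i) (β - r) with h1 | h1
    · rw [z2 _ h1, hrun' _ (by omega) h1]
    · exact z1 _ (by omega)
  · rw [shift_apply', z2 _ (by omega), show t + 1 + -1 = t by ring]
    exact ht
  · rw [seg_shift, hl, add_zero, show t + 1 + -(t + 1 - n) = n by ring]
    exact seg_congr' fun l _ h1 => z2 l (by omega)
  · rw [shift_apply', hl, show t + 1 + -(t + 1 - n) = n by ring, z2 n (by omega)]
    exact hn
  · rw [shift_apply']
    rcases lt_or_ge (t + 1 + i) (β - r) with h1 | h1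
    · rcases lt_or_ge (t + 1 + i) (α + r) with h2 | h2
      · rw [z2 _ h1]
        exact hno _ (by omega) h2
      · rw [z1 _ h2]; exact hs
    · rw [z1 _ (by omega)]; exact hs

/-- A long word of `C(X)` is carried to a long word of `C(Y)`, up to `R` at the ends. The
decomposition of the latter is pulled back: `e'` and the run of `am'` give an entry, the last run
and `v'` or `w'` give an exit, and the part around `c'` is mapped to a piece of the connecting point
`o`. -/
theorem IsBaseConj.long (h : IsBaseConj X Y f g r R am ap c o K am' ap' c' o' K' δ)
    (hS : HasCounterStructure Y am' ap' c') (W : ℕ) : ∃ N B : ℕ, ∀ p ∈ synchroRel X,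
      N < p.1.length → ∃ e ∈ entries X am, ∃ km ≥ W,
      (∃ v ∈ exits X am, v.length ≤ B ∧ p.1 ++ [p.2] = e ++ List.replicate km am ++ v) ∨
      ∃ w ∈ exits X ap, ∃ kp ≥ W,
        p.1 ++ [p.2] = e ++ List.replicate km am ++ (c ++ List.replicate kp ap ++ w) := by
  have hm := h.source.points.left_mem
  have hp := h.source.points.right_mem
  have hms := h.source.left_nosync
  have hps := h.source.right_nosync
  have hms' := h.target.left_nosync
  have hps' := h.target.right_nosync
  set C := 4 * r + 4 * δ.natAbs + 2 * c.length + 2 * c'.length + 2 * R + 1 with hC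
  obtain ⟨N, B, hlong⟩ := hS.long (W + C)
  refine ⟨N + 4 * R, B + R + r, fun p hpr hlen => ?_⟩
  obtain ⟨z, hz, hzs, hz0, hzn, hzno⟩ := exists_of_mem_synchroRel hpr
  set n : ℤ := (p.1.length : ℤ) with hn
  have hyY := h.conj.map_mem z hz
  have hgy : g (f z) = z := h.conj.left_inv z hz
  set y := f z with hy
  obtain ⟨q₀, hq1, hq2, hq3⟩ := h.conj.map_sync z hz 0 hz0
  obtain ⟨q₁, hq4, hq5, hq6⟩ := h.conj.map_sync z hz n hzn
  -- A synchronizing symbol of `y` strictly between `R` and `n - R` would force one of `z` strictly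
  -- between `0` and `n`. Hence `i₀` and `j₀` are consecutive.
  obtain ⟨i₀, ⟨hi1, hi2⟩, hi3, hi4⟩ := exists_last (P := fun q => y q ∈ synchro Y ∧ q ≤ R)
    (p := q₀) (N := R) ⟨hq3, by omega⟩ fun q hq => hq.2
  obtain ⟨j₀, ⟨hj1, hj2⟩, hj3, hj4⟩ := exists_first (P := fun q => y q ∈ synchro Y ∧ n - R ≤ q)
    (p := q₁) (N := n - R) ⟨hq6, by omega⟩ fun q hq => hq.2
  have hbetween : ∀ l, i₀ < l → l < j₀ → y l ∉ synchro Y := fun l h1 h2 h3 => by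
    rcases le_or_gt l R with h4 | h4
    · exact hi4 l h1 ⟨h3, h4⟩
    rcases le_or_gt (n - R) l with h5 | h5
    · exact hj4 l h2 ⟨h3, h5⟩
    obtain ⟨q, h6, h7, h8⟩ := h.conj.inv_sync y hyY l h3
    rw [hgy] at h8
    exact hzno q (by omega) (by omega) h8
  have hij : i₀ < j₀ := by omega
  have hrel := mem_synchroRel_of_points hyY hij hi1 hj1 hbetween
  have hl := length_seg y hij.le
  obtain ⟨e', he', km', hkm', hcase⟩ := hlong _ hrel (by simp only; omega)
  simp only [← seg_concat y hij.le] at hcase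
  have hsplit : ∃ v', EndsSynchronizing Y v' ∧
      seg y i₀ (j₀ + 1) = e' ++ List.replicate km' am' ++ v' := by
    rcases hcase with ⟨v', hv', -, e⟩ | ⟨w', hw', kp', -, e⟩
    · exact ⟨v', endsSynchronizing_exits hv', e⟩
    · exact ⟨_, h.target.endsSynchronizing_arc hw', e⟩
  obtain ⟨v', hv'E, hv'⟩ := hsplit
  obtain ⟨s1, s2, s3⟩ := seg_eq_append (by omega) hv'
  obtain ⟨s4, s5, s6⟩ := seg_eq_append (by omega) s1
  simp only [List.length_append, List.length_replicate, Nat.cast_add] at s2 s3 s5 s6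
  have hv'pos : 0 < v'.length := by
    obtain ⟨d, σ, rfl, -, -⟩ := hv'E
    simp
  set α : ℤ := i₀ + e'.length with hα
  set m : ℤ := α + km' with hmdef
  rw [← add_assoc] at s2 s3 s5
  have hrun : ∀ i, α ≤ i → i < m → y i = am' := fun i h1 h2 => eq_of_seg_eq_replicate s5 h1 h2
  obtain ⟨s, hs1, hs2, hs3, hs4⟩ := h.conj.exists_entry hm h.map_left hms hms' hyY (α := α)
    (β := m) (by omega) hrun he' (by rw [hα, add_sub_cancel_right]; exact s4) (n := 0)
    (by rw [hgy]; exact hz0) (fun i h1 h2 => by rw [hgy]; exact hzno i h1 (by omega)) (by omega)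
  rw [hgy] at hs3 hs4
  have hzno' : ∀ i, α + r ≤ i → i < n → z i ∉ synchro X := fun i h1 h2 => hzno i (by omega) h2
  rcases hcase with ⟨v, hv, hvB, e⟩ | ⟨w', hw', kp', hkp', e⟩
  · obtain rfl : v = v' := List.append_cancel_left (e.symm.trans hv')
    obtain ⟨t, ht1, ht2, ht3, ht4, ht5⟩ := h.conj.exists_exit hm h.map_left hms hms' hyY
      (α := α) (β := m) (by omega) hrun hv (by rw [s3]; exact s2) (n := n)
      (by rw [hgy]; exact hzn) (by rw [hgy]; exact hzno') (by omega)
    rw [hgy] at ht4 ht5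
    refine ⟨_, hs4, (t - s).toNat, by omega, Or.inl ⟨_, ht5, ?_, ?_⟩⟩
    · have := length_seg z (show t ≤ n + 1 by omega)
      omega
    · rw [← hzs, ← seg_append z (show 0 ≤ t by omega) (by omega),
        ← seg_append z hs1.le (show s ≤ t by omega)]
      congr 2
      refine seg_eq_replicate fun l h1 h2 => ?_
      rcases lt_or_ge l (m - r) with h3 | h3
      · exact hs3 l h1 h3
      · exact ht4 l (by omega) h2
  · obtain rfl : c' ++ List.replicate kp' ap' ++ w' = v' :=
      List.append_cancel_left (e.symm.trans hv')
    obtain ⟨t1, t2, t3⟩ := seg_eq_append (by omega) s2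
    obtain ⟨t4, t5, t6⟩ := seg_eq_append (by omega) t1
    simp only [List.length_append, List.length_replicate, Nat.cast_add] at t2 t3 t5 t6
    rw [← add_assoc] at t2 t3 t5
    have hrun2 : ∀ i, m + c'.length ≤ i → i < m + c'.length + kp' → y i = ap' :=
      fun i h1 h2 => eq_of_seg_eq_replicate t5 h1 h2
    have hw'pos : 0 < w'.length := by
      obtain ⟨σ, d, -, -, rfl⟩ := hw'
      simp
    obtain ⟨t, ht1, ht2, ht3, ht4, ht5⟩ := h.conj.exists_exit hp h.map_right hps hps' hyY
      (α := m + c'.length) (β := m + c'.length + kp') (by omega) hrun2 hw'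
      (by rw [t3]; exact t2) (n := n) (by rw [hgy]; exact hzn)
      (by rw [hgy]; exact fun i h1 h2 => hzno i (by omega) h2) (by omega)
    rw [hgy] at ht4 ht5
    -- From the first run to the end of the second one, `y` is a translate of `o'`. Pulled back, the
    -- word `c` begins at `m - δ` in `z`.
    have hyo : ∀ l, α ≤ l → l < m + c'.length + kp' → y l = o' (l + -m) := fun l h1 h2 => by
      rcases lt_or_ge l m with h3 | h3
      · rw [hrun l h1 h3, h.target.o_left _ (by omega)]
      rcases lt_or_ge l (m + c'.length) with h4 | h4
      · rw [eq_of_seg_eq (t4.trans h.target.o_seg.symm) h3 h4]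
        congr 1; ring
      · rw [hrun2 l h4 h2, h.target.o_right _ (by omega)]
    have hzo : ∀ i, α + r ≤ i → i < m + c'.length + kp' - r → z i = o (i + -(m - δ)) :=
      fun i h1 h2 => by
        rw [← hgy, h.conj.symm.map_eq hyY h.target.o_mem (-m) fun l h3 h4 =>
          hyo l (by omega) (by omega), h.symm.map_conn, shift_apply']
        congr 1; ring
    refine ⟨_, hs4, (m - δ - s).toNat, by omega, Or.inr ⟨_, ht5,
      (t - (m - δ + c.length)).toNat, by omega, ?_⟩⟩
    rw [← hzs, ← seg_append z (show 0 ≤ m - δ by omega) (by omega),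
      ← seg_append z hs1.le (show s ≤ m - δ by omega),
      ← seg_append z (show m - δ ≤ t by omega) (by omega),
      ← seg_append z (show m - δ ≤ m - δ + c.length by omega) (show _ ≤ t by omega)]
    congr 2
    · refine seg_eq_replicate fun l h1 h2 => ?_
      rcases lt_or_ge l (m - r) with h3 | h3
      · exact hs3 l h1 h3
      · rw [hzo l (by omega) (by omega), h.source.o_left _ (by omega)]
    · congr 1
      · conv_rhs => rw [← h.source.o_seg]
        rw [seg_congr (y := o) (d := -(m - δ)) fun l h1 h2 => hzo l (by omega) (by omega)]
        congr 1 <;> ring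
      · refine seg_eq_replicate fun l h1 h2 => ?_
        rcases lt_or_ge l (m + c'.length + r) with h3 | h3
        · rw [hzo l (by omega) (by omega), h.source.o_right _ (by omega)]
        · exact ht4 l h3 h2

theorem IsBaseConj.hasCounterStructure
    (h : IsBaseConj X Y f g r R am ap c o K am' ap' c' o' K' δ)
    (hS : HasCounterStructure Y am' ap' c') : HasCounterStructure X am ap c :=
  ⟨h.reset hS, h.short_exit hS, h.reset_iff hS, h.counter_iff hS, h.long hS⟩

/-- The image of the connecting point of `X` lies in the single orbit of connecting points of `Y`;
this provides the translation `δ`. -/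
theorem IsSyncConj.isStandardOneCounterShift (h : IsSyncConj X Y f g r R)
    (hX : IsStronglySynchronizing X) (hY : IsStandardOneCounterShift Y) :
    IsStandardOneCounterShift X := by
  obtain ⟨hYs, am', ap', c', hY1, hY2, hY3, hY4, I', P', hP'⟩ := hY
  obtain ⟨o', K', hYB⟩ := exists_isBase hYs hY1.1 hY2 hY3
  have hchar := h.symm.isCharacteristicPair hYs hX hY1
  have hl := h.symm.inv_const hYB.points.left_mem
  have hr := h.symm.inv_const hYB.points.right_mem
  set am := g (fun _ => am') 0
  set ap := g (fun _ => ap') 0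
  have hpts := (satisfiesABC_iff hX).1 hchar.1
  have hno := hpts.nosync
  have hnorec : ∀ x ∈ X.carrier, RightAsymptotic x ap → ∀ p, x p ∉ synchro X :=
    fun x hx hxr p hp => by
      obtain ⟨q, -, -, hq⟩ := h.map_sync x hx p hp
      have := h.rightAsymptotic hpts.right_mem hx hxr
      rw [hr] at this
      exact hYB.norec _ (h.map_mem x hx) this q hq
  have hsig := (sigmaMinusPlus_eq_empty_iff hno.2).2 hnorec
  obtain ⟨c, hc⟩ := exists_isConnectingWord hX hpts (hpts.ne hnorec)
  obtain ⟨o, K, hXB⟩ := exists_isBase hX hchar.1 hc hsig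
  have hfl := h.leftAsymptotic hpts.left_mem hXB.o_mem
    ⟨-1, fun i hi => hXB.o_left i (by omega)⟩
  have hfr := h.rightAsymptotic hpts.right_mem hXB.o_mem ⟨c.length, hXB.o_right⟩
  rw [hl] at hfl
  rw [hr] at hfr
  obtain ⟨δ, hδ⟩ := hYB.points.unique (f o) (h.map_mem o hXB.o_mem) hfl hfr
    (h.nosync hXB.o_mem hXB.o_nosync) o' hYB.o_mem ⟨-1, fun i hi => hYB.o_left i (by omega)⟩
    ⟨c'.length, hYB.o_right⟩ hYB.o_nosync
  have hB : IsBaseConj X Y f g r R am ap c o K am' ap' c' o' K' δ := ⟨h, hXB, hYB, hl, hr, hδ⟩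
  have hS := hB.hasCounterStructure (hYB.hasCounterStructure hY4 hP')
  exact ⟨hX, am, ap, c, hchar, hc, hsig, hS.resetCondition, hXB.exists_areParameters hS⟩

end LongWords

end OneCounter

theorem theorem3p11 {A B : Type*}
    [Finite A] [TopologicalSpace A] [DiscreteTopology A]
    [Finite B] [TopologicalSpace B] [DiscreteTopology B]
    (X : SymbolicDynamics.FullShift.Subshift A ℤ)
    (Y : SymbolicDynamics.FullShift.Subshift B ℤ)
    (hY : OneCounter.IsStandardOneCounterShift Y)
    (hXY : OneCounter.TopologicallyConjugate X Y) :
    ∃ n₀ : ℕ, ∀ n ≥ n₀,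
      OneCounter.IsStandardOneCounterShift (OneCounter.higherBlock X n) ∧
      (∃ C, OneCounter.IsCanonicalMarkovCode (OneCounter.higherBlock X n) C) ∧
      ∀ C, OneCounter.IsCanonicalMarkovCode (OneCounter.higherBlock X n) C →
        OneCounter.higherBlock X n = C.codedSystem := by
  have hX : X.carrier.Nonempty := by
    obtain ⟨y, hy, -⟩ := hY.1.exists_synchro
    obtain ⟨φ, -⟩ := hXY
    exact ⟨_, (φ.symm ⟨y, hy⟩).2⟩
  obtain ⟨f, g, r, h⟩ := OneCounter.exists_isConj hX hXY
  -- From this block length on, a synchronizing window of `X` fits into one symbol.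
  refine ⟨4 * r + 1, fun n hn => ?_⟩
  have hs := h.isStronglySynchronizing_higherBlock hY.1 hn
  obtain ⟨R, hR⟩ := ((OneCounter.isConj_higherBlock X (show 0 < n by omega)).trans
    h).exists_isSyncConj hs hY.1
  have hstd := hR.isStandardOneCounterShift hs hY
  refine ⟨hstd, OneCounter.exists_isCanonicalMarkovCode hstd fun am ap c h1 h2 h3 => ?_,
    fun C hC => OneCounter.eq_codedSystem_of_isCanonicalMarkovCode hs hC⟩
  obtain ⟨o, K, hB⟩ := OneCounter.exists_isBase hs h1.1 h2 h3
  exact hB.entries_nonempty
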